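/- Let $\mathbb T=\mathbb R/2\pi\mathbb Z$, let $\oint$ denote the integral over one period, and let $c_*=\frac{\pi}{2\sqrt2}$. The peaked traveling wave $\eta_*$ is the $2\pi$-periodic function with $$\eta_*(x)=\tfrac1{16}\left(\pi^2-4\pi|x|+2x^2\right),\qquad \eta_*'(x)=-\tfrac14(\pi-|x|)\,\mathrm{sign}(x),\qquad x\in(-\pi,\pi].$$ For $f\in L^1(\mathbb T)$ let $\Pi_0\partial_x^{-1}\Pi_0 f$ be the zero-mean $2\pi$-periodic primitive of $f-\frac1{2\pi}\oint f\,dx$. Perturbations $\zeta(t,x)$ of the peaked wave, in the frame in which the peak is located at $x=0$, satisfy the evolution equation $$2c_*\,\partial_t\zeta=(c_*^2-2\eta_*)\,\partial_x\zeta-2\left(\zeta-\zeta|_{x=0}\right)\partial_x\zeta-\frac1\pi\oint\eta_*'\,\zeta\,dx+\frac12\,\Pi_0\partial_x^{-1}\Pi_0\left[\zeta+2(\partial_x\zeta)^2\right].\qquad(1)$$ A local solution of (1) on $(-\tau,\tau)$, $\tau>0$, is a function $$\zeta\in C^0\left((-\tau,\tau),H^1_{\rm per}(\mathbb T)\cap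 W^{1,\infty}(\mathbb T)\right)\cap C^1\left((-\tau,\tau),L^2(\mathbb T)\cap L^\infty(\mathbb T)\right)$$ that satisfies (1) for every $t\in(-\tau,\tau)$ and almost every $x\in\mathbb T$. Here derivatives in $x$ are weak derivatives, elements of $H^1_{\rm per}(\mathbb T)$ are identified with their continuous representatives, and $\|f\|_{H^1_{\rm per}}=(\|f\|_{L^2}^2+\|f'\|_{L^2}^2)^{1/2}$, $\|f\|_{W^{1,\infty}}=\|f\|_{L^\infty}+\|f'\|_{L^\infty}$. **Theorem (nonlinear instability of the peaked wave).** For every $\delta>0$ there exists $\zeta_0\in H^1_{\rm per}(\mathbb T)\cap W^{1,\infty}(\mathbb T)$ satisfying $$\|\zeta_0\|_{H^1_{\rm per}}\le\delta^2,\qquad\|\zeta_0\|_{W^{1,\infty}}\le\delta,$$ and the constraint $\frac12\oint\left[\zeta_0+2(\partial_x\zeta_0)^2\right]dx+\pi\,\zeta_0(0)=0$, for which there are $\tau_0>0$ and a local solution $\zeta$ of (1) on $(-\tau_0,\tau_0)$ with $\zeta|_{t=0}=\zeta_0$ such that $\zeta$ is unique (every local solution on an interval $(-\tau_1,\tau_1)$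 with the same initial value agrees with $\zeta$ for $|t|<\min\{\tau_0,\tau_1\}$) and $$\|\zeta(t_0,\cdot)\|_{W^{1,\infty}}=1\qquad\text{for some }t_0\in(0,\tau_0).$$ -/

import Mathlib

open Real Set Filter Topology MeasureTheory
open scoped ENNReal ContDiff

namespace PeakedWave

/-! Functions on the circle of length `2π` are `2π`-periodic functions on the real line, and
`∮` is the integral over `(0, 2π]`. -/

/-- Lebesgue measure on one period. -/
noncomputable def per : Measure ℝ := volume.restrict (Ioc 0 (2 * π))

/-- `g` is a weak derivative of the `2π`-periodic function `f` on the circle: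
`f` and `g` are integrable over a period, `g` is `2π`-periodic, and
`∮ f φ' dx = - ∮ g φ dx` for all smooth `2π`-periodic `φ`. -/
def IsWeakDeriv (f g : ℝ → ℝ) : Prop :=
  Integrable f per ∧ Function.Periodic g (2 * π) ∧ Integrable g per ∧
    ∀ φ : ℝ → ℝ, ContDiff ℝ ∞ φ → Function.Periodic φ (2 * π) →
      ∫ x, f x * deriv φ x ∂per = - ∫ x, g x * φ x ∂per

/-- Periodic extension of a function that is supported inside a period. -/
theorem exists_periodic_extension (φ : ℝ → ℝ) (hφ : ContDiff ℝ ∞ φ)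
    (hs : tsupport φ ⊆ Ioo 0 (2 * π)) :
    ∃ ψ : ℝ → ℝ, ContDiff ℝ ∞ ψ ∧ Function.Periodic ψ (2 * π) ∧
      ∀ x ∈ Ioc 0 (2 * π), ψ x = φ x := by
  have hp : (0 : ℝ) < 2 * π := two_pi_pos
  have key : ∀ (k : ℤ) (x : ℝ), x - k • (2 * π) ∈ Ioc 0 (2 * π) →
      toIocMod hp 0 x = x - k • (2 * π) := by
    intro k x hx
    rw [toIocMod_eq_iff]
    refine ⟨by simpa using hx, k, by ring⟩
  have out : ∀ y : ℝ, y ∉ Ioo 0 (2 * π) → φ y = 0 := fun y hy =>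
    image_eq_zero_of_notMem_tsupport fun h => hy (hs h)
  refine ⟨fun x => φ (toIocMod hp 0 x), ?_, ?_, ?_⟩
  · rw [contDiff_iff_contDiffAt]
    intro x
    have hmem := toIocMod_mem_Ioc hp 0 x
    have hdec : toIocMod hp 0 x = x - toIocDiv hp 0 x • (2 * π) := rfl
    set k := toIocDiv hp 0 x with hk
    rw [hdec] at hmem
    simp only [zero_add] at hmem
    have hloc : ContDiffAt ℝ ∞ (fun z => φ (z - k • (2 * π))) x :=
      (hφ.comp (contDiff_id.sub contDiff_const)).contDiffAt
    rcases lt_or_eq_of_le hmem.2 with hlt | heq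
    · refine hloc.congr_of_eventuallyEq ?_
      have : ∀ᶠ z in 𝓝 x, z - k • (2 * π) ∈ Ioo 0 (2 * π) :=
        (continuous_id.sub continuous_const).continuousAt.eventually_mem
          (isOpen_Ioo.mem_nhds ⟨hmem.1, hlt⟩)
      filter_upwards [this] with z hz
      rw [key k z ⟨hz.1, hz.2.le⟩]
    · have h0 : (0 : ℝ) ∉ tsupport φ := fun h => lt_irrefl _ (hs h).1
      have h1 : (2 * π : ℝ) ∉ tsupport φ := fun h => lt_irrefl _ (hs h).2
      have e0 : φ =ᶠ[𝓝 0] 0 := notMem_tsupport_iff_eventuallyEq.mp h0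
      have e1 : φ =ᶠ[𝓝 (2 * π)] 0 := notMem_tsupport_iff_eventuallyEq.mp h1
      have c1 : Tendsto (fun z : ℝ => z - k • (2 * π)) (𝓝 x) (𝓝 (2 * π)) := by
        have : ContinuousAt (fun z : ℝ => z - k • (2 * π)) x := by fun_prop
        rw [ContinuousAt, heq] at this
        exact this
      have c0 : Tendsto (fun z : ℝ => z - (k + 1) • (2 * π)) (𝓝 x) (𝓝 0) := by
        have : ContinuousAt (fun z : ℝ => z - (k + 1) • (2 * π)) x := by fun_prop
        have h2 : x - (k + 1) • (2 * π) = 0 := by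
          rw [add_smul, one_smul]; linarith
        rw [ContinuousAt, h2] at this
        exact this
      refine (contDiffAt_const (c := (0 : ℝ))).congr_of_eventuallyEq ?_
      have i1 : ∀ᶠ z in 𝓝 x, z - k • (2 * π) ∈ Ioi (0 : ℝ) :=
        c1.eventually_mem (Ioi_mem_nhds hp)
      have i0 : ∀ᶠ z in 𝓝 x, z - (k + 1) • (2 * π) ∈ Iio (2 * π) :=
        c0.eventually_mem (Iio_mem_nhds hp)
      filter_upwards [c1.eventually e1, c0.eventually e0, i1, i0] with z a1 a0 b1 b0
      rcases le_or_gt (z - k • (2 * π)) (2 * π) with hz | hz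
      · rw [key k z ⟨b1, hz⟩]; exact a1
      · have h3 : z - (k + 1) • (2 * π) = z - k • (2 * π) - 2 * π := by
          rw [add_smul, one_smul]; ring
        rw [key (k + 1) z ⟨by rw [h3]; linarith, le_of_lt b0⟩]; exact a0
  · intro x
    simp only [toIocMod_add_right]
  · intro x hx
    have := key 0 x (by simpa using hx)
    simp only [zero_smul, sub_zero] at this
    simp only [this]

/-- Weak derivatives are unique almost everywhere, so that `weakDeriv` below is well defined. -/
theorem IsWeakDeriv.ae_eq {f g₁ g₂ : ℝ → ℝ} (h₁ : IsWeakDeriv f g₁) (h₂ : IsWeakDeriv f g₂) :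
    g₁ =ᵐ[per] g₂ := by
  have hint : Integrable (g₁ - g₂) per := h₁.2.2.1.sub h₂.2.2.1
  have hloc : LocallyIntegrableOn (g₁ - g₂) (Ioo 0 (2 * π)) volume :=
    IntegrableOn.locallyIntegrableOn
      (IntegrableOn.mono_set (show IntegrableOn (g₁ - g₂) (Ioc 0 (2 * π)) volume from hint)
        Ioo_subset_Ioc_self)
  have hz := isOpen_Ioo.ae_eq_zero_of_integral_contDiff_smul_eq_zero hloc (by
    intro φ hφ _ hs
    obtain ⟨ψ, hψ, hper, heq⟩ := exists_periodic_extension φ hφ hs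
    have hb : ∀ x, φ x • (g₁ - g₂) x
        = (Ioc 0 (2 * π)).indicator (fun x => φ x • (g₁ - g₂) x) x := by
      intro x
      by_cases hx : x ∈ Ioc 0 (2 * π)
      · rw [indicator_of_mem hx]
      · rw [indicator_of_notMem hx,
          image_eq_zero_of_notMem_tsupport (f := φ)
            fun h => hx (Ioo_subset_Ioc_self (hs h)), zero_smul]
    rw [integral_congr_ae (ae_of_all _ hb), integral_indicator measurableSet_Ioc]
    have hc : ∫ x in Ioc 0 (2 * π), φ x • (g₁ - g₂) x
        = ∫ x, (g₁ x * ψ x - g₂ x * ψ x) ∂per := by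
      refine setIntegral_congr_fun measurableSet_Ioc fun x hx => ?_
      simp only [heq x hx, smul_eq_mul, Pi.sub_apply]; ring
    obtain ⟨C, hC⟩ : ∃ C, ∀ x ∈ Icc 0 (2 * π), ‖ψ x‖ ≤ C :=
      isCompact_Icc.exists_bound_of_continuousOn hψ.continuous.continuousOn
    have hCae : ∀ᵐ x ∂per, ‖ψ x‖ ≤ C :=
      (ae_restrict_mem measurableSet_Ioc).mono fun x hx => hC x (Ioc_subset_Icc_self hx)
    have hm : AEStronglyMeasurable ψ per := hψ.continuous.aestronglyMeasurable
    rw [hc, integral_sub (h₁.2.2.1.mul_bdd hm hCae) (h₂.2.2.1.mul_bdd hm hCae)]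
    have e₁ := h₁.2.2.2 ψ hψ hper
    have e₂ := h₂.2.2.2 ψ hψ hper
    linarith)
  have : ∀ᵐ x ∂(volume.restrict (Ioo 0 (2 * π))), g₁ x = g₂ x := by
    rw [ae_restrict_iff' measurableSet_Ioo]
    filter_upwards [hz] with x hx hm
    exact sub_eq_zero.mp (hx hm)
  rw [Filter.EventuallyEq, per, ← restrict_Ioo_eq_restrict_Ioc]
  exact this

open Classical in
/-- The weak derivative `∂ₓ f` on the circle (zero if there is none). -/
noncomputable def weakDeriv (f : ℝ → ℝ) : ℝ → ℝ :=
  if h : ∃ g, IsWeakDeriv f g then h.choose else 0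

/-- `f ∈ H¹_per`. The elements of this space are represented by their continuous
representatives, so that point values make sense. -/
def MemH1per (f : ℝ → ℝ) : Prop :=
  Function.Periodic f (2 * π) ∧ Continuous f ∧ MemLp f 2 per ∧
    ∃ g, IsWeakDeriv f g ∧ MemLp g 2 per

/-- `f ∈ W^{1,∞}` on the circle. -/
def MemW1inf (f : ℝ → ℝ) : Prop :=
  Function.Periodic f (2 * π) ∧ MemLp f ∞ per ∧ ∃ g, IsWeakDeriv f g ∧ MemLp g ∞ per

/-- The norm `(‖f‖²_{L²} + ‖∂ₓ f‖²_{L²})^{1/2}` of `H¹_per`. -/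
noncomputable def normH1 (f : ℝ → ℝ) : ℝ≥0∞ :=
  (eLpNorm f 2 per ^ 2 + eLpNorm (weakDeriv f) 2 per ^ 2) ^ (1 / 2 : ℝ)

/-- The norm `‖f‖_{L^∞} + ‖∂ₓ f‖_{L^∞}` of `W^{1,∞}`. -/
noncomputable def normW1inf (f : ℝ → ℝ) : ℝ≥0∞ :=
  eLpNorm f ∞ per + eLpNorm (weakDeriv f) ∞ per

/-- The speed `c_* = π / (2 √2)` of the peaked wave. -/
noncomputable def cStar : ℝ := π / (2 * √2)

/-- The representative of `x` modulo `2π` in `(-π, π]`. -/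
noncomputable def rep (x : ℝ) : ℝ := toIocMod two_pi_pos (-π) x

/-- The peaked profile `η_*`. -/
noncomputable def etaStar (x : ℝ) : ℝ := (π ^ 2 - 4 * π * |rep x| + 2 * rep x ^ 2) / 16

/-- The slope `η_*'` of the peaked profile. -/
noncomputable def etaStar' (x : ℝ) : ℝ := -(1 / 4) * (π - |rep x|) * SignType.sign (rep x)

/-- The mean value of a periodic function. -/
noncomputable def mean (f : ℝ → ℝ) : ℝ := (2 * π)⁻¹ * ∫ x, f x ∂per

/-- `Π₀ ∂ₓ⁻¹ Π₀ f`: the zero-mean periodic primitive of `f - mean f`. -/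
noncomputable def primZero (f : ℝ → ℝ) (x : ℝ) : ℝ :=
  (∫ y in (0)..x, (f y - mean f)) - mean fun z => ∫ y in (0)..z, (f y - mean f)

/-- The right-hand side of the evolution equation of perturbations to the peaked wave,
`(c_*² - 2 η_*) ζ' - 2 (ζ - ζ(0)) ζ' - π⁻¹ ∮ η_*' ζ dx + ½ Π₀ ∂ₓ⁻¹ Π₀ [ζ + 2 (ζ')²]`. -/
noncomputable def evolutionRHS (z : ℝ → ℝ) (x : ℝ) : ℝ :=
  (cStar ^ 2 - 2 * etaStar x) * weakDeriv z x
    - 2 * (z x - z 0) * weakDeriv z x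
    - π⁻¹ * (∫ y, etaStar' y * z y ∂per)
    + 1 / 2 * primZero (fun y => z y + 2 * weakDeriv z y ^ 2) x

/-- `w` is the derivative of the curve `u`, which is `C¹` on `(-τ, τ)` with values
in `L^p` of the circle. -/
def IsC1Deriv (p : ℝ≥0∞) (τ : ℝ) (u w : ℝ → ℝ → ℝ) : Prop :=
  ∀ t ∈ Ioo (-τ) τ, MemLp (u t) p per ∧ MemLp (w t) p per ∧
    Tendsto (fun h : ℝ => eLpNorm (fun x => h⁻¹ * (u (t + h) x - u t x) - w t x) p per)
      (𝓝[≠] 0) (𝓝 0) ∧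
    Tendsto (fun s : ℝ => eLpNorm (fun x => w s x - w t x) p per) (𝓝 t) (𝓝 0)

/-- `ζ ∈ C⁰((-τ, τ), H¹_per ∩ W^{1,∞}) ∩ C¹((-τ, τ), L² ∩ L^∞)` is a local solution of the
evolution equation `2 c_* ∂ₜ ζ = evolutionRHS ζ`. -/
structure IsLocalSolution (τ : ℝ) (ζ : ℝ → ℝ → ℝ) : Prop where
  mem : ∀ t ∈ Ioo (-τ) τ, MemH1per (ζ t) ∧ MemW1inf (ζ t)
  continuous_H1 : ∀ t ∈ Ioo (-τ) τ,
    Tendsto (fun s => normH1 (fun x => ζ s x - ζ t x)) (𝓝 t) (𝓝 0)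
  continuous_W1inf : ∀ t ∈ Ioo (-τ) τ,
    Tendsto (fun s => normW1inf (fun x => ζ s x - ζ t x)) (𝓝 t) (𝓝 0)
  equation : ∃ w : ℝ → ℝ → ℝ, IsC1Deriv 2 τ ζ w ∧ IsC1Deriv ∞ τ ζ w ∧
    ∀ t ∈ Ioo (-τ) τ, ∀ᵐ x ∂per, 2 * cStar * w t x = evolutionRHS (ζ t) x

end PeakedWave

namespace PeakedWave

/-! ### Weak derivatives on the circle -/

/-! On `[0, 2π]` the peak sits at both ends, and the equation is a transport equation with speed V =
x(2π - x)/4 - 2(ζ - ζ(0)), which vanishes at the peak, plus a nonlocal source. Differentiating in x,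
the slope q = ∂ₓζ along the characteristics X' = -V/(2c_*) satisfies 2c_* q' = (π - X)/2 · q - q² +
(ζ/2 - M), where M is the mean of ζ/2 + (∂ₓζ)². The characteristic through the peak is stationary.
There the linear term is (π/2) q, so a negative slope grows exponentially, and -q² only helps
(`q_zero_le`). The energy E = ∮ q² dx, in contrast, grows at most like e^|t| whatever the size of
the negative slope, because its cubic terms cancel (`hasDerivAt_energy`), and the forcing ζ/2 - M is
at most a multiple of √E (`abs_forcing_le`). So a negative spike of slope at the peak, of height
comparable to δ but so thin that its energy is negligible, grows until the slope has size 2. On the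
way the W^{1,∞} norm passes through 1.

Existence. In the variables (J, q, ζ(0)), with J the Jacobian of the flow, no derivative is lost:
the equation is an ordinary differential equation with locally Lipschitz field on a Banach space
(`bddLip_lagField`). Periodicity and positivity of J are propagated by Grönwall arguments
(`periodic_aux`, `J_pos`), and inverting the flow gives the local solution
(`IsLagSol.isLocalSolution`). The time interval has to be symmetric about zero. Backward in time the
slopes near the peak are damped (`neg_q_le_of_nonpos`) and the others start tiny, so it is forward
in time that the slope reaches size 2 (`IsSmallDatum.exists_isLagSol`).

Uniqueness. A competitor is only W^{1,∞} in space. If the speed is positive away from the peak, the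
equation can be solved for the slope, so both solutions are differentiable there and satisfy the
equation along curves (`IsLocalSolution.exists_slope`). The constructed solution has a Lipschitz
slope, so along the characteristics of the competitor the difference is controlled in the Lipschitz
norm without loss (`IsLocalSolution.contraction`). Positivity of the speed needs q ≤ π/16 everywhere
and q ≥ -π/16 on the right half of the period only. This is why the spike may be large and negative,
and why it is placed just to the right of the peak. -/

theorem integral_per (f : ℝ → ℝ) : ∫ x, f x ∂per = ∫ x in (0)..(2 * π), f x := by
  rw [intervalIntegral.integral_of_le two_pi_pos.le, per]

theorem intervalIntegrable_of_per {f : ℝ → ℝ} (hf : Integrable f per) :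
    IntervalIntegrable f volume 0 (2 * π) :=
  (intervalIntegrable_iff_integrableOn_Ioc_of_le two_pi_pos.le).2 hf

theorem intervalIntegrable_of_per_of_mem {f : ℝ → ℝ} (hf : Integrable f per) {a b : ℝ}
    (ha : a ∈ Icc 0 (2 * π)) (hb : b ∈ Icc 0 (2 * π)) : IntervalIntegrable f volume a b :=
  (intervalIntegrable_of_per hf).mono_set (by
    rw [uIcc_of_le two_pi_pos.le]; exact uIcc_subset_Icc ha hb)

instance : IsFiniteMeasure per := by unfold per; infer_instance

theorem integrable_per_of_continuousOn {f : ℝ → ℝ} (hf : ContinuousOn f (Icc 0 (2 * π))) :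
    Integrable f per :=
  (hf.integrableOn_Icc).mono_set Ioc_subset_Icc_self

theorem ae_per_iff {p : ℝ → Prop} :
    (∀ᵐ x ∂per, p x) ↔ ∀ᵐ x, x ∈ Ioc 0 (2 * π) → p x :=
  ae_restrict_iff' measurableSet_Ioc

theorem ae_per_of_forall {p : ℝ → Prop} (h : ∀ x ∈ Ioo 0 (2 * π), p x) : ∀ᵐ x ∂per, p x := by
  rw [per, ← restrict_Ioo_eq_restrict_Ioc]
  exact (ae_restrict_mem measurableSet_Ioo).mono h

theorem eqOn_Icc_of_ae_eq_per {f g : ℝ → ℝ} (h : f =ᵐ[per] g)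
    (hf : ContinuousOn f (Icc 0 (2 * π))) (hg : ContinuousOn g (Icc 0 (2 * π))) :
    EqOn f g (Icc 0 (2 * π)) := by
  refine Measure.eqOn_Icc_of_ae_eq volume two_pi_pos.ne ?_ hf hg
  rw [← restrict_Ioc_eq_restrict_Icc]
  exact h

theorem hasDerivAt_integral_zero {ψ : ℝ → ℝ} (hψ : Continuous ψ) (x : ℝ) :
    HasDerivAt (fun y => ∫ s in (0)..y, ψ s) (ψ x) x :=
  intervalIntegral.integral_hasDerivAt_right (hψ.intervalIntegrable _ _)
    (hψ.stronglyMeasurableAtFilter _ _) hψ.continuousAt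

/-- A continuous function with a weak derivative is the primitive of that derivative. -/
theorem IsWeakDeriv.sub_eq_integral {f g : ℝ → ℝ} (h : IsWeakDeriv f g) (hc : Continuous f)
    {a b : ℝ} (ha : a ∈ Icc 0 (2 * π)) (hb : b ∈ Icc 0 (2 * π)) :
    f b - f a = ∫ x in a..b, g x := by
  have hgi := intervalIntegrable_of_per h.2.2.1
  set G : ℝ → ℝ := fun x => ∫ y in (0)..x, g y with hG
  have hGac : AbsolutelyContinuousOnInterval G 0 (2 * π) :=
    hgi.absolutelyContinuousOnInterval_intervalIntegral (by simp [two_pi_pos.le])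
  have hGc : ContinuousOn G (Icc 0 (2 * π)) := by
    have := hGac.continuousOn
    rwa [uIcc_of_le two_pi_pos.le] at this
  set H : ℝ → ℝ := fun x => f x - G x with hH
  have hHc : ContinuousOn H (Icc 0 (2 * π)) := hc.continuousOn.sub hGc
  set c : ℝ := (2 * π)⁻¹ * ∫ x in (0)..(2 * π), H x with hcdef
  have hHi : IntervalIntegrable H volume 0 (2 * π) :=
    ContinuousOn.intervalIntegrable (by rwa [uIcc_of_le two_pi_pos.le])
  -- Du Bois-Reymond's argument: an arbitrary periodic ψ minus its mean has a periodic primitive φ,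
  -- which is an admissible test function.
  have key : ∀ ψ : ℝ → ℝ, ContDiff ℝ ∞ ψ → Function.Periodic ψ (2 * π) →
      ∫ x in (0)..(2 * π), ψ x * (H x - c) = 0 := by
    intro ψ hψ hper
    set m : ℝ := (2 * π)⁻¹ * ∫ x in (0)..(2 * π), ψ x with hm
    set φ : ℝ → ℝ := fun x => (∫ s in (0)..x, ψ s) - m * x with hφ
    have hφd : ∀ x, HasDerivAt φ (ψ x - m) x := fun x => by
      have := (hasDerivAt_integral_zero hψ.continuous x).sub ((hasDerivAt_id x).const_mul m)
      rw [mul_one] at this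
      exact this
    have hφ' : deriv φ = fun x => ψ x - m := funext fun x => (hφd x).deriv
    have hφs : ContDiff ℝ ∞ φ := by
      rw [contDiff_infty_iff_deriv]
      exact ⟨fun x => (hφd x).differentiableAt, by rw [hφ']; exact hψ.sub contDiff_const⟩
    have hm2 : m * (2 * π) = ∫ x in (0)..(2 * π), ψ x := by
      rw [hm]; field_simp
    have hφp : Function.Periodic φ (2 * π) := by
      intro x
      have h1 : ∫ s in (0)..(x + 2 * π), ψ s
          = (∫ s in (0)..x, ψ s) + ∫ s in x..(x + 2 * π), ψ s :=
        (intervalIntegral.integral_add_adjacent_intervals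
          (hψ.continuous.intervalIntegrable _ _) (hψ.continuous.intervalIntegrable _ _)).symm
      have h2 := hper.intervalIntegral_add_eq x 0
      rw [zero_add] at h2
      simp only [hφ]
      rw [h1, h2, ← hm2]; ring
    have hφ0 : φ 0 = 0 := by simp [hφ]
    have hφ2 : φ (2 * π) = 0 := by
      have := hφp 0; rwa [zero_add, hφ0] at this
    have e1 := h.2.2.2 φ hφs hφp
    rw [integral_per, integral_per, hφ'] at e1
    have hφac : AbsolutelyContinuousOnInterval φ 0 (2 * π) :=
      (hφs.of_le (by exact_mod_cast le_top)).contDiffOn.absolutelyContinuousOnInterval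
    -- Since φ vanishes at both ends the boundary terms drop out, and the value of `G` at 2π plays
    -- no role.
    have e2 := hGac.integral_mul_deriv_eq_deriv_mul hφac
    rw [hφ', hφ0, hφ2] at e2
    have e3 : ∫ x in (0)..(2 * π), deriv G x * φ x = ∫ x in (0)..(2 * π), g x * φ x := by
      refine intervalIntegral.integral_congr_ae ?_
      filter_upwards [hgi.ae_hasDerivAt_integral] with x hx hx'
      rw [(hx (uIoc_subset_uIcc hx') 0 (by simp)).deriv]
    rw [e3] at e2
    have hψi : ∀ u : ℝ → ℝ, IntervalIntegrable u volume 0 (2 * π) →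
        ∀ v : ℝ → ℝ, Continuous v → IntervalIntegrable (fun x => u x * v x) volume 0 (2 * π) :=
      fun u hu v hv => hu.mul_continuousOn hv.continuousOn
    have hGi : IntervalIntegrable G volume 0 (2 * π) :=
      ContinuousOn.intervalIntegrable (by rwa [uIcc_of_le two_pi_pos.le])
    have e4 : ∫ x in (0)..(2 * π), H x * (ψ x - m) = 0 := by
      have : ∀ x, H x * (ψ x - m) = f x * (ψ x - m) - G x * (ψ x - m) := fun x => by
        simp only [hH]; ring
      simp_rw [this]
      rw [intervalIntegral.integral_sub
        (hψi _ (hc.intervalIntegrable _ _) (fun x => ψ x - m) (hψ.continuous.sub continuous_const))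
        (hψi _ hGi (fun x => ψ x - m) (hψ.continuous.sub continuous_const)), e1, e2]
      ring
    have e5 : ∀ x, H x * (ψ x - m) = H x * ψ x - m * H x := fun x => by ring
    have e6 : ∀ x, ψ x * (H x - c) = H x * ψ x - c * ψ x := fun x => by ring
    simp_rw [e5] at e4
    simp_rw [e6]
    rw [intervalIntegral.integral_sub (hψi _ hHi _ hψ.continuous) (hHi.const_mul _),
      intervalIntegral.integral_const_mul] at e4
    rw [intervalIntegral.integral_sub (hψi _ hHi _ hψ.continuous)
      ((hψ.continuous.intervalIntegrable _ _).const_mul _),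
      intervalIntegral.integral_const_mul, ← hm2]
    have : c * (2 * π) = ∫ x in (0)..(2 * π), H x := by rw [hcdef]; field_simp
    rw [← this] at e4
    linarith
  have hloc : LocallyIntegrableOn (fun x => H x - c) (Ioo 0 (2 * π)) volume :=
    ((hHc.sub continuousOn_const).mono Ioo_subset_Icc_self).locallyIntegrableOn measurableSet_Ioo
  have hz := isOpen_Ioo.ae_eq_zero_of_integral_contDiff_smul_eq_zero hloc (by
    intro φ hφ _ hs
    obtain ⟨ψ, hψ, hper, heq⟩ := exists_periodic_extension φ hφ hs
    have hb : ∀ x, φ x • (H x - c)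
        = (Ioc 0 (2 * π)).indicator (fun x => φ x • (H x - c)) x := by
      intro x
      by_cases hx : x ∈ Ioc 0 (2 * π)
      · rw [indicator_of_mem hx]
      · rw [indicator_of_notMem hx,
          image_eq_zero_of_notMem_tsupport (f := φ)
            fun h => hx (Ioo_subset_Ioc_self (hs h)), zero_smul]
    rw [integral_congr_ae (ae_of_all _ hb), integral_indicator measurableSet_Ioc,
      ← intervalIntegral.integral_of_le two_pi_pos.le, ]
    refine Eq.trans ?_ (key ψ hψ hper)
    refine intervalIntegral.integral_congr_ae (ae_of_all _ fun x hx => ?_)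
    rw [uIoc_of_le two_pi_pos.le] at hx
    simp only [heq x hx, smul_eq_mul])
  have hHeq : EqOn H (fun _ => c) (Icc 0 (2 * π)) := by
    refine eqOn_Icc_of_ae_eq_per ?_ hHc continuousOn_const
    rw [Filter.EventuallyEq, per, ← restrict_Ioo_eq_restrict_Ioc,
      ae_restrict_iff' measurableSet_Ioo]
    filter_upwards [hz] with x hx hm
    exact sub_eq_zero.mp (hx hm)
  have h0 : (0 : ℝ) ∈ Icc 0 (2 * π) := ⟨le_rfl, two_pi_pos.le⟩
  have ea := hHeq ha
  have eb := hHeq hb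
  simp only [hH, hG] at ea eb
  rw [← intervalIntegral.integral_interval_sub_left
    (intervalIntegrable_of_per_of_mem h.2.2.1 h0 hb)
    (intervalIntegrable_of_per_of_mem h.2.2.1 h0 ha)]
  linarith

theorem IsWeakDeriv.sub {f₁ f₂ g₁ g₂ : ℝ → ℝ} (h₁ : IsWeakDeriv f₁ g₁) (h₂ : IsWeakDeriv f₂ g₂) :
    IsWeakDeriv (fun x => f₁ x - f₂ x) (fun x => g₁ x - g₂ x) := by
  refine ⟨h₁.1.sub h₂.1, fun x => by simp only [h₁.2.1 x, h₂.2.1 x], h₁.2.2.1.sub h₂.2.2.1, ?_⟩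
  intro φ hφ hp
  have bdd : ∀ u : ℝ → ℝ, Continuous u → ∃ C, ∀ᵐ x ∂per, ‖u x‖ ≤ C := fun u hu => by
    obtain ⟨C, hC⟩ := isCompact_Icc.exists_bound_of_continuousOn (s := Icc 0 (2 * π))
      hu.continuousOn
    exact ⟨C, (ae_restrict_mem measurableSet_Ioc).mono fun x hx => hC x (Ioc_subset_Icc_self hx)⟩
  have hφ' : Continuous (deriv φ) := hφ.continuous_deriv (by simp)
  obtain ⟨C, hC⟩ := bdd φ hφ.continuous
  obtain ⟨C', hC'⟩ := bdd _ hφ'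
  simp_rw [sub_mul]
  rw [integral_sub (h₁.1.mul_bdd hφ'.aestronglyMeasurable hC')
    (h₂.1.mul_bdd hφ'.aestronglyMeasurable hC'),
    integral_sub (h₁.2.2.1.mul_bdd hφ.continuous.aestronglyMeasurable hC)
    (h₂.2.2.1.mul_bdd hφ.continuous.aestronglyMeasurable hC), h₁.2.2.2 φ hφ hp, h₂.2.2.2 φ hφ hp]
  ring

theorem isWeakDeriv_weakDeriv {f g : ℝ → ℝ} (h : IsWeakDeriv f g) :
    IsWeakDeriv f (weakDeriv f) := by
  have h' : ∃ g, IsWeakDeriv f g := ⟨g, h⟩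
  rw [weakDeriv, dif_pos h']
  exact h'.choose_spec

theorem weakDeriv_ae_eq {f g : ℝ → ℝ} (h : IsWeakDeriv f g) : weakDeriv f =ᵐ[per] g :=
  (isWeakDeriv_weakDeriv h).ae_eq h

/-! ### Periodic extension of functions on `[0, 2π]` -/

/-- The `2π`-periodic function that agrees with `F` on `(0, 2π]`. -/
noncomputable def perExt (F : ℝ → ℝ) (x : ℝ) : ℝ := F (toIocMod two_pi_pos 0 x)

theorem perExt_periodic (F : ℝ → ℝ) : Function.Periodic (perExt F) (2 * π) := fun x => by
  simp only [perExt, toIocMod_add_right]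

theorem toIocMod_of_mem {x : ℝ} (hx : x ∈ Ioc 0 (2 * π)) : toIocMod two_pi_pos 0 x = x := by
  rw [toIocMod_eq_iff]
  exact ⟨by simpa using hx, 0, by simp⟩

theorem perExt_of_mem {F : ℝ → ℝ} {x : ℝ} (hx : x ∈ Ioc 0 (2 * π)) : perExt F x = F x := by
  rw [perExt, toIocMod_of_mem hx]

theorem perExt_zero (F : ℝ → ℝ) : perExt F 0 = F (2 * π) := by
  have h := perExt_periodic F 0
  rw [← h, zero_add, perExt_of_mem ⟨two_pi_pos, le_rfl⟩]

theorem perExt_of_mem_Icc {F : ℝ → ℝ} (hF : F (2 * π) = F 0) {x : ℝ} (hx : x ∈ Icc 0 (2 * π)) :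
    perExt F x = F x := by
  rcases eq_or_lt_of_le hx.1 with h | h
  · rw [← h, perExt_zero, hF]
  · exact perExt_of_mem ⟨h, hx.2⟩

theorem perExt_ae_eq (F : ℝ → ℝ) : perExt F =ᵐ[per] F :=
  (ae_restrict_mem measurableSet_Ioc).mono fun _ hx => perExt_of_mem hx

theorem perExt_continuous {F : ℝ → ℝ} (hF : Continuous F) (h : F (2 * π) = F 0) :
    Continuous (perExt F) := by
  have : Fact ((0 : ℝ) < 2 * π) := ⟨two_pi_pos⟩
  exact (AddCircle.liftIoc_zero_continuous (p := 2 * π) h.symm hF.continuousOn).comp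
    (AddCircle.continuous_mk' _)

theorem IsWeakDeriv.perExt_integral {g : ℝ → ℝ} (hg : Continuous g)
    (h0 : ∫ x in (0)..(2 * π), g x = 0) (c : ℝ) :
    IsWeakDeriv (perExt fun x => c + ∫ y in (0)..x, g y) (perExt g) := by
  have hFd : ∀ x, HasDerivAt (fun x => c + ∫ y in (0)..x, g y) (g x) x := fun x =>
    (hasDerivAt_integral_zero hg x).const_add c
  have hFc : Continuous fun x => c + ∫ y in (0)..x, g y :=
    continuous_iff_continuousAt.2 fun x => (hFd x).continuousAt
  refine ⟨(integrable_per_of_continuousOn hFc.continuousOn).congr (perExt_ae_eq _).symm,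
    perExt_periodic _, (integrable_per_of_continuousOn hg.continuousOn).congr
    (perExt_ae_eq _).symm, fun φ hφ hp => ?_⟩
  have e1 : ∫ x, perExt (fun x => c + ∫ y in (0)..x, g y) x * deriv φ x ∂per
      = ∫ x, (c + ∫ y in (0)..x, g y) * deriv φ x ∂per :=
    integral_congr_ae ((perExt_ae_eq _).mul (ae_eq_refl (deriv φ)))
  have e2 : ∫ x, perExt g x * φ x ∂per = ∫ x, g x * φ x ∂per :=
    integral_congr_ae ((perExt_ae_eq g).mul (ae_eq_refl φ))
  rw [e1, e2, integral_per, integral_per]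
  have hφ' : Continuous (deriv φ) := hφ.continuous_deriv (by simp)
  have := intervalIntegral.integral_mul_deriv_eq_deriv_mul (a := 0) (b := 2 * π)
    (fun x _ => hFd x)
    (fun x _ => ((hφ.differentiable (by simp)) x).hasDerivAt) (hg.intervalIntegrable _ _)
    (hφ'.intervalIntegrable _ _)
  have hp0 := hp 0
  rw [zero_add] at hp0
  rw [this, hp0, h0]
  simp
/-! ### Norms -/

theorem abs_le_on_Icc_of_ae {f : ℝ → ℝ} (hf : ContinuousOn f (Icc 0 (2 * π))) {C : ℝ}
    (h : ∀ᵐ x ∂per, |f x| ≤ C) : ∀ x ∈ Icc 0 (2 * π), |f x| ≤ C := by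
  have h1 : (fun x => max |f x| C) =ᵐ[per] fun _ => C := h.mono fun x hx => max_eq_right hx
  intro x hx
  have := eqOn_Icc_of_ae_eq_per h1 (hf.abs.sup continuousOn_const) continuousOn_const hx
  exact max_eq_right_iff.1 this

theorem ae_abs_le_of_eLpNorm_top_le {f : ℝ → ℝ} {C : ℝ} (hC : 0 ≤ C)
    (h : eLpNorm f ∞ per ≤ ENNReal.ofReal C) : ∀ᵐ x ∂per, |f x| ≤ C := by
  rw [eLpNorm_exponent_top] at h
  filter_upwards [ae_le_eLpNormEssSup (f := f) (μ := per)] with x hx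
  have := hx.trans h
  rwa [Real.enorm_eq_ofReal_abs, ENNReal.ofReal_le_ofReal_iff hC] at this

theorem eLpNorm_top_le_of_ae {f : ℝ → ℝ} {C : ℝ} (h : ∀ᵐ x ∂per, |f x| ≤ C) :
    eLpNorm f ∞ per ≤ ENNReal.ofReal C := by
  rw [eLpNorm_exponent_top]
  refine eLpNormEssSup_le_of_ae_bound ?_
  simpa using h

theorem MemH1per.isWeakDeriv {f : ℝ → ℝ} (h : MemH1per f) : IsWeakDeriv f (weakDeriv f) := by
  obtain ⟨g, hg, -⟩ := h.2.2.2
  exact isWeakDeriv_weakDeriv hg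

theorem MemH1per.memLp_weakDeriv {f : ℝ → ℝ} (h : MemH1per f) : MemLp (weakDeriv f) 2 per := by
  obtain ⟨g, hg, hg2⟩ := h.2.2.2
  exact (memLp_congr_ae (weakDeriv_ae_eq hg)).2 hg2

theorem MemH1per.apply_two_pi {f : ℝ → ℝ} (h : MemH1per f) : f (2 * π) = f 0 := by
  have := h.1 0
  rwa [zero_add] at this

theorem abs_integral_le_of_ae_per {g : ℝ → ℝ} {C : ℝ} (h : ∀ᵐ x ∂per, |g x| ≤ C) {a b : ℝ}
    (ha : a ∈ Icc 0 (2 * π)) (hb : b ∈ Icc 0 (2 * π)) : |∫ x in a..b, g x| ≤ C * |b - a| := by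
  rw [← Real.norm_eq_abs (∫ x in a..b, g x)]
  refine intervalIntegral.norm_integral_le_of_norm_le_const_ae ?_
  rw [ae_per_iff] at h
  filter_upwards [h] with x hx hx'
  refine hx ⟨(le_min ha.1 hb.1).trans_lt hx'.1, hx'.2.trans (max_le ha.2 hb.2)⟩

/-- An essential bound for the weak derivative is a Lipschitz constant. -/
theorem MemH1per.abs_sub_le {f : ℝ → ℝ} (h : MemH1per f) {C : ℝ}
    (hC : ∀ᵐ x ∂per, |weakDeriv f x| ≤ C) {a b : ℝ}
    (ha : a ∈ Icc 0 (2 * π)) (hb : b ∈ Icc 0 (2 * π)) : |f b - f a| ≤ C * |b - a| := by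
  rw [h.isWeakDeriv.sub_eq_integral h.2.1 ha hb]
  exact abs_integral_le_of_ae_per hC ha hb

/-! ### Grönwall's inequality in both directions of time -/

theorem norm_le_gronwallBound_of_hasDerivAt {E : Type*} [NormedAddCommGroup E] [NormedSpace ℝ E]
    {f f' : ℝ → E} {l u K ε : ℝ} (hf : ∀ s ∈ Ioo l u, HasDerivAt f (f' s) s)
    (hb : ∀ s ∈ Ioo l u, ‖f' s‖ ≤ K * ‖f s‖ + ε) {s t : ℝ} (hs : s ∈ Ioo l u) (ht : t ∈ Ioo l u) :
    ‖f t‖ ≤ gronwallBound ‖f s‖ K ε |t - s| := by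
  rcases le_total s t with hst | hst
  · rw [abs_of_nonneg (sub_nonneg.2 hst)]
    have hm : ∀ x ∈ Icc s t, x ∈ Ioo l u := fun x hx => ⟨hs.1.trans_le hx.1, hx.2.trans_lt ht.2⟩
    exact norm_le_gronwallBound_of_norm_deriv_right_le
      (fun x hx => (hf x (hm x hx)).continuousAt.continuousWithinAt)
      (fun x hx => (hf x (hm x (Ico_subset_Icc_self hx))).hasDerivWithinAt) le_rfl
      (fun x hx => hb x (hm x (Ico_subset_Icc_self hx))) t ⟨hst, le_rfl⟩
  · rw [abs_of_nonpos (sub_nonpos.2 hst), neg_sub]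
    have hm : ∀ x ∈ Icc (-s) (-t), -x ∈ Ioo l u := fun x hx =>
      ⟨ht.1.trans_le (by linarith [hx.2]), (by linarith [hx.1] : -x ≤ s).trans_lt hs.2⟩
    have hd : ∀ x ∈ Icc (-s) (-t), HasDerivAt (fun y => f (-y)) (-f' (-x)) x := fun x hx => by
      have := (hf (-x) (hm x hx)).scomp x (hasDerivAt_neg x)
      simpa [Function.comp_def] using this
    have := norm_le_gronwallBound_of_norm_deriv_right_le (f := fun y => f (-y))
      (f' := fun y => -f' (-y)) (δ := ‖f s‖) (K := K) (ε := ε) (a := -s) (b := -t)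
      (fun x hx => (hd x hx).continuousAt.continuousWithinAt)
      (fun x hx => (hd x (Ico_subset_Icc_self hx)).hasDerivWithinAt) (by simp)
      (fun x hx => by rw [norm_neg]; exact hb _ (hm x (Ico_subset_Icc_self hx))) (-t)
      ⟨neg_le_neg hst, le_rfl⟩
    simpa [neg_add_eq_sub] using this

/-- The inequality e^y - 1 ≤ y e^y removes the quotient ε / K from Grönwall's bound. -/
theorem gronwallBound_le {δ K ε x : ℝ} (hK : 0 < K) (hε : 0 ≤ ε) :
    gronwallBound δ K ε x ≤ (δ + ε * x) * exp (K * x) := by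
  rw [gronwallBound_of_K_ne_0 hK.ne']
  have h : exp (K * x) - 1 ≤ K * x * exp (K * x) := by
    have h1 := add_one_le_exp (-(K * x))
    rw [exp_neg] at h1
    have h2 := exp_pos (K * x)
    have h3 := mul_le_mul_of_nonneg_right h1 h2.le
    rw [inv_mul_cancel₀ h2.ne'] at h3
    linarith
  have h' : ε / K * (exp (K * x) - 1) ≤ ε / K * (K * x * exp (K * x)) :=
    mul_le_mul_of_nonneg_left h (by positivity)
  have h'' : ε / K * (K * x * exp (K * x)) = ε * x * exp (K * x) := by field_simp
  linarith

theorem norm_le_mul_exp_of_hasDerivAt {E : Type*} [NormedAddCommGroup E] [NormedSpace ℝ E]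
    {f f' : ℝ → E} {l u K ε : ℝ} (hK : 0 < K) (hε : 0 ≤ ε)
    (hf : ∀ s ∈ Ioo l u, HasDerivAt f (f' s) s)
    (hb : ∀ s ∈ Ioo l u, ‖f' s‖ ≤ K * ‖f s‖ + ε) {s t : ℝ} (hs : s ∈ Ioo l u) (ht : t ∈ Ioo l u) :
    ‖f t‖ ≤ (‖f s‖ + ε * |t - s|) * exp (K * |t - s|) :=
  (norm_le_gronwallBound_of_hasDerivAt hf hb hs ht).trans (gronwallBound_le hK hε)

/-! ### The peaked profile on `[0, 2π]` -/

theorem cStar_pos : 0 < cStar := by unfold cStar; positivity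

theorem cStar_sq : cStar ^ 2 = π ^ 2 / 8 := by
  rw [cStar, div_pow, mul_pow, Real.sq_sqrt (by norm_num : (0 : ℝ) ≤ 2)]; ring

theorem one_le_cStar : 1 ≤ cStar := by
  have h : (1 : ℝ) ≤ cStar ^ 2 := by rw [cStar_sq]; nlinarith [pi_gt_three]
  nlinarith [cStar_pos]

theorem rep_of_le {x : ℝ} (h0 : 0 ≤ x) (h : x ≤ π) : rep x = x := by
  rw [rep, toIocMod_eq_iff]
  exact ⟨⟨by linarith [pi_pos], by linarith⟩, 0, by simp⟩

theorem rep_of_lt {x : ℝ} (h0 : π < x) (h : x ≤ 2 * π) : rep x = x - 2 * π := by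
  rw [rep, toIocMod_eq_iff]
  exact ⟨⟨by linarith [pi_pos], by linarith [pi_pos]⟩, 1, by simp⟩

/-- With the peak moved to the ends of the period, the two branches of |x| merge into one quadratic
polynomial. It vanishes linearly at both ends, so particles at the peak do not move. -/
theorem speed_etaStar {x : ℝ} (hx : x ∈ Icc 0 (2 * π)) :
    cStar ^ 2 - 2 * etaStar x = x * (2 * π - x) / 4 := by
  rw [cStar_sq, etaStar]
  rcases le_or_gt x π with h | h
  · rw [rep_of_le hx.1 h, abs_of_nonneg hx.1]; ring
  · rw [rep_of_lt h hx.2, abs_of_nonpos (by linarith [hx.2])]; ring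

/-- The ends are excluded because the sign of 0 is 0 there. They are negligible under the integral.
-/
theorem etaStar'_of_mem {x : ℝ} (hx : x ∈ Ioo 0 (2 * π)) : etaStar' x = (x - π) / 4 := by
  rw [etaStar']
  rcases le_or_gt x π with h | h
  · rw [rep_of_le hx.1.le h, abs_of_nonneg hx.1.le, sign_pos hx.1]
    simp; ring
  · rw [rep_of_lt h hx.2.le, abs_of_nonpos (by linarith [hx.2]),
      sign_neg (by linarith [hx.2])]
    simp; ring

theorem integral_etaStar'_mul (z : ℝ → ℝ) :
    ∫ y, etaStar' y * z y ∂per = ∫ y in (0)..(2 * π), (y - π) / 4 * z y := by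
  rw [← integral_per]
  exact integral_congr_ae (ae_per_of_forall fun x hx => by simp only [etaStar'_of_mem hx])

/-! ### The evolution equation as a transport equation with a nonlocal source -/

/-- The transport speed `c_*² - 2 η_* - 2 (z - z(0))`. -/
noncomputable def speed (z : ℝ → ℝ) (x : ℝ) : ℝ := cStar ^ 2 - 2 * etaStar x - 2 * (z x - z 0)

/-- The nonlocal part of the right-hand side of the evolution equation. -/
noncomputable def source (z : ℝ → ℝ) (x : ℝ) : ℝ :=
  -(π⁻¹ * ∫ y, etaStar' y * z y ∂per) + 1 / 2 * primZero (fun y => z y + 2 * weakDeriv z y ^ 2) x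

theorem evolutionRHS_eq (z : ℝ → ℝ) (x : ℝ) :
    evolutionRHS z x = speed z x * weakDeriv z x + source z x := by
  simp only [evolutionRHS, speed, source]; ring

theorem continuousOn_speed {z : ℝ → ℝ} (hz : Continuous z) :
    ContinuousOn (speed z) (Icc 0 (2 * π)) := by
  have h : ContinuousOn (fun x => x * (2 * π - x) / 4 - 2 * (z x - z 0)) (Icc 0 (2 * π)) := by
    fun_prop
  refine h.congr fun x hx => ?_
  simp only [speed, speed_etaStar hx]

theorem continuousOn_primZero {f : ℝ → ℝ} (hf : Integrable f per) :
    ContinuousOn (primZero f) (Icc 0 (2 * π)) := by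
  refine ContinuousOn.sub ?_ continuousOn_const
  have h := intervalIntegral.continuousOn_primitive_interval
    (μ := volume) (a := 0) (b := 2 * π) (f := fun y => f y - mean f) (by
      rw [uIcc_of_le two_pi_pos.le, integrableOn_Icc_iff_integrableOn_Ioc]
      exact hf.sub (integrable_const _))
  rwa [uIcc_of_le two_pi_pos.le] at h

theorem MemH1per.integrable_source {z : ℝ → ℝ} (hz : MemH1per z) :
    Integrable (fun y => z y + 2 * weakDeriv z y ^ 2) per :=
  (integrable_per_of_continuousOn hz.2.1.continuousOn).add
    (hz.memLp_weakDeriv.integrable_sq.const_mul 2)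

theorem MemH1per.continuousOn_source {z : ℝ → ℝ} (hz : MemH1per z) :
    ContinuousOn (source z) (Icc 0 (2 * π)) :=
  continuousOn_const.add ((continuousOn_primZero hz.integrable_source).const_smul (1 / 2 : ℝ))

theorem mean_sub_le {f₁ f₂ : ℝ → ℝ} (h₁ : Integrable f₁ per) (h₂ : Integrable f₂ per) {C : ℝ}
    (hC : ∀ᵐ x ∂per, |f₁ x - f₂ x| ≤ C) : |mean f₁ - mean f₂| ≤ C := by
  rw [mean, mean, ← mul_sub, ← integral_sub h₁ h₂, integral_per, abs_mul,
    abs_of_pos (by positivity)]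
  have := abs_integral_le_of_ae_per hC (a := 0) (b := 2 * π) ⟨le_rfl, two_pi_pos.le⟩
    ⟨two_pi_pos.le, le_rfl⟩
  rw [sub_zero, abs_of_pos two_pi_pos] at this
  rw [inv_mul_le_iff₀ two_pi_pos]
  linarith

theorem primZero_sub_primZero {f : ℝ → ℝ} (hf : Integrable f per) {a b : ℝ}
    (ha : a ∈ Icc 0 (2 * π)) (hb : b ∈ Icc 0 (2 * π)) :
    primZero f b - primZero f a = ∫ y in a..b, (f y - mean f) := by
  have hi : Integrable (fun y => f y - mean f) per := hf.sub (integrable_const _)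
  have h0 : (0 : ℝ) ∈ Icc 0 (2 * π) := ⟨le_rfl, two_pi_pos.le⟩
  rw [← intervalIntegral.integral_interval_sub_left (intervalIntegrable_of_per_of_mem hi h0 hb)
    (intervalIntegrable_of_per_of_mem hi h0 ha), primZero, primZero]
  ring

theorem primZero_increment_le {f₁ f₂ : ℝ → ℝ} (h₁ : Integrable f₁ per) (h₂ : Integrable f₂ per)
    {C : ℝ} (hC : ∀ᵐ x ∂per, |f₁ x - f₂ x| ≤ C) {a b : ℝ}
    (ha : a ∈ Icc 0 (2 * π)) (hb : b ∈ Icc 0 (2 * π)) :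
    |(primZero f₁ b - primZero f₁ a) - (primZero f₂ b - primZero f₂ a)| ≤ 2 * C * |b - a| := by
  rw [primZero_sub_primZero h₁ ha hb, primZero_sub_primZero h₂ ha hb,
    ← intervalIntegral.integral_sub
      (intervalIntegrable_of_per_of_mem (f := fun y => f₁ y - mean f₁)
        (h₁.sub (integrable_const _)) ha hb)
      (intervalIntegrable_of_per_of_mem (f := fun y => f₂ y - mean f₂)
        (h₂.sub (integrable_const _)) ha hb)]
  refine abs_integral_le_of_ae_per ?_ ha hb
  filter_upwards [hC] with x hx
  have := mean_sub_le h₁ h₂ hC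
  have e : f₁ x - mean f₁ - (f₂ x - mean f₂) = (f₁ x - f₂ x) - (mean f₁ - mean f₂) := by ring
  rw [e]
  exact (abs_sub _ _).trans (by linarith)

theorem primZero_sub_le {f₁ f₂ : ℝ → ℝ} (h₁ : Integrable f₁ per) (h₂ : Integrable f₂ per)
    {C : ℝ} (hC : ∀ᵐ x ∂per, |f₁ x - f₂ x| ≤ C) {x : ℝ} (hx : x ∈ Icc 0 (2 * π)) :
    |primZero f₁ x - primZero f₂ x| ≤ 8 * π * C := by
  have h0 : (0 : ℝ) ∈ Icc 0 (2 * π) := ⟨le_rfl, two_pi_pos.le⟩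
  have hC0 : 0 ≤ C := (abs_nonneg _).trans (mean_sub_le h₁ h₂ hC)
  -- Half of the constant 8π comes from the primitive, namely 2C over a length of at most 2π; the
  -- subtracted mean of the primitive contributes the other half.
  have hA : ∀ y ∈ Icc 0 (2 * π), |(∫ s in (0)..y, (f₁ s - mean f₁)) -
      ∫ s in (0)..y, (f₂ s - mean f₂)| ≤ 4 * π * C := by
    intro y hy
    have := primZero_increment_le h₁ h₂ hC h0 hy
    rw [primZero_sub_primZero h₁ h0 hy, primZero_sub_primZero h₂ h0 hy, sub_zero,
      abs_of_nonneg hy.1] at this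
    nlinarith [hy.2]
  have hci : ∀ f : ℝ → ℝ, Integrable f per →
      Integrable (fun z => ∫ s in (0)..z, (f s - mean f)) per := fun f hf => by
    refine integrable_per_of_continuousOn ?_
    have := (continuousOn_primZero hf).add
      (continuousOn_const (c := mean fun z => ∫ s in (0)..z, (f s - mean f)))
    refine this.congr fun x _ => ?_
    simp only [Pi.add_apply, primZero]; ring
  have hB := mean_sub_le (hci f₁ h₁) (hci f₂ h₂) (C := 4 * π * C)
    ((ae_restrict_mem measurableSet_Ioc).mono fun y hy => hA y (Ioc_subset_Icc_self hy))
  have hA' := hA x hx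
  simp only [primZero]
  rw [abs_le] at hA' hB ⊢
  constructor <;> linarith [hA'.1, hA'.2, hB.1, hB.2]

/-! ### Regularity of local solutions -/

theorem ae_abs_sub_of_normW1inf_le {f₁ f₂ : ℝ → ℝ} (h₁ : MemH1per f₁) (h₂ : MemH1per f₂) {C : ℝ}
    (hC : 0 ≤ C) (h : normW1inf (fun x => f₁ x - f₂ x) ≤ ENNReal.ofReal C) :
    (∀ x ∈ Icc 0 (2 * π), |f₁ x - f₂ x| ≤ C) ∧
      ∀ᵐ x ∂per, |weakDeriv f₁ x - weakDeriv f₂ x| ≤ C := by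
  rw [normW1inf] at h
  refine ⟨abs_le_on_Icc_of_ae (h₁.2.1.sub h₂.2.1).continuousOn
    (ae_abs_le_of_eLpNorm_top_le hC (le_self_add.trans h)), ?_⟩
  filter_upwards [ae_abs_le_of_eLpNorm_top_le hC (le_add_self.trans h),
    weakDeriv_ae_eq (h₁.isWeakDeriv.sub h₂.isWeakDeriv)] with x hx hx'
  rwa [hx'] at hx

theorem IsLocalSolution.eventually_close {τ : ℝ} {ζ : ℝ → ℝ → ℝ} (h : IsLocalSolution τ ζ) {t : ℝ}
    (ht : t ∈ Ioo (-τ) τ) {ε : ℝ} (hε : 0 < ε) :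
    ∀ᶠ s in 𝓝 t, (∀ x ∈ Icc 0 (2 * π), |ζ s x - ζ t x| ≤ ε) ∧
      ∀ᵐ x ∂per, |weakDeriv (ζ s) x - weakDeriv (ζ t) x| ≤ ε := by
  have h1 := (h.continuous_W1inf t ht).eventually (Iic_mem_nhds (ENNReal.ofReal_pos.2 hε))
  filter_upwards [h1, isOpen_Ioo.mem_nhds ht] with s hs hs'
  exact ae_abs_sub_of_normW1inf_le (h.mem s hs').1 (h.mem t ht).1 hε.le hs

/-- The difference quotients are continuous in space, so their convergence in `L^∞` is uniform on
the closed period and their limit is continuous. This gives the time derivative pointwise values,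
which are needed to follow the solution along curves. -/
theorem IsLocalSolution.exists_timeDeriv {τ : ℝ} {ζ : ℝ → ℝ → ℝ} (h : IsLocalSolution τ ζ) {t : ℝ}
    (ht : t ∈ Ioo (-τ) τ) :
    ∃ v : ℝ → ℝ, ContinuousOn v (Icc 0 (2 * π)) ∧
      (∀ᵐ x ∂per, 2 * cStar * v x = evolutionRHS (ζ t) x) ∧
      ∀ ε > 0, ∀ᶠ k in 𝓝[≠] 0, ∀ x ∈ Icc 0 (2 * π), |k⁻¹ * (ζ (t + k) x - ζ t x) - v x| ≤ ε := by
  obtain ⟨w, -, hw, heq⟩ := h.equation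
  obtain ⟨-, -, hlim, -⟩ := hw t ht
  set d : ℝ → ℝ → ℝ := fun k x => k⁻¹ * (ζ (t + k) x - ζ t x) with hd
  have hmem : ∀ᶠ k in 𝓝[≠] (0 : ℝ), t + k ∈ Ioo (-τ) τ := by
    have : Tendsto (fun k : ℝ => t + k) (𝓝[≠] 0) (𝓝 t) := by
      have : ContinuousAt (fun k : ℝ => t + k) 0 := by fun_prop
      rw [ContinuousAt, add_zero] at this
      exact this.mono_left nhdsWithin_le_nhds
    exact this.eventually (isOpen_Ioo.mem_nhds ht)
  have hdw : ∀ ε > 0, ∀ᶠ k in 𝓝[≠] (0 : ℝ), ∀ᵐ x ∂per, |d k x - w t x| ≤ ε := fun ε hε => by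
    filter_upwards [hlim.eventually (Iic_mem_nhds (ENNReal.ofReal_pos.2 hε))] with k hk
    exact ae_abs_le_of_eLpNorm_top_le hε.le hk
  have hdc : ∀ᶠ k in 𝓝[≠] (0 : ℝ), ContinuousOn (d k) (Icc 0 (2 * π)) := by
    filter_upwards [hmem] with k hk
    exact (((h.mem _ hk).1.2.1.sub (h.mem t ht).1.2.1).const_smul k⁻¹).continuousOn
  -- For continuous functions an almost everywhere bound holds everywhere, so the quotients form a
  -- uniform Cauchy family.
  have hdd : ∀ ε > 0, ∀ᶠ p in (𝓝[≠] (0 : ℝ)) ×ˢ (𝓝[≠] (0 : ℝ)), ∀ x ∈ Icc 0 (2 * π),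
      |d p.1 x - d p.2 x| ≤ ε := fun ε hε => by
    have := (hdw (ε / 2) (by positivity)).and hdc
    filter_upwards [this.prod_mk this] with p hp
    refine abs_le_on_Icc_of_ae (hp.1.2.sub hp.2.2) ?_
    filter_upwards [hp.1.1, hp.2.1] with x h1 h2
    rw [Pi.sub_apply]
    rw [abs_le] at h1 h2 ⊢
    constructor <;> linarith [h1.1, h1.2, h2.1, h2.2]
  have hex : ∀ x ∈ Icc 0 (2 * π), ∃ l, Tendsto (fun k => d k x) (𝓝[≠] 0) (𝓝 l) := by
    intro x hx
    rw [← cauchy_map_iff_exists_tendsto, cauchy_map_iff]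
    refine ⟨inferInstance, Metric.uniformity_basis_dist_le.tendsto_right_iff.2 fun ε hε => ?_⟩
    filter_upwards [hdd ε hε] with p hp
    exact hp x hx
  choose! v hv using hex
  have hunif : ∀ ε > 0, ∀ᶠ k in 𝓝[≠] (0 : ℝ), ∀ x ∈ Icc 0 (2 * π), |d k x - v x| ≤ ε := by
    intro ε hε
    filter_upwards [(hdd ε hε).curry] with k hk x hx
    have h1 : Tendsto (fun k' => |d k x - d k' x|) (𝓝[≠] 0) (𝓝 |d k x - v x|) :=
      (tendsto_const_nhds.sub (hv x hx)).abs
    exact le_of_tendsto h1 (hk.mono fun k' hk' => hk' x hx)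
  refine ⟨v, ?_, ?_, hunif⟩
  · have hu : TendstoUniformlyOn d v (𝓝[≠] (0 : ℝ)) (Icc 0 (2 * π)) := by
      rw [Metric.tendstoUniformlyOn_iff]
      intro ε hε
      filter_upwards [hunif (ε / 2) (by positivity)] with k hk x hx
      rw [dist_comm, Real.dist_eq]
      linarith [hk x hx]
    exact hu.continuousOn hdc.frequently
  · have h0 : ∀ n : ℕ, ∀ᵐ x ∂per, |v x - w t x| ≤ 2 * (1 / ((n : ℝ) + 1)) := fun n => by
      have hn : (0 : ℝ) < 1 / ((n : ℝ) + 1) := by positivity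
      obtain ⟨k, hk1, hk2⟩ := ((hunif _ hn).and (hdw _ hn)).exists
      filter_upwards [hk2, ae_restrict_mem measurableSet_Ioc] with x hx hx'
      have := hk1 x (Ioc_subset_Icc_self hx')
      rw [abs_le] at this hx ⊢
      constructor <;> linarith [this.1, this.2, hx.1, hx.2]
    filter_upwards [ae_all_iff.2 h0, heq t ht] with x hx hx'
    have : v x = w t x := by
      have hl : Tendsto (fun n : ℕ => 2 * (1 / ((n : ℝ) + 1))) atTop (𝓝 0) := by
        simpa using tendsto_one_div_add_atTop_nhds_zero_nat.const_mul (2 : ℝ)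
      have := ge_of_tendsto' hl hx
      exact sub_eq_zero.1 (abs_eq_zero.1 (le_antisymm this (abs_nonneg _)))
    rw [this, hx']

theorem speed_eq {z : ℝ → ℝ} {x : ℝ} (hx : x ∈ Icc 0 (2 * π)) :
    speed z x = x * (2 * π - x) / 4 - 2 * (z x - z 0) := by
  rw [speed, speed_etaStar hx]

/-- Where the transport speed does not vanish, a local solution is differentiable in space, and
it satisfies the evolution equation along differentiable curves. -/
theorem IsLocalSolution.exists_slope {τ : ℝ} {ζ : ℝ → ℝ → ℝ} (h : IsLocalSolution τ ζ) {t : ℝ}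
    (ht : t ∈ Ioo (-τ) τ) (hV : ∀ x ∈ Ioo 0 (2 * π), speed (ζ t) x ≠ 0) :
    ∃ q : ℝ → ℝ, weakDeriv (ζ t) =ᵐ[per] q ∧
      (∀ x ∈ Ioo 0 (2 * π), HasDerivAt (ζ t) (q x) x) ∧
      ∀ x ∈ Ioo 0 (2 * π), ∀ (X : ℝ → ℝ) (X' : ℝ), X t = x → HasDerivAt X X' t →
        HasDerivAt (fun s => ζ s (X s))
          ((speed (ζ t) x * q x + source (ζ t) x) / (2 * cStar) + q x * X') t := by
  obtain ⟨v, hvc, hv, hlim⟩ := h.exists_timeDeriv ht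
  have hm := (h.mem t ht).1
  -- The equation solved for the slope: a quotient of continuous functions with nonzero denominator,
  -- hence a continuous representative of the weak derivative on the open period.
  set q : ℝ → ℝ := fun x => (2 * cStar * v x - source (ζ t) x) / speed (ζ t) x with hq
  have hqc : ContinuousOn q (Ioo 0 (2 * π)) :=
    (((hvc.const_smul (2 * cStar)).sub hm.continuousOn_source).mono Ioo_subset_Icc_self).div
      ((continuousOn_speed hm.2.1).mono Ioo_subset_Icc_self) hV
  have hae : weakDeriv (ζ t) =ᵐ[per] q := by
    filter_upwards [hv, ae_per_of_forall hV] with x hx hx'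
    rw [evolutionRHS_eq] at hx
    simp only [hq]
    rw [hx]
    field_simp
    ring
  have hqd : ∀ x ∈ Ioo 0 (2 * π), HasDerivAt (ζ t) (q x) x := by
    intro x hx
    have hx' := Ioo_subset_Icc_self hx
    have hint : ∀ y ∈ Ioo 0 (2 * π), ζ t y = ζ t x + ∫ s in x..y, q s := by
      intro y hy
      have e := hm.isWeakDeriv.sub_eq_integral hm.2.1 hx' (Ioo_subset_Icc_self hy)
      have e2 : ∫ s in x..y, weakDeriv (ζ t) s = ∫ s in x..y, q s := by
        refine intervalIntegral.integral_congr_ae ?_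
        filter_upwards [ae_per_iff.1 hae] with s hs hs'
        exact hs ⟨(lt_min hx.1 hy.1).trans hs'.1, hs'.2.trans (max_le hx.2.le hy.2.le)⟩
      linarith
    have hd : HasDerivAt (fun y => ζ t x + ∫ s in x..y, q s) (q x) x := by
      refine (intervalIntegral.integral_hasDerivAt_right (by simp) ?_ ?_).const_add _
      · exact hqc.stronglyMeasurableAtFilter isOpen_Ioo x hx
      · exact hqc.continuousAt (isOpen_Ioo.mem_nhds hx)
    refine hd.congr_of_eventuallyEq ?_
    filter_upwards [isOpen_Ioo.mem_nhds hx] with y hy using hint y hy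
  refine ⟨q, hae, hqd, ?_⟩
  intro x hx X X' hX hX'
  have hvq : (speed (ζ t) x * q x + source (ζ t) x) / (2 * cStar) = v x := by
    have := hV x hx
    have := cStar_pos
    simp only [hq]
    field_simp
    ring
  rw [hvq]
  subst hX
  have h2 : HasDerivAt (fun s => ζ t (X s)) (q (X t) * X') t := (hqd _ hx).comp t hX'
  -- Joint differentiability is not known. The increment is split into a purely temporal part,
  -- handled by the uniform convergence of the difference quotients at the moving point, and a
  -- spatial part at the frozen time `t`.
  have h1 : HasDerivAt (fun s => ζ s (X s) - ζ t (X s)) (v (X t)) t := by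
    rw [hasDerivAt_iff_tendsto_slope_zero]
    simp only [sub_self, sub_zero, smul_eq_mul]
    have hXt : Tendsto (fun k => X (t + k)) (𝓝[≠] 0) (𝓝 (X t)) := by
      have : ContinuousAt (fun k => X (t + k)) 0 :=
        ContinuousAt.comp (by simpa using hX'.continuousAt) (by fun_prop)
      rw [ContinuousAt, add_zero] at this
      exact this.mono_left nhdsWithin_le_nhds
    have hvX : Tendsto (fun k => v (X (t + k))) (𝓝[≠] 0) (𝓝 (v (X t))) :=
      ((hvc.continuousAt (Icc_mem_nhds hx.1 hx.2)).tendsto).comp hXt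
    have hmem : ∀ᶠ k in 𝓝[≠] (0 : ℝ), X (t + k) ∈ Icc 0 (2 * π) :=
      hXt.eventually (Icc_mem_nhds hx.1 hx.2)
    have hz : Tendsto (fun k => k⁻¹ * (ζ (t + k) (X (t + k)) - ζ t (X (t + k))) - v (X (t + k)))
        (𝓝[≠] 0) (𝓝 0) := by
      rw [Metric.tendsto_nhds]
      intro ε hε
      filter_upwards [hlim (ε / 2) (by positivity), hmem] with k hk hk'
      rw [Real.dist_eq, sub_zero]
      linarith [hk _ hk']
    simpa using hz.add hvX
  refine (h1.add h2).congr_of_eventuallyEq (Eventually.of_forall fun s => ?_)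
  simp

/-! ### Characteristics of the transport speed -/

theorem abs_speed_sub_le {z : ℝ → ℝ} {M : ℝ} (hz : MemH1per z)
    (hM : ∀ᵐ x ∂per, |weakDeriv z x| ≤ M) {x y : ℝ} (hx : x ∈ Icc 0 (2 * π))
    (hy : y ∈ Icc 0 (2 * π)) : |speed z x - speed z y| ≤ (π / 2 + 2 * M) * |x - y| := by
  have h1 := hz.abs_sub_le hM hy hx
  rw [speed_eq hx, speed_eq hy]
  have e : x * (2 * π - x) / 4 - 2 * (z x - z 0) - (y * (2 * π - y) / 4 - 2 * (z y - z 0))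
      = (2 * π - x - y) / 4 * (x - y) + -2 * (z x - z y) := by ring
  rw [e]
  refine (abs_add_le _ _).trans ?_
  rw [abs_mul, abs_mul]
  have h2 : |(2 * π - x - y) / 4| ≤ π / 2 := by
    rw [abs_le]; constructor <;> linarith [hx.1, hx.2, hy.1, hy.2]
  have h3 := mul_le_mul_of_nonneg_right h2 (abs_nonneg (x - y))
  have h4 : |(-2 : ℝ)| = 2 := by norm_num
  rw [h4]
  linarith

/-- Characteristics of a Lipschitz velocity field that vanishes at the ends of an interval. -/
theorem exists_characteristic {v : ℝ → ℝ → ℝ} {l u K P : ℝ} (hP : 0 < P) (hK : 0 < K)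
    (hLip : ∀ s ∈ Icc l u, ∀ x ∈ Icc 0 P, ∀ y ∈ Icc 0 P, |v s x - v s y| ≤ K * |x - y|)
    (h0 : ∀ s ∈ Icc l u, v s 0 = 0) (hP0 : ∀ s ∈ Icc l u, v s P = 0)
    (hc : ∀ x ∈ Icc 0 P, ContinuousOn (fun s => v s x) (Icc l u)) {t a : ℝ} (ht : t ∈ Ioo l u)
    (ha : a ∈ Ioo 0 P) :
    ∃ α : ℝ → ℝ, α t = a ∧ ∀ s ∈ Ioo l u, α s ∈ Ioo 0 P ∧ HasDerivAt α (v s (α s)) s := by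
  -- Composing with the projection onto `[0, P]` makes the field globally Lipschitz and bounded by
  -- `K * P`, so Picard–Lindelöf works on the whole time interval at once.
  set pr : ℝ → ℝ := fun x => (projIcc 0 P hP.le x : ℝ) with hpr
  have hprm : ∀ x, pr x ∈ Icc 0 P := fun x => (projIcc 0 P hP.le x).2
  have hprL : ∀ x y, |pr x - pr y| ≤ |x - y| := fun x y => by
    have := (LipschitzWith.projIcc hP.le).dist_le_mul x y
    rw [Subtype.dist_eq, Real.dist_eq, Real.dist_eq] at this
    simpa using this
  have hpr0 : pr 0 = 0 := by simp only [hpr, projIcc_left]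
  have hprP : pr P = P := by simp only [hpr, projIcc_right]
  have hVL : ∀ s ∈ Icc l u, ∀ x y, |v s (pr x) - v s (pr y)| ≤ K * |x - y| := fun s hs x y =>
    (hLip s hs _ (hprm x) _ (hprm y)).trans (mul_le_mul_of_nonneg_left (hprL x y) hK.le)
  have hV0 : ∀ s ∈ Icc l u, ∀ x, |v s (pr x)| ≤ K * |x| := fun s hs x => by
    have := hVL s hs x 0
    rwa [hpr0, h0 s hs, sub_zero, sub_zero] at this
  have hVP : ∀ s ∈ Icc l u, ∀ x, |v s (pr x)| ≤ K * |P - x| := fun s hs x => by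
    have := hVL s hs x P
    rwa [hprP, hP0 s hs, sub_zero, abs_sub_comm x] at this
  have hVb : ∀ s ∈ Icc l u, ∀ x, |v s (pr x)| ≤ K * P := fun s hs x => by
    have := hLip s hs _ (hprm x) 0 ⟨le_rfl, hP.le⟩
    rw [h0 s hs, sub_zero, sub_zero, abs_of_nonneg (hprm x).1] at this
    exact this.trans (mul_le_mul_of_nonneg_left (hprm x).2 hK.le)
  have hlu : 0 < u - l := by linarith [ht.1, ht.2]
  have hPL : IsPicardLindelof (fun s x => v s (pr x)) (tmin := l) (tmax := u)
      ⟨t, Ioo_subset_Icc_self ht⟩ a (Real.toNNReal (K * P * (u - l))) 0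
      (Real.toNNReal (K * P)) (Real.toNNReal K) :=
    { lipschitzOnWith := fun s hs => LipschitzOnWith.of_dist_le_mul fun x _ y _ => by
        rw [Real.dist_eq, Real.dist_eq, Real.coe_toNNReal _ hK.le]
        exact hVL s hs x y
      continuousOn := fun x _ => hc _ (hprm x)
      norm_le := fun s hs x _ => by
        rw [Real.coe_toNNReal _ (by positivity)]
        exact hVb s hs x
      mul_max_le := by
        rw [Real.coe_toNNReal _ (by positivity), Real.coe_toNNReal _ (by positivity)]
        simp only [NNReal.coe_zero, sub_zero]
        refine mul_le_mul_of_nonneg_left (max_le ?_ ?_) (by positivity) <;>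
          linarith [ht.1, ht.2] }
  obtain ⟨α, hαt, hα⟩ := hPL.exists_eq_forall_mem_Icc_hasDerivWithinAt₀
  simp only at hαt
  have hαd : ∀ s ∈ Ioo l u, HasDerivAt α (v s (pr (α s))) s := fun s hs =>
    (hα s (Ioo_subset_Icc_self hs)).hasDerivAt (Icc_mem_nhds hs.1 hs.2)
  have hαc : ContinuousOn α (Ioo l u) := fun s hs => (hαd s hs).continuousAt.continuousWithinAt
  -- An end of the interval is an equilibrium: touching it at one time would, by Grönwall read from
  -- `s` to `t`, force the curve to be there at time `t`.
  have hne0 : ∀ s ∈ Ioo l u, α s ≠ 0 := fun s hs hs0 => by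
    have := norm_le_mul_exp_of_hasDerivAt (ε := 0) hK le_rfl hαd
      (fun r hr => by rw [add_zero]; exact hV0 r (Ioo_subset_Icc_self hr) _) hs ht
    rw [hs0, hαt] at this
    simp only [norm_zero, zero_mul, add_zero] at this
    exact ha.1.ne' (norm_le_zero_iff.1 this)
  have hneP : ∀ s ∈ Ioo l u, α s ≠ P := fun s hs hsP => by
    have := norm_le_mul_exp_of_hasDerivAt (f := fun r => P - α r) (ε := 0) hK le_rfl
      (fun r hr => (hαd r hr).const_sub P)
      (fun r hr => by
        rw [add_zero, norm_neg]; exact hVP r (Ioo_subset_Icc_self hr) _) hs ht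
    rw [hsP, hαt] at this
    simp only [sub_self, norm_zero, zero_mul, add_zero] at this
    have := norm_le_zero_iff.1 this
    linarith [ha.2]
  have hmem : ∀ s ∈ Ioo l u, α s ∈ Ioo 0 P := by
    intro s hs
    constructor
    · by_contra hle
      have := isPreconnected_Ioo.intermediate_value hs ht hαc
        (show (0 : ℝ) ∈ Icc (α s) (α t) from ⟨not_lt.1 hle, by rw [hαt]; exact ha.1.le⟩)
      obtain ⟨r, hr, hr0⟩ := this
      exact hne0 r hr hr0
    · by_contra hle
      have := isPreconnected_Ioo.intermediate_value ht hs hαc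
        (show P ∈ Icc (α t) (α s) from ⟨by rw [hαt]; exact ha.2.le, not_lt.1 hle⟩)
      obtain ⟨r, hr, hr0⟩ := this
      exact hneP r hr hr0
  refine ⟨α, hαt, fun s hs => ⟨hmem s hs, ?_⟩⟩
  have := hαd s hs
  have e : pr (α s) = α s := by
    simp only [hpr, projIcc_of_mem hP.le (Ioo_subset_Icc_self (hmem s hs))]
  rwa [e] at this

theorem abs_etaStar'_le {x : ℝ} (hx : x ∈ Ioo 0 (2 * π)) : |etaStar' x| ≤ 1 := by
  rw [etaStar'_of_mem hx, abs_le]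
  constructor <;> linarith [hx.1, hx.2, pi_lt_four]

theorem abs_le_Icc_of_Ioo {f : ℝ → ℝ} (hf : Continuous f) {C : ℝ}
    (h : ∀ x ∈ Ioo 0 (2 * π), |f x| ≤ C) : ∀ x ∈ Icc 0 (2 * π), |f x| ≤ C := by
  rw [← closure_Ioo two_pi_pos.ne]
  exact fun x hx => closure_minimal (s := Ioo 0 (2 * π)) (t := {x | |f x| ≤ C}) h
    (isClosed_le hf.abs continuous_const) hx

theorem abs_sub_le_Icc_of_Ioo {f : ℝ → ℝ} (hf : Continuous f) {C : ℝ} (hC : 0 ≤ C)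
    (h : ∀ x ∈ Ioo 0 (2 * π), ∀ y ∈ Ioo 0 (2 * π), |f x - f y| ≤ C * |x - y|) :
    ∀ x ∈ Icc 0 (2 * π), ∀ y ∈ Icc 0 (2 * π), |f x - f y| ≤ C * |x - y| := by
  have h1 : LipschitzOnWith (Real.toNNReal C) f (Ioo 0 (2 * π)) :=
    LipschitzOnWith.of_dist_le_mul fun x hx y hy => by
      rw [Real.dist_eq, Real.dist_eq, Real.coe_toNNReal _ hC]; exact h x hx y hy
  rw [← lipschitzOnWith_closure_iff hf.continuousOn, closure_Ioo two_pi_pos.ne] at h1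
  intro x hx y hy
  have := h1.dist_le_mul x hx y hy
  rwa [Real.dist_eq, Real.dist_eq, Real.coe_toNNReal _ hC] at this

/-! ### Lipschitz dependence of the nonlocal source on the perturbation -/

section Source

variable {z z' : ℝ → ℝ} {B M : ℝ}

theorem ae_abs_integrand_sub_le (hM : ∀ᵐ x ∂per, |weakDeriv z x| ≤ M)
    (hM' : ∀ᵐ x ∂per, |weakDeriv z' x| ≤ M)
    (hB : ∀ x ∈ Icc 0 (2 * π), |z' x - z x| ≤ B)
    (hB' : ∀ᵐ x ∂per, |weakDeriv z' x - weakDeriv z x| ≤ B) :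
    ∀ᵐ x ∂per, |(z' x + 2 * weakDeriv z' x ^ 2) - (z x + 2 * weakDeriv z x ^ 2)|
      ≤ (1 + 4 * M) * B := by
  filter_upwards [hM, hM', hB', ae_restrict_mem measurableSet_Ioc] with x h1 h2 h3 h4
  have h5 := hB x (Ioc_subset_Icc_self h4)
  have e : (z' x + 2 * weakDeriv z' x ^ 2) - (z x + 2 * weakDeriv z x ^ 2)
    = (z' x - z x) + 2 * ((weakDeriv z' x + weakDeriv z x) * (weakDeriv z' x - weakDeriv z x)) := by
    ring
  rw [e]
  refine (abs_add_le _ _).trans ?_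
  rw [abs_mul, abs_mul, abs_of_pos (by norm_num : (0 : ℝ) < 2)]
  have h6 : |weakDeriv z' x + weakDeriv z x| ≤ 2 * M := (abs_add_le _ _).trans (by linarith)
  have h7 := mul_le_mul h6 h3 (abs_nonneg _) ((abs_nonneg _).trans h6)
  linarith

/-- The summand 2 comes from the integral against `etaStar'`, which is bounded by 1 on the open
period. The factor 16 is half of the 8π of `primZero_sub_le`, with π < 4. -/
theorem abs_source_sub_le (hz : MemH1per z) (hz' : MemH1per z')
    (hM : ∀ᵐ x ∂per, |weakDeriv z x| ≤ M)
    (hM' : ∀ᵐ x ∂per, |weakDeriv z' x| ≤ M)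
    (hB : ∀ x ∈ Icc 0 (2 * π), |z' x - z x| ≤ B)
    (hB' : ∀ᵐ x ∂per, |weakDeriv z' x - weakDeriv z x| ≤ B) {x : ℝ} (hx : x ∈ Icc 0 (2 * π)) :
    |source z' x - source z x| ≤ (2 + 16 * (1 + 4 * M)) * B := by
  have h1 := primZero_sub_le hz'.integrable_source hz.integrable_source
    (ae_abs_integrand_sub_le hM hM' hB hB') hx
  have h2 : |(∫ y, etaStar' y * z' y ∂per) - ∫ y, etaStar' y * z y ∂per| ≤ 2 * π * B := by
    rw [integral_etaStar'_mul, integral_etaStar'_mul, ← intervalIntegral.integral_sub]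
    · have := abs_integral_le_of_ae_per (C := B)
        (g := fun y => (y - π) / 4 * z' y - (y - π) / 4 * z y) (a := 0) (b := 2 * π)
        (ae_per_of_forall fun y hy => by
          have h3 := abs_etaStar'_le hy
          rw [etaStar'_of_mem hy] at h3
          rw [← mul_sub, abs_mul]
          have := mul_le_mul h3 (hB y (Ioo_subset_Icc_self hy)) (abs_nonneg _) zero_le_one
          linarith) ⟨le_rfl, two_pi_pos.le⟩ ⟨two_pi_pos.le, le_rfl⟩
      rw [sub_zero, abs_of_pos two_pi_pos] at this
      linarith
    · exact (by have := hz'.2.1; fun_prop : Continuous fun y => (y - π) / 4 * z' y).intervalIntegrable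
        _ _
    · exact (by have := hz.2.1; fun_prop : Continuous fun y => (y - π) / 4 * z y).intervalIntegrable
        _ _
  set C := (1 + 4 * M) * B with hC
  have h3 : |π⁻¹ * ((∫ y, etaStar' y * z' y ∂per) - ∫ y, etaStar' y * z y ∂per)| ≤ 2 * B := by
    rw [abs_mul, abs_of_pos (inv_pos.2 pi_pos), inv_mul_le_iff₀ pi_pos]
    linarith
  have hC0 : 0 ≤ C := by
    have := (abs_nonneg _).trans h1
    have := pi_pos
    by_contra hcon
    have : 8 * π * C < 0 := mul_neg_of_pos_of_neg (by positivity) (not_le.1 hcon)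
    linarith
  have h4 : π * C ≤ 4 * C := mul_le_mul_of_nonneg_right pi_lt_four.le hC0
  simp only [source]
  have e : ∀ a b c d : ℝ, -(π⁻¹ * a) + 1 / 2 * b - (-(π⁻¹ * c) + 1 / 2 * d)
      = -(π⁻¹ * (a - c)) + 1 / 2 * (b - d) := fun a b c d => by ring
  rw [e]
  refine (abs_add_le _ _).trans ?_
  rw [abs_neg, abs_mul (1 / 2 : ℝ), abs_of_pos (by norm_num : (0 : ℝ) < 1 / 2)]
  have : (2 + 16 * (1 + 4 * M)) * B = 2 * B + 16 * C := by rw [hC]; ring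
  rw [this]
  linarith

/-- The integral against `etaStar'` is constant in space and cancels in increments, so only half the
zero-mean primitive remains, and it gains one derivative. -/
theorem abs_source_increment_le (hz : MemH1per z) (hz' : MemH1per z')
    (hM : ∀ᵐ x ∂per, |weakDeriv z x| ≤ M)
    (hM' : ∀ᵐ x ∂per, |weakDeriv z' x| ≤ M)
    (hB : ∀ x ∈ Icc 0 (2 * π), |z' x - z x| ≤ B)
    (hB' : ∀ᵐ x ∂per, |weakDeriv z' x - weakDeriv z x| ≤ B) {x y : ℝ} (hx : x ∈ Icc 0 (2 * π))
    (hy : y ∈ Icc 0 (2 * π)) :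
    |(source z' y - source z y) - (source z' x - source z x)| ≤ (1 + 4 * M) * B * |y - x| := by
  have h1 := primZero_increment_le hz'.integrable_source hz.integrable_source
    (ae_abs_integrand_sub_le hM hM' hB hB') hx hy
  simp only [source]
  have e : ∀ a b c d e f : ℝ, -a + 1 / 2 * b - (-e + 1 / 2 * d) - (-a + 1 / 2 * c - (-e + 1 / 2 * f))
      = 1 / 2 * (b - c - (d - f)) := fun a b c d e f => by ring
  rw [e, abs_mul, abs_of_pos (by norm_num : (0 : ℝ) < 1 / 2)]
  linarith

end Source

/-! ### Uniqueness of local solutions -/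

/-- On a short time interval, the distance of two local solutions that agree at some time is
reduced by a factor proportional to the length of the interval. -/
theorem IsLocalSolution.contraction {τ τ' : ℝ} {ζ ζ' g : ℝ → ℝ → ℝ} (h : IsLocalSolution τ ζ)
    (h' : IsLocalSolution τ' ζ') {l u M L B : ℝ} (hl : Icc l u ⊆ Ioo (-τ) τ)
    (hl' : Icc l u ⊆ Ioo (-τ') τ') (hlu : u - l ≤ 1) (hM0 : 0 ≤ M) (hL0 : 0 ≤ L) (hB0 : 0 ≤ B)
    (hM : ∀ s ∈ Icc l u, ∀ᵐ x ∂per, |weakDeriv (ζ s) x| ≤ M)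
    (hM' : ∀ s ∈ Icc l u, ∀ᵐ x ∂per, |weakDeriv (ζ' s) x| ≤ M)
    (hV : ∀ s ∈ Icc l u, ∀ x ∈ Ioo 0 (2 * π), 0 < speed (ζ s) x)
    (hV' : ∀ s ∈ Icc l u, ∀ x ∈ Ioo 0 (2 * π), 0 < speed (ζ' s) x)
    (hg : ∀ s ∈ Icc l u, ∀ x ∈ Ioo 0 (2 * π), HasDerivAt (ζ s) (g s x) x)
    (hgb : ∀ s ∈ Icc l u, ∀ x ∈ Ioo 0 (2 * π), |g s x| ≤ L)
    (hgL : ∀ s ∈ Icc l u, ∀ x ∈ Ioo 0 (2 * π), ∀ y ∈ Ioo 0 (2 * π),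
      |g s x - g s y| ≤ L * |x - y|)
    {t₀ : ℝ} (ht₀ : t₀ ∈ Ioo l u) (heq : ζ' t₀ = ζ t₀)
    (hB : ∀ s ∈ Ioo l u, ∀ x ∈ Icc 0 (2 * π), |ζ' s x - ζ s x| ≤ B)
    (hBL : ∀ s ∈ Ioo l u, ∀ x ∈ Icc 0 (2 * π), ∀ y ∈ Icc 0 (2 * π),
      |(ζ' s x - ζ s x) - (ζ' s y - ζ s y)| ≤ B * |x - y|)
    {t : ℝ} (ht : t ∈ Ioo l u) :
    (∀ x ∈ Icc 0 (2 * π), |ζ' t x - ζ t x|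
        ≤ (2 + 16 * (1 + 4 * M) + 6 * L) * exp (π / 2 + 2 * M) * (u - l) * B) ∧
      ∀ x ∈ Icc 0 (2 * π), ∀ y ∈ Icc 0 (2 * π), |(ζ' t x - ζ t x) - (ζ' t y - ζ t y)|
        ≤ (2 + 16 * (1 + 4 * M) + 6 * L) * exp (π / 2 + 2 * M) * (u - l) * B * |x - y| := by
  have hc1 := one_le_cStar
  have hk : 0 < 2 * cStar := by linarith
  set K := π / 2 + 2 * M with hKdef
  have hK : 0 < K := by positivity
  have hmem : ∀ s ∈ Icc l u, MemH1per (ζ s) := fun s hs => (h.mem s (hl hs)).1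
  have hmem' : ∀ s ∈ Icc l u, MemH1per (ζ' s) := fun s hs => (h'.mem s (hl' hs)).1
  have hI := @Ioo_subset_Icc_self ℝ _ l u
  have hJ := @Ioo_subset_Icc_self ℝ _ 0 (2 * π)
  -- Transporting the difference with the speed of `ζ'` removes the term with the difference of the
  -- slopes. What is left is the difference of the sources and the difference of the speeds, -2
  -- times the increment of ζ' - ζ from the peak, multiplied by the slope `g` of the regular
  -- solution alone.
  set R : ℝ → ℝ → ℝ := fun s x => ((source (ζ' s) x - source (ζ s) x)
    - 2 * ((ζ' s x - ζ s x) - (ζ' s 0 - ζ s 0)) * g s x) / (2 * cStar) with hR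
  -- the weak derivatives are close
  have hBw : ∀ s ∈ Ioo l u, ∀ᵐ x ∂per, |weakDeriv (ζ' s) x - weakDeriv (ζ s) x| ≤ B := by
    intro s hs
    obtain ⟨q, hq, hqd, -⟩ := h.exists_slope (hl (hI hs)) fun x hx => (hV s (hI hs) x hx).ne'
    obtain ⟨q', hq', hqd', -⟩ := h'.exists_slope (hl' (hI hs)) fun x hx => (hV' s (hI hs) x hx).ne'
    filter_upwards [hq, hq', ae_per_of_forall (p := fun x => |q' x - q x| ≤ B) fun x hx => by
      refine ((hqd' x hx).sub (hqd x hx)).le_of_lip' hB0 ?_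
      filter_upwards [isOpen_Ioo.mem_nhds hx] with y hy
      exact hBL s hs y (hJ hy) x (hJ hx)] with x h1 h2 h3
    rwa [h1, h2]
  -- derivative of the difference along characteristics
  have hder : ∀ α : ℝ → ℝ, ∀ s ∈ Ioo l u, α s ∈ Ioo 0 (2 * π) →
      HasDerivAt α (-speed (ζ' s) (α s) / (2 * cStar)) s →
      HasDerivAt (fun r => ζ' r (α r) - ζ r (α r)) (R s (α s)) s := by
    intro α s hs hα hα'
    obtain ⟨q, hq, hqd, hqc⟩ := h.exists_slope (hl (hI hs)) fun x hx => (hV s (hI hs) x hx).ne'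
    obtain ⟨q', hq', hqd', hqc'⟩ :=
      h'.exists_slope (hl' (hI hs)) fun x hx => (hV' s (hI hs) x hx).ne'
    have e : q (α s) = g s (α s) := (hqd _ hα).unique (hg s (hI hs) _ hα)
    refine ((hqc' _ hα α _ rfl hα').sub (hqc _ hα α _ rfl hα')).congr_deriv ?_
    simp only [hR, speed, e]
    field_simp
    ring
  have h0mem : (0 : ℝ) ∈ Icc 0 (2 * π) := ⟨le_rfl, two_pi_pos.le⟩
  have hw0 : ∀ s ∈ Ioo l u, ∀ x ∈ Icc 0 (2 * π),
      |(ζ' s x - ζ s x) - (ζ' s 0 - ζ s 0)| ≤ 2 * B := fun s hs x hx =>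
    (abs_sub _ _).trans (by linarith [hB s hs x hx, hB s hs 0 h0mem])
  have hRb : ∀ s ∈ Ioo l u, ∀ x ∈ Ioo 0 (2 * π),
      |R s x| ≤ (2 + 16 * (1 + 4 * M) + 6 * L) * B := by
    intro s hs x hx
    have h1 := abs_source_sub_le (hmem s (hI hs)) (hmem' s (hI hs)) (hM s (hI hs)) (hM' s (hI hs))
      (hB s hs) (hBw s hs) (hJ hx)
    have h2 := mul_le_mul (hw0 s hs x (hJ hx)) (hgb s (hI hs) x hx) (abs_nonneg _)
      (by positivity)
    simp only [hR]
    rw [abs_div, abs_of_pos hk, div_le_iff₀ hk]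
    refine (abs_sub _ _).trans ?_
    rw [mul_assoc, abs_mul, abs_mul, abs_of_pos (by norm_num : (0 : ℝ) < 2)]
    have h3 : 0 ≤ (2 + 16 * (1 + 4 * M) + 6 * L) * B := by positivity
    have h4 : 0 ≤ B * L := by positivity
    nlinarith
  -- This is where the Lipschitz bound on `g` is needed. The product contributes 2(BL + 2B·L) = 6BL,
  -- which fixes the coefficient of `L` in the constant.
  have hRL : ∀ s ∈ Ioo l u, ∀ x ∈ Ioo 0 (2 * π), ∀ y ∈ Ioo 0 (2 * π),
      |R s y - R s x| ≤ (2 + 16 * (1 + 4 * M) + 6 * L) * B * |y - x| := by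
    intro s hs x hx y hy
    have h1 := abs_source_increment_le (hmem s (hI hs)) (hmem' s (hI hs)) (hM s (hI hs))
      (hM' s (hI hs)) (hB s hs) (hBw s hs) (hJ hx) (hJ hy)
    have h2 := mul_le_mul (hBL s hs y (hJ hy) x (hJ hx)) (hgb s (hI hs) y hy) (abs_nonneg _)
      (by positivity)
    have h3 := mul_le_mul (hw0 s hs x (hJ hx)) (hgL s (hI hs) y hy x hx) (abs_nonneg _)
      (by positivity)
    have e : R s y - R s x = (((source (ζ' s) y - source (ζ s) y)
        - (source (ζ' s) x - source (ζ s) x))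
        - 2 * (((ζ' s y - ζ s y) - (ζ' s x - ζ s x)) * g s y
          + ((ζ' s x - ζ s x) - (ζ' s 0 - ζ s 0)) * (g s y - g s x))) / (2 * cStar) := by
      simp only [hR]; ring
    rw [e, abs_div, abs_of_pos hk, div_le_iff₀ hk]
    refine (abs_sub _ _).trans ?_
    rw [abs_mul (2 : ℝ), abs_of_pos (by norm_num : (0 : ℝ) < 2)]
    have h4 := abs_add_le (((ζ' s y - ζ s y) - (ζ' s x - ζ s x)) * g s y)
      (((ζ' s x - ζ s x) - (ζ' s 0 - ζ s 0)) * (g s y - g s x))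
    rw [abs_mul, abs_mul] at h4
    set d := |y - x| with hd
    have hd0 : 0 ≤ d := abs_nonneg _
    have h5 : 0 ≤ (2 + 16 * (1 + 4 * M) + 6 * L) * B * d := by positivity
    have h6 : 0 ≤ B * d * L := by positivity
    have h7 : 0 ≤ M * (B * d) := by positivity
    have h8 : 0 ≤ B * d := by positivity
    nlinarith
  -- characteristics through points of the open interval
  have hchar : ∀ a ∈ Ioo 0 (2 * π), ∃ α : ℝ → ℝ, α t = a ∧ ∀ s ∈ Ioo l u,
      α s ∈ Ioo 0 (2 * π) ∧ HasDerivAt α (-speed (ζ' s) (α s) / (2 * cStar)) s := by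
    intro a ha
    refine exists_characteristic (v := fun s x => -speed (ζ' s) x / (2 * cStar)) two_pi_pos hK
      ?_ ?_ ?_ ?_ ht ha
    · intro s hs x hx y hy
      have := abs_speed_sub_le (hmem' s hs) (hM' s hs) hx hy
      have e : -speed (ζ' s) x / (2 * cStar) - -speed (ζ' s) y / (2 * cStar)
          = -(speed (ζ' s) x - speed (ζ' s) y) / (2 * cStar) := by ring
      rw [e, abs_div, abs_neg, abs_of_pos hk, div_le_iff₀ hk]
      rw [← hKdef] at this
      have h0 : 0 ≤ K * |x - y| := by positivity
      exact this.trans (le_mul_of_one_le_right h0 (by linarith))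
    · intro s hs
      simp [speed_eq h0mem]
    · intro s hs
      simp [speed_eq (⟨two_pi_pos.le, le_rfl⟩ : 2 * π ∈ Icc 0 (2 * π)), (hmem' s hs).apply_two_pi]
    · intro x hx
      have hcz : ∀ y ∈ Icc 0 (2 * π), ContinuousOn (fun s => ζ' s y) (Icc l u) := by
        intro y hy s hs
        refine ContinuousAt.continuousWithinAt ?_
        rw [Metric.continuousAt_iff']
        intro ε hε
        filter_upwards [h'.eventually_close (hl' hs) (half_pos hε)] with r hr
        rw [Real.dist_eq]
        linarith [hr.1 y hy]
      have := hcz x hx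
      have := hcz 0 h0mem
      simp only [speed_eq hx]
      fun_prop
  have hul : 0 ≤ u - l := by linarith [ht.1, ht.2]
  have htt : |t - t₀| ≤ u - l := by
    rw [abs_le]; constructor <;> linarith [ht.1, ht.2, ht₀.1, ht₀.2]
  set C := 2 + 16 * (1 + 4 * M) + 6 * L with hCdef
  have hC0 : 0 ≤ C := by positivity
  have hexp : 1 ≤ exp K := one_le_exp hK.le
  have hcont : Continuous fun x => ζ' t x - ζ t x := (hmem' t (hI ht)).2.1.sub (hmem t (hI ht)).2.1
  refine ⟨abs_le_Icc_of_Ioo hcont ?_, abs_sub_le_Icc_of_Ioo hcont (by positivity) ?_⟩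
  · intro a ha
    obtain ⟨α, hαt, hα⟩ := hchar a ha
    have := (convex_Ioo l u).norm_image_sub_le_of_norm_hasDerivWithin_le (C := C * B)
      (fun s hs => (hder α s hs (hα s hs).1 (hα s hs).2).hasDerivWithinAt)
      (fun s hs => hRb s hs _ (hα s hs).1) ht₀ ht
    rw [heq, sub_self, sub_zero, hαt, Real.norm_eq_abs, Real.norm_eq_abs] at this
    refine this.trans ?_
    calc C * B * |t - t₀| ≤ C * B * (u - l) := by gcongr
      _ = C * 1 * (u - l) * B := by ring
      _ ≤ C * exp K * (u - l) * B := by gcongr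
  · intro b hb a ha
    obtain ⟨α, hαt, hα⟩ := hchar a ha
    obtain ⟨β, hβt, hβ⟩ := hchar b hb
    -- Two characteristics separate by at most a factor e^K over a time of length at most 1. This
    -- factor is the exponential in the contraction constant.
    have hαβ : ∀ s ∈ Ioo l u, |β s - α s| ≤ |b - a| * exp K := by
      intro s hs
      have := norm_le_mul_exp_of_hasDerivAt (f := fun r => β r - α r) (K := K) (ε := 0) hK le_rfl
        (fun r hr => (hβ r hr).2.sub (hα r hr).2)
        (fun r hr => by
          have h1 := abs_speed_sub_le (hmem' r (hI hr)) (hM' r (hI hr)) (hJ (hβ r hr).1)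
            (hJ (hα r hr).1)
          have e : -speed (ζ' r) (β r) / (2 * cStar) - -speed (ζ' r) (α r) / (2 * cStar)
            = -(speed (ζ' r) (β r) - speed (ζ' r) (α r)) / (2 * cStar) := by ring
          rw [e, add_zero, Real.norm_eq_abs, Real.norm_eq_abs, abs_div, abs_neg, abs_of_pos hk,
            div_le_iff₀ hk]
          rw [← hKdef] at h1
          have h0 : 0 ≤ K * |β r - α r| := by positivity
          exact h1.trans (le_mul_of_one_le_right h0 (by linarith))) ht hs
      rw [hβt, hαt, zero_mul, add_zero, Real.norm_eq_abs, Real.norm_eq_abs] at this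
      refine this.trans (mul_le_mul_of_nonneg_left (exp_le_exp.2 ?_) (abs_nonneg _))
      have : |s - t| ≤ 1 := by
        rw [abs_le]; constructor <;> linarith [ht.1, ht.2, hs.1, hs.2]
      nlinarith
    have := (convex_Ioo l u).norm_image_sub_le_of_norm_hasDerivWithin_le
      (C := C * B * (|b - a| * exp K))
      (fun s hs => ((hder β s hs (hβ s hs).1 (hβ s hs).2).sub
        (hder α s hs (hα s hs).1 (hα s hs).2)).hasDerivWithinAt)
      (fun s hs => (hRL s hs _ (hα s hs).1 _ (hβ s hs).1).trans
        (mul_le_mul_of_nonneg_left (hαβ s hs) (by positivity))) ht₀ ht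
    simp only [Pi.sub_apply, heq, sub_self, sub_zero, hαt, hβt, Real.norm_eq_abs] at this
    refine this.trans ?_
    calc C * B * (|b - a| * exp K) * |t - t₀| ≤ C * B * (|b - a| * exp K) * (u - l) := by gcongr
      _ = C * exp K * (u - l) * B * |b - a| := by ring

theorem eq_of_eqOn_Icc_of_periodic {f g : ℝ → ℝ} (hf : Function.Periodic f (2 * π))
    (hg : Function.Periodic g (2 * π)) (h : ∀ x ∈ Icc 0 (2 * π), f x = g x) : f = g := by
  funext x
  have hd : Function.Periodic (fun x => f x - g x) (2 * π) := fun y => by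
    simp only [hf y, hg y]
  obtain ⟨y, hy, hxy⟩ := hd.exists_mem_Ico₀ two_pi_pos x
  have := h y (Ico_subset_Icc_self hy)
  rw [this, sub_self] at hxy
  exact sub_eq_zero.1 hxy

/-- Local solutions with a Lipschitz slope and a positive transport speed are locally unique. -/
theorem IsLocalSolution.eventually_eq {τ τ' : ℝ} {ζ ζ' g : ℝ → ℝ → ℝ} (h : IsLocalSolution τ ζ)
    (h' : IsLocalSolution τ' ζ') {L : ℝ}
    (hV : ∀ s ∈ Ioo (-τ) τ, ∃ κ > 0, ∀ x ∈ Icc 0 (2 * π), κ * min x (2 * π - x) ≤ speed (ζ s) x)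
    (hg : ∀ s ∈ Ioo (-τ) τ, ∀ x ∈ Ioo 0 (2 * π), HasDerivAt (ζ s) (g s x) x)
    (hgb : ∀ s ∈ Ioo (-τ) τ, ∀ x ∈ Ioo 0 (2 * π), |g s x| ≤ L)
    (hgL : ∀ s ∈ Ioo (-τ) τ, ∀ x ∈ Ioo 0 (2 * π), ∀ y ∈ Ioo 0 (2 * π),
      |g s x - g s y| ≤ L * |x - y|)
    {t₀ : ℝ} (ht₀ : t₀ ∈ Ioo (-τ) τ) (ht₀' : t₀ ∈ Ioo (-τ') τ') (heq : ζ' t₀ = ζ t₀) :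
    ∀ᶠ t in 𝓝 t₀, ζ' t = ζ t := by
  have hL0 : 0 ≤ L := (abs_nonneg _).trans (hgb t₀ ht₀ π ⟨pi_pos, by linarith [pi_pos]⟩)
  have h0mem : (0 : ℝ) ∈ Icc 0 (2 * π) := ⟨le_rfl, two_pi_pos.le⟩
  have h2mem : 2 * π ∈ Icc 0 (2 * π) := ⟨two_pi_pos.le, le_rfl⟩
  obtain ⟨κ, hκ, hκV⟩ := hV t₀ ht₀
  -- Slopes within ε of those at `t₀` change the speed by at most 2ε times the distance to the
  -- nearer end, hence by at most half of its lower bound. The bound ε ≤ 1 gives the slope bound `M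
  -- = L + 1`.
  set ε := min 1 (κ / 4) with hε
  have hε0 : 0 < ε := by positivity
  have hε1 : ε ≤ 1 := min_le_left _ _
  have hε2 : ε ≤ κ / 4 := min_le_right _ _
  have hwd0 : ∀ᵐ x ∂per, |weakDeriv (ζ t₀) x| ≤ L := by
    have hpos : ∀ x ∈ Ioo 0 (2 * π), 0 < min x (2 * π - x) := fun x hx =>
      lt_min hx.1 (by linarith [hx.2])
    obtain ⟨q, hq, hqd, -⟩ := h.exists_slope ht₀ fun x hx =>
      ((mul_pos hκ (hpos x hx)).trans_le (hκV x (Ioo_subset_Icc_self hx))).ne'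
    filter_upwards [hq, ae_per_of_forall (p := fun x => |q x| ≤ L) fun x hx => by
      rw [(hqd x hx).unique (hg t₀ ht₀ x hx)]; exact hgb t₀ ht₀ x hx] with x h1 h2
    rwa [h1]
  obtain ⟨σ, hσ, hσb⟩ := Metric.eventually_nhds_iff.1
    (((h.eventually_close ht₀ hε0).and (h'.eventually_close ht₀' hε0)).and
      ((isOpen_Ioo.eventually_mem ht₀).and (isOpen_Ioo.eventually_mem ht₀')))
  set M := L + 1 with hM
  have hM0 : 0 ≤ M := by positivity
  set C := (2 + 16 * (1 + 4 * M) + 6 * L) * exp (π / 2 + 2 * M) with hC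
  have hC0 : 0 < C := by positivity
  -- The three bounds keep the interval inside the neighbourhood, make its length at most 1 as
  -- `contraction` requires, and make the contraction factor at most 1/2.
  set r := min (σ / 2) (min (1 / 2) (1 / (4 * C))) with hr
  have hr0 : 0 < r := by positivity
  have hrσ : r < σ := (min_le_left _ _).trans_lt (by linarith)
  have hr1 : r ≤ 1 / 2 := (min_le_right _ _).trans (min_le_left _ _)
  have hrC : C * (2 * r) ≤ 1 / 2 := by
    have : r ≤ 1 / (4 * C) := (min_le_right _ _).trans (min_le_right _ _)
    rw [le_div_iff₀ (by positivity)] at this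
    linarith
  set l := t₀ - r with hl
  set u := t₀ + r with hu
  have hball : ∀ s ∈ Icc l u, dist s t₀ < σ := fun s hs => by
    rw [Real.dist_eq]
    refine lt_of_le_of_lt ?_ hrσ
    rw [abs_le]; constructor <;> linarith [hs.1, hs.2]
  have hlτ : Icc l u ⊆ Ioo (-τ) τ := fun s hs => (hσb (hball s hs)).2.1
  have hlτ' : Icc l u ⊆ Ioo (-τ') τ' := fun s hs => (hσb (hball s hs)).2.2
  have hMζ : ∀ s ∈ Icc l u, ∀ᵐ x ∂per, |weakDeriv (ζ s) x| ≤ M := fun s hs => by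
    filter_upwards [(hσb (hball s hs)).1.1.2, hwd0] with x h1 h2
    rw [abs_le] at h1 h2 ⊢
    constructor <;> linarith [h1.1, h1.2, h2.1, h2.2]
  have hMζ' : ∀ s ∈ Icc l u, ∀ᵐ x ∂per, |weakDeriv (ζ' s) x| ≤ M := fun s hs => by
    filter_upwards [(hσb (hball s hs)).1.2.2, hwd0] with x h1 h2
    rw [heq] at h1
    rw [abs_le] at h1 h2 ⊢
    constructor <;> linarith [h1.1, h1.2, h2.1, h2.2]
  have hmin : ∀ x ∈ Ioo 0 (2 * π), 0 < min x (2 * π - x) := fun x hx =>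
    lt_min hx.1 (by linarith [hx.2])
  have hVζ : ∀ s ∈ Icc l u, ∀ x ∈ Ioo 0 (2 * π), 0 < speed (ζ s) x := fun s hs x hx => by
    obtain ⟨κ', hκ', hκ'V⟩ := hV s (hlτ hs)
    exact (mul_pos hκ' (hmin x hx)).trans_le (hκ'V x (Ioo_subset_Icc_self hx))
  have hmζ : ∀ s ∈ Icc l u, MemH1per (ζ s) := fun s hs => (h.mem s (hlτ hs)).1
  have hmζ' : ∀ s ∈ Icc l u, MemH1per (ζ' s) := fun s hs => (h'.mem s (hlτ' hs)).1
  have ht₀I : t₀ ∈ Icc l u := ⟨by linarith, by linarith⟩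
  -- The competitor inherits positivity of the speed. The change of its increment from the peak is
  -- estimated from whichever end is nearer, periodicity identifying the values at 0 and 2π.
  have hVζ' : ∀ s ∈ Icc l u, ∀ x ∈ Ioo 0 (2 * π), 0 < speed (ζ' s) x := fun s hs x hx => by
    have hx' := Ioo_subset_Icc_self hx
    have hd := (hmζ' s hs).isWeakDeriv.sub (hmζ' t₀ ht₀I).isWeakDeriv
    have hdc : Continuous fun y => ζ' s y - ζ' t₀ y := (hmζ' s hs).2.1.sub (hmζ' t₀ ht₀I).2.1
    have h1 := abs_integral_le_of_ae_per (hσb (hball s hs)).1.2.2 h0mem hx'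
    have h2 := abs_integral_le_of_ae_per (hσb (hball s hs)).1.2.2 hx' h2mem
    rw [← hd.sub_eq_integral hdc h0mem hx', heq] at h1
    rw [← hd.sub_eq_integral hdc hx' h2mem, heq, (hmζ' s hs).apply_two_pi,
      (hmζ t₀ ht₀I).apply_two_pi] at h2
    rw [sub_zero, abs_of_pos hx.1] at h1
    rw [abs_of_pos (sub_pos.2 hx.2)] at h2
    have h3 := hκV x hx'
    have h4 : (ζ' s x - ζ t₀ x) - (ζ' s 0 - ζ t₀ 0) ≤ ε * min x (2 * π - x) := by
      rw [mul_min_of_nonneg _ _ hε0.le]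
      rw [abs_le] at h1 h2
      exact le_min (by linarith [h1.2]) (by linarith [h2.1])
    have h5 : speed (ζ' s) x = speed (ζ t₀) x - 2 * ((ζ' s x - ζ t₀ x) - (ζ' s 0 - ζ t₀ 0)) := by
      simp only [speed]; ring
    have h6 := hmin x hx
    have h7 : ε * min x (2 * π - x) ≤ κ / 4 * min x (2 * π - x) := by gcongr
    have h8 : 0 < κ * min x (2 * π - x) := by positivity
    rw [h5]
    linarith
  -- iterate the contraction
  have hit : ∀ n : ℕ, (∀ s ∈ Ioo l u, ∀ x ∈ Icc 0 (2 * π),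
        |ζ' s x - ζ s x| ≤ 2 * M * (1 / 2) ^ n) ∧
      ∀ s ∈ Ioo l u, ∀ x ∈ Icc 0 (2 * π), ∀ y ∈ Icc 0 (2 * π),
        |(ζ' s x - ζ s x) - (ζ' s y - ζ s y)| ≤ 2 * M * (1 / 2) ^ n * |x - y| := by
    intro n
    induction n with
    | zero =>
      simp only [pow_zero, mul_one]
      refine ⟨fun s hs x hx => ?_, fun s hs x hx y hy => ?_⟩
      · have h1 := (hσb (hball s (Ioo_subset_Icc_self hs))).1.1.1 x hx
        have h2 := (hσb (hball s (Ioo_subset_Icc_self hs))).1.2.1 x hx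
        rw [heq] at h2
        have h3 : ζ' s x - ζ s x = (ζ' s x - ζ t₀ x) - (ζ s x - ζ t₀ x) := by ring
        rw [h3]
        exact (abs_sub _ _).trans (by linarith)
      · have hs' := Ioo_subset_Icc_self hs
        have h1 := (hmζ s hs').abs_sub_le (hMζ s hs') hy hx
        have h2 := (hmζ' s hs').abs_sub_le (hMζ' s hs') hy hx
        have h3 : (ζ' s x - ζ s x) - (ζ' s y - ζ s y)
          = (ζ' s x - ζ' s y) - (ζ s x - ζ s y) := by ring
        rw [h3]
        exact (abs_sub _ _).trans (by linarith)
    | succ n ih =>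
      have hB0 : 0 ≤ 2 * M * (1 / 2 : ℝ) ^ n := by positivity
      have hle : (2 + 16 * (1 + 4 * M) + 6 * L) * exp (π / 2 + 2 * M) * (u - l)
          * (2 * M * (1 / 2) ^ n) ≤ 2 * M * (1 / 2) ^ (n + 1) := by
        have e : u - l = 2 * r := by rw [hu, hl]; ring
        rw [← hC, e, pow_succ]
        calc C * (2 * r) * (2 * M * (1 / 2) ^ n) ≤ 1 / 2 * (2 * M * (1 / 2) ^ n) := by gcongr
          _ = 2 * M * ((1 / 2) ^ n * (1 / 2)) := by ring
      have key := fun t (ht : t ∈ Ioo l u) => h.contraction h' (t := t) hlτ hlτ'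
        (by rw [hu, hl]; linarith) hM0 hL0 hB0 hMζ hMζ' hVζ hVζ' (fun s hs => hg s (hlτ hs))
        (fun s hs => hgb s (hlτ hs)) (fun s hs => hgL s (hlτ hs))
        (⟨by linarith, by linarith⟩ : t₀ ∈ Ioo l u) heq ih.1 ih.2 ht
      exact ⟨fun s hs x hx => ((key s hs).1 x hx).trans hle, fun s hs x hx y hy =>
        ((key s hs).2 x hx y hy).trans (mul_le_mul_of_nonneg_right hle (abs_nonneg _))⟩
  have hnhd : Ioo l u ∈ 𝓝 t₀ := isOpen_Ioo.mem_nhds ⟨by linarith, by linarith⟩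
  filter_upwards [hnhd] with s hs
  have hs' := Ioo_subset_Icc_self hs
  refine eq_of_eqOn_Icc_of_periodic (hmζ' s hs').1 (hmζ s hs').1 fun x hx => ?_
  have hlim : Tendsto (fun n : ℕ => 2 * M * (1 / 2 : ℝ) ^ n) atTop (𝓝 0) := by
    simpa using (tendsto_pow_atTop_nhds_zero_of_lt_one (by norm_num : (0 : ℝ) ≤ 1 / 2)
      (by norm_num)).const_mul (2 * M)
  have := ge_of_tendsto' hlim fun n => (hit n).1 s hs x hx
  exact sub_eq_zero.1 (abs_eq_zero.1 (le_antisymm this (abs_nonneg _)))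

/-- Uniqueness of local solutions with a Lipschitz slope and a positive transport speed. -/
theorem IsLocalSolution.unique {τ τ' : ℝ} {ζ ζ' g : ℝ → ℝ → ℝ} (h : IsLocalSolution τ ζ)
    (h' : IsLocalSolution τ' ζ') (hτ : 0 < τ) (hτ' : 0 < τ') {L : ℝ}
    (hV : ∀ s ∈ Ioo (-τ) τ, ∃ κ > 0, ∀ x ∈ Icc 0 (2 * π), κ * min x (2 * π - x) ≤ speed (ζ s) x)
    (hg : ∀ s ∈ Ioo (-τ) τ, ∀ x ∈ Ioo 0 (2 * π), HasDerivAt (ζ s) (g s x) x)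
    (hgb : ∀ s ∈ Ioo (-τ) τ, ∀ x ∈ Ioo 0 (2 * π), |g s x| ≤ L)
    (hgL : ∀ s ∈ Ioo (-τ) τ, ∀ x ∈ Ioo 0 (2 * π), ∀ y ∈ Ioo 0 (2 * π),
      |g s x - g s y| ≤ L * |x - y|) (heq : ζ' 0 = ζ 0) {t : ℝ} (ht : |t| < τ) (ht' : |t| < τ') :
    ζ' t = ζ t := by
  set I := Ioo (-τ) τ ∩ Ioo (-τ') τ' with hI
  have hIc : IsPreconnected I := by
    rw [hI, Ioo_inter_Ioo]; exact isPreconnected_Ioo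
  -- The times of agreement form an open set by local uniqueness, the times of disagreement by
  -- continuity in time. A connected interval cannot meet both.
  have hS : IsOpen (I ∩ {s | ζ' s = ζ s}) := by
    rw [isOpen_iff_mem_nhds]
    intro s hs
    filter_upwards [isOpen_Ioo.mem_nhds hs.1.1, isOpen_Ioo.mem_nhds hs.1.2,
      h.eventually_eq h' hV hg hgb hgL hs.1.1 hs.1.2 hs.2] with r h1 h2 h3
    exact ⟨⟨h1, h2⟩, h3⟩
  have hS' : IsOpen (I ∩ {s | ζ' s ≠ ζ s}) := by
    rw [isOpen_iff_mem_nhds]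
    intro s hs
    obtain ⟨x, hx, hne⟩ : ∃ x ∈ Icc 0 (2 * π), ζ' s x ≠ ζ s x := by
      by_contra! hcon
      exact hs.2 (eq_of_eqOn_Icc_of_periodic (h'.mem s hs.1.2).1.1 (h.mem s hs.1.1).1.1 hcon)
    have hε : 0 < |ζ' s x - ζ s x| / 4 := by
      have := abs_pos.2 (sub_ne_zero.2 hne); positivity
    filter_upwards [isOpen_Ioo.mem_nhds hs.1.1, isOpen_Ioo.mem_nhds hs.1.2,
      h.eventually_close hs.1.1 hε, h'.eventually_close hs.1.2 hε] with r h1 h2 h3 h4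
    refine ⟨⟨h1, h2⟩, fun hr => ?_⟩
    have h5 := h3.1 x hx
    have h6 := h4.1 x hx
    rw [hr] at h6
    have h7 : ζ' s x - ζ s x = (ζ r x - ζ s x) - (ζ r x - ζ' s x) := by ring
    have h8 : |ζ' s x - ζ s x| ≤ |ζ r x - ζ s x| + |ζ r x - ζ' s x| := by
      conv_lhs => rw [h7]
      exact abs_sub _ _
    linarith
  have htI : t ∈ I := ⟨abs_lt.1 ht, abs_lt.1 ht'⟩
  by_contra hne
  obtain ⟨s, -, hs1, hs2⟩ := hIc _ _ hS hS'
    (fun s hs => by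
      by_cases hsz : ζ' s = ζ s
      · exact Or.inl ⟨hs, hsz⟩
      · exact Or.inr ⟨hs, hsz⟩)
    ⟨0, ⟨⟨by linarith, hτ⟩, by linarith, hτ'⟩, ⟨⟨by linarith, hτ⟩, by linarith, hτ'⟩, heq⟩
    ⟨t, htI, htI, hne⟩
  exact hs2.2 hs1.2

/-! ### Classical solutions are local solutions -/

theorem tendsto_eLpNorm_of_ae_bound {ι : Type*} {l : Filter ι} {F : ι → ℝ → ℝ} (p : ℝ≥0∞)
    (h : ∀ ε > 0, ∀ᶠ s in l, ∀ᵐ x ∂per, |F s x| ≤ ε) :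
    Tendsto (fun s => eLpNorm (F s) p per) l (𝓝 0) := by
  rw [ENNReal.tendsto_nhds_zero]
  intro e he
  set A := per univ ^ p.toReal⁻¹ with hA
  have hAtop : A ≠ ⊤ :=
    ENNReal.rpow_ne_top_of_nonneg (inv_nonneg.2 ENNReal.toReal_nonneg) (measure_ne_top _ _)
  have hlim : Tendsto (fun r : ℝ => A * ENNReal.ofReal r) (𝓝[>] 0) (𝓝 0) := by
    have h1 : Tendsto (fun r : ℝ => ENNReal.ofReal r) (𝓝[>] 0) (𝓝 0) := by
      have := (ENNReal.continuous_ofReal.tendsto 0).mono_left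
        (nhdsWithin_le_nhds (s := Ioi (0 : ℝ)))
      rwa [ENNReal.ofReal_zero] at this
    have := ENNReal.Tendsto.const_mul (a := A) h1 (Or.inr hAtop)
    rwa [mul_zero] at this
  obtain ⟨r, hr, hr0⟩ := ((hlim.eventually (Iic_mem_nhds he)).and self_mem_nhdsWithin).exists
  filter_upwards [h r hr0] with s hs
  exact (eLpNorm_le_of_ae_bound (by simpa using hs)).trans hr

theorem memLp_per_of_continuous {f : ℝ → ℝ} (hf : Continuous f) (p : ℝ≥0∞) : MemLp f p per := by
  obtain ⟨C, hC⟩ := isCompact_Icc.exists_bound_of_continuousOn (s := Icc 0 (2 * π))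
    hf.continuousOn
  exact MemLp.of_bound hf.aestronglyMeasurable C
    ((ae_restrict_mem measurableSet_Ioc).mono fun x hx => hC x (Ioc_subset_Icc_self hx))

theorem memLp_perExt {f : ℝ → ℝ} (hf : Continuous f) (p : ℝ≥0∞) : MemLp (perExt f) p per :=
  (memLp_congr_ae (perExt_ae_eq f)).2 (memLp_per_of_continuous hf p)

theorem continuous_primitive {g : ℝ → ℝ} (hg : Continuous g) (c : ℝ) :
    Continuous fun x => c + ∫ y in (0)..x, g y :=
  continuous_iff_continuousAt.2 fun x => ((hasDerivAt_integral_zero hg x).const_add c).continuousAt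

theorem perExt_primitive_continuous {g : ℝ → ℝ} (hg : Continuous g)
    (h0 : ∫ x in (0)..(2 * π), g x = 0) (c : ℝ) :
    Continuous (perExt fun x => c + ∫ y in (0)..x, g y) :=
  perExt_continuous (continuous_primitive hg c) (by simp [h0])

theorem memH1per_perExt {g : ℝ → ℝ} (hg : Continuous g)
    (h0 : ∫ x in (0)..(2 * π), g x = 0) (c : ℝ) :
    MemH1per (perExt fun x => c + ∫ y in (0)..x, g y) :=
  ⟨perExt_periodic _, perExt_primitive_continuous hg h0 c, memLp_perExt (continuous_primitive hg c) 2,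
    _, IsWeakDeriv.perExt_integral hg h0 c, memLp_perExt hg 2⟩

theorem memW1inf_perExt {g : ℝ → ℝ} (hg : Continuous g)
    (h0 : ∫ x in (0)..(2 * π), g x = 0) (c : ℝ) :
    MemW1inf (perExt fun x => c + ∫ y in (0)..x, g y) :=
  ⟨perExt_periodic _, memLp_perExt (continuous_primitive hg c) ∞,
    _, IsWeakDeriv.perExt_integral hg h0 c, memLp_perExt hg ∞⟩

theorem weakDeriv_perExt {g : ℝ → ℝ} (hg : Continuous g)
    (h0 : ∫ x in (0)..(2 * π), g x = 0) (c : ℝ) :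
    weakDeriv (perExt fun x => c + ∫ y in (0)..x, g y) =ᵐ[per] g :=
  (weakDeriv_ae_eq (IsWeakDeriv.perExt_integral hg h0 c)).trans (perExt_ae_eq g)

theorem mean_eq (f : ℝ → ℝ) : mean f = (2 * π)⁻¹ * ∫ x in (0)..(2 * π), f x := by
  rw [mean, integral_per]

theorem primZero_congr {f₁ f₂ : ℝ → ℝ} (h : f₁ =ᵐ[per] f₂) {x : ℝ} (hx : x ∈ Icc 0 (2 * π)) :
    primZero f₁ x = primZero f₂ x := by
  have hm : mean f₁ = mean f₂ := by rw [mean, mean, integral_congr_ae h]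
  have hi : ∀ y ∈ Icc 0 (2 * π), ∫ s in (0)..y, (f₁ s - mean f₁)
      = ∫ s in (0)..y, (f₂ s - mean f₂) := by
    intro y hy
    refine intervalIntegral.integral_congr_ae ?_
    filter_upwards [ae_per_iff.1 h] with s hs hs'
    rw [uIoc_of_le hy.1] at hs'
    rw [hs ⟨hs'.1, hs'.2.trans hy.2⟩, hm]
  rw [primZero, primZero, hi x hx]
  congr 1
  rw [mean, mean]
  congr 1
  exact integral_congr_ae ((ae_restrict_mem measurableSet_Ioc).mono fun y hy =>
    hi y (Ioc_subset_Icc_self hy))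

theorem integral_sub_pi : ∫ y in (0)..(2 * π), (y - π) = 0 := by
  rw [intervalIntegral.integral_sub (by simp) (by simp)]
  simp
  ring

/-- The zero-mean primitive, written with the value of the primitive at zero. -/
theorem primZero_eq {f : ℝ → ℝ} (hf : Continuous f) (x : ℝ) :
    primZero f x = (2 * π)⁻¹ * (∫ y in (0)..(2 * π), (y - π) * f y)
      + ∫ y in (0)..x, (f y - mean f) := by
  set φ : ℝ → ℝ := fun y => f y - mean f with hφ
  have hφc : Continuous φ := hf.sub continuous_const
  have hφ0 : ∫ y in (0)..(2 * π), φ y = 0 := by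
    simp only [hφ]
    rw [intervalIntegral.integral_sub (hf.intervalIntegrable _ _) (by simp), mean_eq]
    simp
    field_simp
    simp
  -- Taking y - π as the primitive of 1 turns the mean of the primitive of φ into a first moment of
  -- φ. The boundary terms vanish because φ has integral zero.
  have hparts := intervalIntegral.integral_mul_deriv_eq_deriv_mul (a := 0) (b := 2 * π)
    (fun y _ => hasDerivAt_integral_zero hφc y) (fun y _ => (hasDerivAt_id y).sub_const π)
    (hφc.intervalIntegrable _ _) (by simp)
  simp only [mul_one, hφ0, zero_mul, intervalIntegral.integral_same, sub_self, zero_sub] at hparts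
  have h2 : ∫ y in (0)..(2 * π), φ y * (id y - π) = ∫ y in (0)..(2 * π), (y - π) * f y := by
    have : ∀ y, φ y * (id y - π) = (y - π) * f y - mean f * (y - π) := fun y => by
      simp only [hφ, id]; ring
    simp_rw [this]
    rw [intervalIntegral.integral_sub
      ((by fun_prop : Continuous fun y => (y - π) * f y).intervalIntegrable _ _)
      ((by fun_prop : Continuous fun y => mean f * (y - π)).intervalIntegrable _ _),
      intervalIntegral.integral_const_mul, integral_sub_pi]
    ring
  rw [primZero, mean_eq fun z => ∫ y in (0)..z, φ y, hparts, h2]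
  ring

/-- Since `etaStar'` is (y - π)/4 inside the period, the term -π⁻¹ ∮ η_*' ζ cancels exactly the
linear part of the zero-mean primitive at x = 0. The source at the peak is therefore purely
quadratic in the slope, and a small energy keeps the value at the peak under control. -/
theorem source_perExt {q : ℝ → ℝ} (hq : Continuous q) (h0 : ∫ x in (0)..(2 * π), q x = 0) (c : ℝ)
    {x : ℝ} (hx : x ∈ Icc 0 (2 * π)) :
    source (perExt fun x => c + ∫ y in (0)..x, q y) x
      = (2 * π)⁻¹ * (∫ y in (0)..(2 * π), (y - π) * q y ^ 2)
        + ∫ y in (0)..x, (1 / 2 * (c + ∫ s in (0)..y, q s) + q y ^ 2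
          - (2 * π)⁻¹ * ∫ y in (0)..(2 * π), (1 / 2 * (c + ∫ s in (0)..y, q s) + q y ^ 2)) := by
  set Z : ℝ → ℝ := fun x => c + ∫ y in (0)..x, q y with hZ
  have hZc : Continuous Z := continuous_primitive hq c
  rw [source, primZero_congr (f₂ := fun y => Z y + 2 * q y ^ 2) ?_ hx, primZero_eq (by fun_prop),
    integral_etaStar'_mul]
  · have e1 : ∫ y in (0)..(2 * π), (y - π) / 4 * perExt Z y
        = 1 / 4 * ∫ y in (0)..(2 * π), (y - π) * Z y := by
      rw [← intervalIntegral.integral_const_mul]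
      refine intervalIntegral.integral_congr fun y hy => ?_
      rw [uIcc_of_le two_pi_pos.le] at hy
      rw [perExt_of_mem_Icc (by simp [hZ, h0]) hy]
      ring
    have e2 : ∫ y in (0)..(2 * π), (y - π) * (Z y + 2 * q y ^ 2)
        = (∫ y in (0)..(2 * π), (y - π) * Z y) + 2 * ∫ y in (0)..(2 * π), (y - π) * q y ^ 2 := by
      rw [← intervalIntegral.integral_const_mul, ← intervalIntegral.integral_add
        ((by fun_prop : Continuous fun y => (y - π) * Z y).intervalIntegrable _ _)
        ((by fun_prop : Continuous fun y => 2 * ((y - π) * q y ^ 2)).intervalIntegrable _ _)]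
      congr 1; ext y; ring
    have e3 : mean (fun y => Z y + 2 * q y ^ 2)
        = 2 * ((2 * π)⁻¹ * ∫ y in (0)..(2 * π), (1 / 2 * Z y + q y ^ 2)) := by
      rw [mean_eq, mul_left_comm, ← intervalIntegral.integral_const_mul 2]
      congr 1
      refine intervalIntegral.integral_congr fun y _ => ?_
      ring
    rw [e1, e2, e3]
    have e4 : ∀ m, ∫ y in (0)..x, (Z y + 2 * q y ^ 2 - 2 * m)
        = 2 * ∫ y in (0)..x, (1 / 2 * Z y + q y ^ 2 - m) := fun m => by
      rw [← intervalIntegral.integral_const_mul]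
      congr 1; ext y; ring
    rw [e4]
    field_simp
    ring
  · filter_upwards [perExt_ae_eq Z, weakDeriv_perExt hq h0 c] with y h1 h2
    rw [h1, h2]

theorem eventually_abs_sub_le {F : ℝ → ℝ → ℝ} {τ : ℝ}
    (hF : ContinuousOn (Function.uncurry F) (Ioo (-τ) τ ×ˢ univ)) {t : ℝ} (ht : t ∈ Ioo (-τ) τ)
    {ε : ℝ} (hε : 0 < ε) : ∀ᶠ s in 𝓝 t, ∀ x ∈ Icc 0 (2 * π), |F s x - F t x| ≤ ε := by
  obtain ⟨v, hv, hv'⟩ := isCompact_Icc.mem_uniformity_of_prod (k := Icc 0 (2 * π)) (f := F)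
    (hF.mono (prod_mono_right (subset_univ _))) ht (Metric.dist_mem_uniformity hε)
  rw [isOpen_Ioo.nhdsWithin_eq ht] at hv
  filter_upwards [hv] with s hs x hx
  exact (hv' s hs x hx).le

theorem isC1Deriv_of_hasDerivAt {τ : ℝ} {ζ w Z W : ℝ → ℝ → ℝ} (p : ℝ≥0∞)
    (hζ : ∀ t ∈ Ioo (-τ) τ, ζ t =ᵐ[per] Z t) (hw : ∀ t ∈ Ioo (-τ) τ, w t =ᵐ[per] W t)
    (hZ : ∀ t ∈ Ioo (-τ) τ, Continuous (Z t))
    (hW : ContinuousOn (Function.uncurry W) (Ioo (-τ) τ ×ˢ univ))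
    (hd : ∀ t ∈ Ioo (-τ) τ, ∀ x ∈ Icc 0 (2 * π), HasDerivAt (fun s => Z s x) (W t x) t) :
    IsC1Deriv p τ ζ w := by
  have hWc : ∀ t ∈ Ioo (-τ) τ, Continuous (W t) := fun t ht => by
    rw [← continuousOn_univ]
    exact hW.comp (f := fun x => (t, x)) (by fun_prop) fun x hx => ⟨ht, hx⟩
  intro t ht
  refine ⟨(memLp_congr_ae (hζ t ht)).2 (memLp_per_of_continuous (hZ t ht) p),
    (memLp_congr_ae (hw t ht)).2 (memLp_per_of_continuous (hWc t ht) p), ?_, ?_⟩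
  · refine tendsto_eLpNorm_of_ae_bound p fun ε hε => ?_
    obtain ⟨r, hr, hrb⟩ := Metric.eventually_nhds_iff.1
      ((eventually_abs_sub_le hW ht hε).and (isOpen_Ioo.eventually_mem ht))
    have hnear : ∀ᶠ k in 𝓝[≠] (0 : ℝ), |k| < r := by
      have : ∀ᶠ k in 𝓝 (0 : ℝ), |k| < r := by
        exact continuous_abs.continuousAt.eventually_lt continuousAt_const (by simpa using hr)
      exact this.filter_mono nhdsWithin_le_nhds
    filter_upwards [hnear, self_mem_nhdsWithin] with k hk hk0
    have hk0 : k ≠ 0 := hk0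
    have hball : ∀ s ∈ Metric.ball t r, s ∈ Ioo (-τ) τ := fun s hs => (hrb hs).2
    have htk : t + k ∈ Metric.ball t r := by rw [Metric.mem_ball, Real.dist_eq]; simpa using hk
    filter_upwards [hζ t ht, hζ (t + k) (hball _ htk), hw t ht, ae_restrict_mem measurableSet_Ioc]
      with x h1 h2 h3 hx
    rw [h1, h2, h3]
    have hx' := Ioc_subset_Icc_self hx
    -- The mean value inequality is applied after subtracting the linear function with slope `W t
    -- x`, which makes the bound uniform in `x`.
    have key := (convex_ball t r).norm_image_sub_le_of_norm_hasDerivWithin_le (C := ε)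
      (f := fun s => Z s x - s * W t x) (f' := fun s => W s x - W t x)
      (fun s hs => by
        have := (hd s (hball s hs) x hx').sub ((hasDerivAt_id s).mul_const (W t x))
        rw [one_mul] at this
        exact this.hasDerivWithinAt)
      (fun s hs => (hrb hs).1 x hx') (Metric.mem_ball_self hr) htk
    rw [Real.norm_eq_abs, Real.norm_eq_abs, add_sub_cancel_left] at key
    have e : k⁻¹ * (Z (t + k) x - Z t x) - W t x
        = k⁻¹ * (Z (t + k) x - (t + k) * W t x - (Z t x - t * W t x)) := by
      field_simp
      ring
    rw [e, abs_mul, abs_inv, inv_mul_le_iff₀ (abs_pos.2 hk0)]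
    linarith
  · refine tendsto_eLpNorm_of_ae_bound p fun ε hε => ?_
    filter_upwards [eventually_abs_sub_le hW ht hε, isOpen_Ioo.eventually_mem ht] with s hs hs'
    filter_upwards [hw t ht, hw s hs', ae_restrict_mem measurableSet_Ioc] with x h1 h2 hx
    rw [h1, h2]
    exact hs x (Ioc_subset_Icc_self hx)

/-- A classical solution on `[0, 2π]`, given by its value `c` at zero and its slope `g`, extends
periodically to a local solution. -/
theorem isLocalSolution_perExt {τ : ℝ} {c : ℝ → ℝ} {g W : ℝ → ℝ → ℝ}
    (hc : ContinuousOn c (Ioo (-τ) τ))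
    (hg : ContinuousOn (Function.uncurry g) (Ioo (-τ) τ ×ˢ univ))
    (hgt : ∀ t ∈ Ioo (-τ) τ, Continuous (g t))
    (h0 : ∀ t ∈ Ioo (-τ) τ, ∫ x in (0)..(2 * π), g t x = 0)
    (hW : ContinuousOn (Function.uncurry W) (Ioo (-τ) τ ×ˢ univ))
    (hd : ∀ t ∈ Ioo (-τ) τ, ∀ x ∈ Icc 0 (2 * π),
      HasDerivAt (fun s => c s + ∫ y in (0)..x, g s y) (W t x) t)
    (heq : ∀ t ∈ Ioo (-τ) τ, ∀ x ∈ Ioo 0 (2 * π), 2 * cStar * W t x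
      = (x * (2 * π - x) / 4 - 2 * ∫ y in (0)..x, g t y) * g t x
        + ((2 * π)⁻¹ * (∫ y in (0)..(2 * π), (y - π) * g t y ^ 2)
        + ∫ y in (0)..x, (1 / 2 * (c t + ∫ s in (0)..y, g t s) + g t y ^ 2
          - (2 * π)⁻¹ * ∫ y in (0)..(2 * π), (1 / 2 * (c t + ∫ s in (0)..y, g t s) + g t y ^ 2)))) :
    IsLocalSolution τ fun t => perExt fun x => c t + ∫ y in (0)..x, g t y := by
  have hclose : ∀ t ∈ Ioo (-τ) τ, ∀ ε > 0, ∀ᶠ s in 𝓝 t,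
      (∀ᵐ x ∂per, |perExt (fun x => c s + ∫ y in (0)..x, g s y) x
        - perExt (fun x => c t + ∫ y in (0)..x, g t y) x| ≤ ε) ∧
      ∀ᵐ x ∂per, |weakDeriv (fun x => perExt (fun x => c s + ∫ y in (0)..x, g s y) x
        - perExt (fun x => c t + ∫ y in (0)..x, g t y) x) x| ≤ ε := by
    intro t ht ε hε
    have hε' : 0 < ε / (1 + 2 * π) := by positivity
    have hcc : ∀ᶠ s in 𝓝 t, |c s - c t| ≤ ε / (1 + 2 * π) := by
      have := (hc.continuousAt (isOpen_Ioo.mem_nhds ht)).eventually (Metric.ball_mem_nhds _ hε')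
      filter_upwards [this] with s hs
      rw [← Real.dist_eq]
      exact hs.le
    filter_upwards [eventually_abs_sub_le hg ht hε', hcc, isOpen_Ioo.eventually_mem ht]
      with s h1 h2 hs
    have hle : ε / (1 + 2 * π) ≤ ε := div_le_self hε.le (by linarith [pi_pos])
    constructor
    · filter_upwards [perExt_ae_eq (fun x => c s + ∫ y in (0)..x, g s y),
        perExt_ae_eq (fun x => c t + ∫ y in (0)..x, g t y), ae_restrict_mem measurableSet_Ioc]
        with x e1 e2 hx
      rw [e1, e2]
      have hint := abs_integral_le_of_ae_per (g := fun y => g s y - g t y) (a := 0) (b := x)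
        ((ae_restrict_mem measurableSet_Ioc).mono fun y hy => h1 y (Ioc_subset_Icc_self hy))
        ⟨le_rfl, two_pi_pos.le⟩ (Ioc_subset_Icc_self hx)
      rw [intervalIntegral.integral_sub ((hgt s hs).intervalIntegrable _ _)
        ((hgt t ht).intervalIntegrable _ _), sub_zero, abs_of_pos hx.1] at hint
      have e : (c s + ∫ y in (0)..x, g s y) - (c t + ∫ y in (0)..x, g t y)
          = (c s - c t) + ((∫ y in (0)..x, g s y) - ∫ y in (0)..x, g t y) := by ring
      rw [e]
      refine (abs_add_le _ _).trans ((add_le_add h2 hint).trans ?_)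
      calc ε / (1 + 2 * π) + ε / (1 + 2 * π) * x
          ≤ ε / (1 + 2 * π) + ε / (1 + 2 * π) * (2 * π) := by gcongr; exact hx.2
        _ = ε := by field_simp
    · filter_upwards [weakDeriv_ae_eq ((IsWeakDeriv.perExt_integral (hgt s hs) (h0 s hs) (c s)).sub
        (IsWeakDeriv.perExt_integral (hgt t ht) (h0 t ht) (c t))), perExt_ae_eq (g s),
        perExt_ae_eq (g t), ae_restrict_mem measurableSet_Ioc] with x e1 e2 e3 hx
      rw [e1, e2, e3]
      exact (h1 x (Ioc_subset_Icc_self hx)).trans hle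
  have hL : ∀ p, ∀ t ∈ Ioo (-τ) τ, Tendsto (fun s => eLpNorm
      (fun x => perExt (fun x => c s + ∫ y in (0)..x, g s y) x
        - perExt (fun x => c t + ∫ y in (0)..x, g t y) x) p per) (𝓝 t) (𝓝 0) := fun p t ht =>
    tendsto_eLpNorm_of_ae_bound p fun ε hε => (hclose t ht ε hε).mono fun s hs => hs.1
  have hL' : ∀ p, ∀ t ∈ Ioo (-τ) τ, Tendsto (fun s => eLpNorm (weakDeriv
      (fun x => perExt (fun x => c s + ∫ y in (0)..x, g s y) x
        - perExt (fun x => c t + ∫ y in (0)..x, g t y) x)) p per) (𝓝 t) (𝓝 0) := fun p t ht =>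
    tendsto_eLpNorm_of_ae_bound p fun ε hε => (hclose t ht ε hε).mono fun s hs => hs.2
  refine ⟨fun t ht => ⟨memH1per_perExt (hgt t ht) (h0 t ht) _,
    memW1inf_perExt (hgt t ht) (h0 t ht) _⟩, fun t ht => ?_, fun t ht => ?_, W, ?_, ?_, ?_⟩
  · have h1 := ((ENNReal.continuous_pow 2).tendsto 0).comp (hL 2 t ht)
    have h2 := ((ENNReal.continuous_pow 2).tendsto 0).comp (hL' 2 t ht)
    have h3 := ((ENNReal.continuous_rpow_const (y := (1 / 2 : ℝ))).tendsto _).comp (h1.add h2)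
    have e : ((0 : ℝ≥0∞) ^ 2 + 0 ^ 2) ^ (1 / 2 : ℝ) = 0 := by simp
    rw [e] at h3
    exact h3
  · have := (hL ∞ t ht).add (hL' ∞ t ht)
    rw [add_zero] at this
    exact this
  · exact isC1Deriv_of_hasDerivAt 2 (fun t _ => perExt_ae_eq _) (fun t _ => ae_eq_refl _)
      (fun t ht => continuous_primitive (hgt t ht) _) hW hd
  · exact isC1Deriv_of_hasDerivAt ∞ (fun t _ => perExt_ae_eq _) (fun t _ => ae_eq_refl _)
      (fun t ht => continuous_primitive (hgt t ht) _) hW hd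
  · intro t ht
    filter_upwards [ae_per_of_forall fun x hx => heq t ht x hx, weakDeriv_perExt (hgt t ht)
      (h0 t ht) (c t), ae_per_of_forall (p := fun x => x ∈ Ioo 0 (2 * π)) fun x hx => hx]
      with x h1 h2 hx
    have hx' := Ioo_subset_Icc_self hx
    rw [h1, evolutionRHS_eq, h2, source_perExt (hgt t ht) (h0 t ht) _ hx', speed_eq hx',
      perExt_of_mem_Icc (by simp [h0 t ht]) hx', perExt_of_mem_Icc (by simp [h0 t ht])
      ⟨le_rfl, two_pi_pos.le⟩, intervalIntegral.integral_same]
    ring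

/-! ### Ordinary differential equations with locally Lipschitz right-hand side -/

/-- `F` is bounded and Lipschitz on bounded sets. -/
def BddLip {E G : Type*} [NormedAddCommGroup E] [NormedAddCommGroup G] (F : E → G) : Prop :=
  ∀ R : ℝ, ∃ L : ℝ, 0 ≤ L ∧ (∀ u, ‖u‖ ≤ R → ‖F u‖ ≤ L) ∧
    ∀ u v, ‖u‖ ≤ R → ‖v‖ ≤ R → ‖F u - F v‖ ≤ L * ‖u - v‖

namespace BddLip

variable {E G H : Type*} [NormedAddCommGroup E] [NormedAddCommGroup G] [NormedAddCommGroup H]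

theorem const (c : G) : BddLip fun _ : E => c := fun _ =>
  ⟨‖c‖, norm_nonneg _, fun _ _ => le_rfl, fun u v _ _ => by
    rw [sub_self, norm_zero]; positivity⟩

theorem add {F₁ F₂ : E → G} (h₁ : BddLip F₁) (h₂ : BddLip F₂) : BddLip fun u => F₁ u + F₂ u := by
  intro R
  obtain ⟨L₁, p₁, b₁, l₁⟩ := h₁ R
  obtain ⟨L₂, p₂, b₂, l₂⟩ := h₂ R
  refine ⟨L₁ + L₂, by positivity, fun u hu => (norm_add_le _ _).trans (add_le_add (b₁ u hu) (b₂ u hu)),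
    fun u v hu hv => ?_⟩
  rw [add_sub_add_comm, add_mul]
  exact (norm_add_le _ _).trans (add_le_add (l₁ u v hu hv) (l₂ u v hu hv))

theorem clm_comp [NormedSpace ℝ G] [NormedSpace ℝ H] (T : G →L[ℝ] H) {F : E → G} (h : BddLip F) :
    BddLip fun u => T (F u) := by
  intro R
  obtain ⟨L, p, b, l⟩ := h R
  refine ⟨‖T‖ * L, by positivity, fun u hu => (T.le_opNorm _).trans
    (mul_le_mul_of_nonneg_left (b u hu) (norm_nonneg _)), fun u v hu hv => ?_⟩
  rw [← map_sub, mul_assoc]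
  exact (T.le_opNorm _).trans (mul_le_mul_of_nonneg_left (l u v hu hv) (norm_nonneg _))

theorem clm [NormedSpace ℝ E] [NormedSpace ℝ G] (T : E →L[ℝ] G) : BddLip fun u => T u := by
  refine clm_comp T (F := id) fun R => ⟨max R 1, by positivity, fun u hu => hu.trans (le_max_left _ _),
    fun u v _ _ => ?_⟩
  exact le_mul_of_one_le_left (norm_nonneg _) (le_max_right _ _)

theorem smul [NormedSpace ℝ G] (c : ℝ) {F : E → G} (h : BddLip F) : BddLip fun u => c • F u :=
  clm_comp (c • ContinuousLinearMap.id ℝ G) h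

theorem sub [NormedSpace ℝ G] {F₁ F₂ : E → G} (h₁ : BddLip F₁) (h₂ : BddLip F₂) :
    BddLip fun u => F₁ u - F₂ u := by
  have := h₁.add (h₂.smul (-1))
  simpa [sub_eq_add_neg] using this

theorem mul {A : Type*} [NormedRing A] {F₁ F₂ : E → A} (h₁ : BddLip F₁) (h₂ : BddLip F₂) :
    BddLip fun u => F₁ u * F₂ u := by
  intro R
  obtain ⟨L₁, p₁, b₁, l₁⟩ := h₁ R
  obtain ⟨L₂, p₂, b₂, l₂⟩ := h₂ R
  refine ⟨2 * (L₁ * L₂), by positivity, fun u hu => ?_, fun u v hu hv => ?_⟩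
  · refine (norm_mul_le _ _).trans ((mul_le_mul (b₁ u hu) (b₂ u hu) (norm_nonneg _) p₁).trans ?_)
    have := mul_nonneg p₁ p₂
    linarith
  · have e : F₁ u * F₂ u - F₁ v * F₂ v = (F₁ u - F₁ v) * F₂ u + F₁ v * (F₂ u - F₂ v) := by
      noncomm_ring
    rw [e]
    refine (norm_add_le _ _).trans ?_
    have h3 := (norm_mul_le (F₁ u - F₁ v) (F₂ u)).trans
      (mul_le_mul (l₁ u v hu hv) (b₂ u hu) (norm_nonneg _) (by positivity))
    have h4 := (norm_mul_le (F₁ v) (F₂ u - F₂ v)).trans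
      (mul_le_mul (b₁ v hv) (l₂ u v hu hv) (norm_nonneg _) p₁)
    linarith

theorem prodMk {F₁ : E → G} {F₂ : E → H} (h₁ : BddLip F₁) (h₂ : BddLip F₂) :
    BddLip fun u => (F₁ u, F₂ u) := by
  intro R
  obtain ⟨L₁, p₁, b₁, l₁⟩ := h₁ R
  obtain ⟨L₂, p₂, b₂, l₂⟩ := h₂ R
  refine ⟨max L₁ L₂, by positivity, fun u hu => ?_, fun u v hu hv => ?_⟩
  · rw [Prod.norm_mk]
    exact max_le_max (b₁ u hu) (b₂ u hu)
  · rw [Prod.mk_sub_mk, Prod.norm_mk]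
    exact max_le ((l₁ u v hu hv).trans (mul_le_mul_of_nonneg_right (le_max_left _ _) (norm_nonneg _)))
      ((l₂ u v hu hv).trans (mul_le_mul_of_nonneg_right (le_max_right _ _) (norm_nonneg _)))

end BddLip

/-- For every `R`, the equation `u' = F u` has a curve on `[-T, T]` that solves it wherever its
norm is at most `R`. -/
theorem BddLip.exists_solution {E : Type*} [NormedAddCommGroup E] [NormedSpace ℝ E]
    [CompleteSpace E] {F : E → E} (hF : BddLip F) (u₀ : E) (R : ℝ) {T : ℝ} (hT : 0 < T) :
    ∃ u : ℝ → E, u 0 = u₀ ∧ ContinuousOn u (Icc (-T) T) ∧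
      ∀ t ∈ Ioo (-T) T, ‖u t‖ ≤ R → HasDerivAt u (F (u t)) t := by
  obtain ⟨L, hL, hb, hl⟩ := hF (R + 1)
  -- A Lipschitz cutoff, equal to 1 on the ball of radius `R` and to 0 outside radius `R + 1`. The
  -- truncated field is bounded and globally Lipschitz, so its solution exists on all of `[-T, T]`.
  set χ : E → ℝ := fun u => max 0 (min 1 (R + 1 - ‖u‖)) with hχ
  have hχ0 : ∀ u, 0 ≤ χ u := fun u => le_max_left _ _
  have hχ1 : ∀ u, χ u ≤ 1 := fun u => max_le zero_le_one (min_le_left _ _)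
  have hχs : ∀ u, R + 1 ≤ ‖u‖ → χ u = 0 := fun u hu =>
    max_eq_left ((min_le_right _ _).trans (by linarith))
  have hχL : ∀ u v, |χ u - χ v| ≤ ‖u - v‖ := fun u v => by
    have h1 : |χ u - χ v| ≤ |min 1 (R + 1 - ‖u‖) - min 1 (R + 1 - ‖v‖)| := by
      have := abs_max_sub_max_le_max 0 (min 1 (R + 1 - ‖u‖)) 0 (min 1 (R + 1 - ‖v‖))
      simpa using this
    have h2 : |min 1 (R + 1 - ‖u‖) - min 1 (R + 1 - ‖v‖)| ≤ |‖v‖ - ‖u‖| := by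
      have := abs_min_sub_min_le_max 1 (R + 1 - ‖u‖) 1 (R + 1 - ‖v‖)
      simpa using this
    refine h1.trans (h2.trans ?_)
    rw [norm_sub_rev]
    exact abs_norm_sub_norm_le v u
  set G : E → E := fun u => χ u • F u with hG
  have hGb : ∀ u, ‖G u‖ ≤ L := by
    intro u
    rcases le_total (R + 1) ‖u‖ with h | h
    · simp only [hG, hχs u h, zero_smul, norm_zero]; exact hL
    · simp only [hG]
      rw [norm_smul, Real.norm_eq_abs, abs_of_nonneg (hχ0 u)]
      exact (mul_le_of_le_one_left (norm_nonneg _) (hχ1 u)).trans (hb u h)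
  -- One point inside the larger ball suffices: the difference of the cutoffs is put on the field at
  -- `u`, where it is bounded, and the remaining term carries the factor `χ v`, which vanishes when
  -- `v` lies outside.
  have hGle : ∀ u v, ‖u‖ ≤ R + 1 → ‖G u - G v‖ ≤ 2 * L * ‖u - v‖ := by
    intro u v hu
    rcases le_total (R + 1) ‖v‖ with h | h
    · have hv : χ v = 0 := hχs v h
      have h1 : G u - G v = (χ u - χ v) • F u := by simp only [hG, hv]; simp
      rw [h1, norm_smul, Real.norm_eq_abs]
      have := mul_le_mul (hχL u v) (hb u hu) (norm_nonneg _) (norm_nonneg _)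
      have h2 : 0 ≤ L * ‖u - v‖ := by positivity
      linarith
    · have h1 : G u - G v = (χ u - χ v) • F u + χ v • (F u - F v) := by
        simp only [hG, sub_smul, smul_sub]; abel
      rw [h1]
      refine (norm_add_le _ _).trans ?_
      rw [norm_smul, norm_smul, Real.norm_eq_abs, Real.norm_eq_abs, abs_of_nonneg (hχ0 v)]
      have h2 := mul_le_mul (hχL u v) (hb u hu) (norm_nonneg _) (norm_nonneg _)
      have h3 := (mul_le_of_le_one_left (norm_nonneg (F u - F v)) (hχ1 v)).trans (hl u v hu h)
      linarith
  have hGL : ∀ u v, ‖G u - G v‖ ≤ 2 * L * ‖u - v‖ := by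
    intro u v
    rcases le_total (R + 1) ‖u‖ with h | h
    · rcases le_total (R + 1) ‖v‖ with h' | h'
      · simp only [hG, hχs u h, hχs v h', zero_smul, sub_self, norm_zero]; positivity
      · rw [norm_sub_rev, norm_sub_rev u v]; exact hGle v u h'
    · exact hGle u v h
  have hPL : IsPicardLindelof (fun (_ : ℝ) u => G u) (tmin := -T) (tmax := T)
      ⟨0, by constructor <;> linarith⟩ u₀ (Real.toNNReal (L * T)) 0
      (Real.toNNReal L) (Real.toNNReal (2 * L)) :=
    { lipschitzOnWith := fun s _ => LipschitzOnWith.of_dist_le_mul fun x _ y _ => by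
        rw [dist_eq_norm, dist_eq_norm, Real.coe_toNNReal _ (by positivity)]
        exact hGL x y
      continuousOn := fun x _ => continuousOn_const
      norm_le := fun s _ x _ => by
        rw [Real.coe_toNNReal _ hL]
        exact hGb x
      mul_max_le := by
        rw [Real.coe_toNNReal L hL, Real.coe_toNNReal (L * T) (by positivity)]
        simp }
  obtain ⟨u, hu0, hu⟩ := hPL.exists_eq_forall_mem_Icc_hasDerivWithinAt₀
  refine ⟨u, hu0, fun t ht => (hu t ht).continuousWithinAt, fun t ht hut => ?_⟩
  have h1 := (hu t (Ioo_subset_Icc_self ht)).hasDerivAt (Icc_mem_nhds ht.1 ht.2)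
  have h2 : χ (u t) = 1 := by
    simp only [hχ]
    rw [min_eq_left (by linarith), max_eq_right zero_le_one]
  simpa only [hG, h2, one_smul] using h1

/-! ### The Lagrangian equations -/

open scoped BoundedContinuousFunction

/-- The projection of `ℝ` onto `[0, 2π]`. -/
noncomputable def clamp (x : ℝ) : ℝ := max 0 (min (2 * π) x)

theorem continuous_clamp : Continuous clamp := by unfold clamp; fun_prop

theorem clamp_mem (x : ℝ) : clamp x ∈ Icc 0 (2 * π) :=
  ⟨le_max_left _ _, max_le two_pi_pos.le (min_le_left _ _)⟩

theorem clamp_of_mem {x : ℝ} (hx : x ∈ Icc 0 (2 * π)) : clamp x = x := by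
  rw [clamp, min_eq_right hx.2, max_eq_right hx.1]

theorem abs_clamp_sub_le (x y : ℝ) : |clamp x - clamp y| ≤ |x - y| := by
  have h1 := abs_max_sub_max_le_max 0 (min (2 * π) x) 0 (min (2 * π) y)
  have h2 := abs_min_sub_min_le_max (2 * π) x (2 * π) y
  simp only [sub_self, abs_zero] at h1 h2
  rw [max_eq_right (abs_nonneg (min (2 * π) x - min (2 * π) y))] at h1
  rw [max_eq_right (abs_nonneg (x - y))] at h2
  exact h1.trans h2

theorem abs_integral_le_norm (f : ℝ →ᵇ ℝ) (a b : ℝ) : |∫ y in a..b, f y| ≤ ‖f‖ * |b - a| := by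
  rw [← Real.norm_eq_abs (∫ y in a..b, f y)]
  exact intervalIntegral.norm_integral_le_of_norm_le_const fun x _ => f.norm_coe_le_norm x

theorem abs_integral_clamp_le (f : ℝ →ᵇ ℝ) (ξ : ℝ) :
    ‖∫ y in (0)..(clamp ξ), f y‖ ≤ ‖f‖ * (2 * π) := by
  refine (abs_integral_le_norm f 0 (clamp ξ)).trans
    (mul_le_mul_of_nonneg_left ?_ (norm_nonneg _))
  rw [sub_zero, abs_of_nonneg (clamp_mem ξ).1]
  exact (clamp_mem ξ).2

/-- The primitive `ξ ↦ ∫₀^ξ f` on `[0, 2π]`, extended by constants. -/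
noncomputable def integ : (ℝ →ᵇ ℝ) →L[ℝ] (ℝ →ᵇ ℝ) :=
  LinearMap.mkContinuous
    { toFun := fun f => BoundedContinuousFunction.ofNormedAddCommGroup
        (fun ξ => ∫ y in (0)..(clamp ξ), f y)
        ((continuous_iff_continuousAt.2 fun x =>
          (hasDerivAt_integral_zero f.continuous x).continuousAt).comp continuous_clamp)
        (‖f‖ * (2 * π)) (abs_integral_clamp_le f)
      map_add' := fun f g => by
        ext ξ
        exact intervalIntegral.integral_add (f.continuous.intervalIntegrable _ _)
          (g.continuous.intervalIntegrable _ _)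
      map_smul' := fun c f => by
        ext ξ
        exact intervalIntegral.integral_smul c f }
    (2 * π) (fun f => by
      refine le_of_le_of_eq ?_ (mul_comm ‖f‖ (2 * π))
      exact BoundedContinuousFunction.norm_ofNormedAddCommGroup_le _ (by positivity)
        (abs_integral_clamp_le f))

theorem integ_apply (f : ℝ →ᵇ ℝ) (ξ : ℝ) : integ f ξ = ∫ y in (0)..(clamp ξ), f y := rfl

theorem integ_apply_of_mem (f : ℝ →ᵇ ℝ) {ξ : ℝ} (hξ : ξ ∈ Icc 0 (2 * π)) :
    integ f ξ = ∫ y in (0)..ξ, f y := by rw [integ_apply, clamp_of_mem hξ]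

theorem integ_two_pi (f : ℝ →ᵇ ℝ) : integ f (2 * π) = ∫ y in (0)..(2 * π), f y :=
  integ_apply_of_mem f ⟨two_pi_pos.le, le_rfl⟩

theorem integ_zero (f : ℝ →ᵇ ℝ) : integ f 0 = 0 := by
  rw [integ_apply_of_mem f ⟨le_rfl, two_pi_pos.le⟩, intervalIntegral.integral_same]

/-- The states of the Lagrangian equations: the Jacobian of the flow, the slope of the perturbation
along the flow, and the value of the perturbation at the peak. -/
abbrev LagState := (ℝ →ᵇ ℝ) × (ℝ →ᵇ ℝ) × ℝ

/-- The particle positions. -/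
noncomputable def lagX (u : LagState) : ℝ →ᵇ ℝ := integ u.1

/-- The perturbation along the flow. -/
noncomputable def lagZ (u : LagState) : ℝ →ᵇ ℝ :=
  BoundedContinuousFunction.const ℝ u.2.2 + integ (u.2.1 * u.1)

/-- The mean value of `z / 2 + q ^ 2`. -/
noncomputable def lagM (u : LagState) : ℝ :=
  (2 * π)⁻¹ * integ (((1 / 2 : ℝ) • lagZ u + u.2.1 * u.2.1) * u.1) (2 * π)

/-- The vector field of the Lagrangian equations. -/
noncomputable def lagField (u : LagState) : LagState :=
  ((2 * cStar)⁻¹ • (((1 / 2 : ℝ) • (lagX u - BoundedContinuousFunction.const ℝ π)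
      + (2 : ℝ) • u.2.1) * u.1),
    (2 * cStar)⁻¹ • ((1 / 2 : ℝ) • ((BoundedContinuousFunction.const ℝ π - lagX u) * u.2.1)
      - u.2.1 * u.2.1 + (1 / 2 : ℝ) • lagZ u - BoundedContinuousFunction.const ℝ (lagM u)),
    (2 * cStar)⁻¹ * ((2 * π)⁻¹ *
      integ ((lagX u - BoundedContinuousFunction.const ℝ π) * (u.2.1 * u.2.1) * u.1) (2 * π)))

/-- Constant functions as a continuous linear map. -/
noncomputable def constCLM : ℝ →L[ℝ] (ℝ →ᵇ ℝ) :=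
  LinearMap.mkContinuous
    { toFun := fun c => BoundedContinuousFunction.const ℝ c
      map_add' := fun _ _ => rfl
      map_smul' := fun _ _ => rfl } 1 (fun c => by
        rw [one_mul]; exact BoundedContinuousFunction.norm_const_le c)

theorem constCLM_apply (c : ℝ) : constCLM c = BoundedContinuousFunction.const ℝ c := rfl

theorem bddLip_fst : BddLip fun u : LagState => u.1 :=
  BddLip.clm (ContinuousLinearMap.fst ℝ (ℝ →ᵇ ℝ) ((ℝ →ᵇ ℝ) × ℝ))

theorem bddLip_q : BddLip fun u : LagState => u.2.1 :=
  BddLip.clm ((ContinuousLinearMap.fst ℝ (ℝ →ᵇ ℝ) ℝ).comp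
    (ContinuousLinearMap.snd ℝ (ℝ →ᵇ ℝ) ((ℝ →ᵇ ℝ) × ℝ)))

theorem bddLip_z0 : BddLip fun u : LagState => u.2.2 :=
  BddLip.clm ((ContinuousLinearMap.snd ℝ (ℝ →ᵇ ℝ) ℝ).comp
    (ContinuousLinearMap.snd ℝ (ℝ →ᵇ ℝ) ((ℝ →ᵇ ℝ) × ℝ)))

theorem bddLip_lagX : BddLip lagX := bddLip_fst.clm_comp integ

theorem bddLip_lagZ : BddLip lagZ :=
  (bddLip_z0.clm_comp constCLM).add ((bddLip_q.mul bddLip_fst).clm_comp integ)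

theorem bddLip_integ_two_pi {F : LagState → ℝ →ᵇ ℝ} (h : BddLip F) (c : ℝ) :
    BddLip fun u => c * integ (F u) (2 * π) :=
  ((h.clm_comp integ).clm_comp (BoundedContinuousFunction.evalCLM ℝ (2 * π))).smul c

theorem bddLip_lagM : BddLip lagM :=
  bddLip_integ_two_pi (((bddLip_lagZ.smul _).add (bddLip_q.mul bddLip_q)).mul bddLip_fst) _

theorem bddLip_lagField : BddLip lagField := by
  refine BddLip.prodMk ?_ (BddLip.prodMk ?_ ?_)
  · exact ((((bddLip_lagX.sub (BddLip.const _)).smul _).add (bddLip_q.smul _)).mul bddLip_fst).smul _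
  · exact ((((((BddLip.const _).sub bddLip_lagX).mul bddLip_q).smul _).sub
      (bddLip_q.mul bddLip_q)).add (bddLip_lagZ.smul _)).sub (bddLip_lagM.clm_comp constCLM)
      |>.smul _
  · have := bddLip_integ_two_pi (((bddLip_lagX.sub (BddLip.const
      (BoundedContinuousFunction.const ℝ π))).mul (bddLip_q.mul bddLip_q)).mul bddLip_fst)
      ((2 * cStar)⁻¹ * (2 * π)⁻¹)
    simpa only [mul_assoc] using this

/-! ### Estimates of the Lagrangian solutions -/

/-- The integrand F'F is the derivative of F²/2. This lets the Jacobian equation integrate to a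
position equation, and makes a term of the energy balance vanish over a period. -/
theorem integ_mul_integ (f : ℝ →ᵇ ℝ) (ξ : ℝ) : integ (f * integ f) ξ = (integ f ξ) ^ 2 / 2 := by
  rw [integ_apply, integ_apply]
  have h : ∫ y in (0)..(clamp ξ), (f * integ f) y
      = ∫ y in (0)..(clamp ξ), f y * ∫ w in (0)..y, f w := by
    refine intervalIntegral.integral_congr fun y hy => ?_
    rw [uIcc_of_le (clamp_mem ξ).1] at hy
    simp only [BoundedContinuousFunction.coe_mul, Pi.mul_apply]
    rw [integ_apply_of_mem f ⟨hy.1, hy.2.trans (clamp_mem ξ).2⟩]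
  have hd : ∀ y, HasDerivAt (fun y => ∫ w in (0)..y, f w) (f y) y :=
    hasDerivAt_integral_zero f.continuous
  rw [h, intervalIntegral.integral_eq_sub_of_hasDerivAt
    (f := fun y => (∫ w in (0)..y, f w) ^ 2 / 2)]
  · simp
  · intro y _
    refine (((hd y).fun_pow 2).div_const 2).congr_deriv ?_
    push_cast; ring
  · refine Continuous.intervalIntegrable ?_ _ _
    exact f.continuous.mul (continuous_iff_continuousAt.2 fun y => (hd y).continuousAt)

theorem integ_le_integ {f g : ℝ →ᵇ ℝ} (h : ∀ x, f x ≤ g x) (ξ : ℝ) : integ f ξ ≤ integ g ξ :=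
  intervalIntegral.integral_mono_on (clamp_mem ξ).1 (f.continuous.intervalIntegrable _ _)
    (g.continuous.intervalIntegrable _ _) fun x _ => h x

theorem abs_integ_le {f g : ℝ →ᵇ ℝ} (h : ∀ x, |f x| ≤ g x) (ξ : ℝ) :
    |integ f ξ| ≤ integ g (2 * π) := by
  have h0 : ∀ x, 0 ≤ g x := fun x => (abs_nonneg _).trans (h x)
  have h1 : integ g ξ ≤ integ g (2 * π) := by
    rw [integ_apply, integ_two_pi]
    exact intervalIntegral.integral_mono_interval le_rfl (clamp_mem ξ).1 (clamp_mem ξ).2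
      (ae_of_all _ h0) (g.continuous.intervalIntegrable _ _)
  refine le_trans ?_ h1
  rw [abs_le, ← BoundedContinuousFunction.neg_apply, ← map_neg]
  exact ⟨integ_le_integ (fun x => neg_le_of_abs_le (h x)) ξ,
    integ_le_integ (fun x => le_of_abs_le (h x)) ξ⟩

theorem abs_integ_sub_le (f : ℝ →ᵇ ℝ) (ξ η : ℝ) :
    |integ f ξ - integ f η| ≤ ‖f‖ * |clamp ξ - clamp η| := by
  rw [integ_apply, integ_apply, intervalIntegral.integral_interval_sub_left
    (f.continuous.intervalIntegrable _ _) (f.continuous.intervalIntegrable _ _)]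
  exact abs_integral_le_norm f _ _

/-- The time derivative of the particle positions. -/
noncomputable def lagDX (u : LagState) : ℝ →ᵇ ℝ := integ (lagField u).1

/-- The time derivative of the perturbation along the flow. -/
noncomputable def lagDZ (u : LagState) : ℝ →ᵇ ℝ :=
  constCLM (lagField u).2.2 + integ ((lagField u).2.1 * u.1 + u.2.1 * (lagField u).1)

theorem two_le_two_mul_cStar : 2 ≤ 2 * cStar := by linarith [one_le_cStar]

/-- The right-hand factor is -∂ₓV, where V = x(2π - x)/4 - 2(ζ - ζ(0)) is the transport speed. -/
theorem lagField_fst (u : LagState) (ξ : ℝ) :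
    2 * cStar * (lagField u).1 ξ = ((lagX u ξ - π) / 2 + 2 * u.2.1 ξ) * u.1 ξ := by
  have := cStar_pos.ne'
  simp only [lagField, BoundedContinuousFunction.coe_smul, BoundedContinuousFunction.coe_mul,
    BoundedContinuousFunction.coe_add, BoundedContinuousFunction.coe_sub, Pi.mul_apply,
    Pi.add_apply, Pi.sub_apply, smul_eq_mul, BoundedContinuousFunction.const_apply]
  field_simp

/-- Differentiating the equation in x, the term ∂ₓV · q contributes -2q² and the source contributes
+q². The resulting -q² drives negative slopes further down. -/
theorem lagField_snd (u : LagState) (ξ : ℝ) :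
    2 * cStar * (lagField u).2.1 ξ
      = (π - lagX u ξ) / 2 * u.2.1 ξ - u.2.1 ξ ^ 2 + (lagZ u ξ / 2 - lagM u) := by
  have := cStar_pos.ne'
  simp only [lagField, BoundedContinuousFunction.coe_smul, BoundedContinuousFunction.coe_mul,
    BoundedContinuousFunction.coe_add, BoundedContinuousFunction.coe_sub, Pi.mul_apply,
    Pi.add_apply, Pi.sub_apply, smul_eq_mul, BoundedContinuousFunction.const_apply]
  field_simp
  ring

/-- The Jacobian equation is the label derivative of X' = -V/(2c_*). Integrating it from the label
0, which stays at the peak, recovers the velocity. -/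
theorem lagX_two_smul (u : LagState) (ξ : ℝ) :
    2 * cStar * lagDX u ξ = lagX u ξ * (lagX u ξ - 2 * π) / 4 + 2 * (lagZ u ξ - u.2.2) := by
  have h : (2 * cStar) • (lagField u).1 = (1 / 2 : ℝ) • (u.1 * integ u.1) - (π / 2) • u.1
      + (2 : ℝ) • (u.2.1 * u.1) := by
    ext ξ
    have := lagField_fst u ξ
    simp only [BoundedContinuousFunction.coe_smul, BoundedContinuousFunction.coe_mul,
      BoundedContinuousFunction.coe_add, BoundedContinuousFunction.coe_sub, Pi.mul_apply,
      Pi.add_apply, Pi.sub_apply, smul_eq_mul]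
    rw [this, lagX]; ring
  have h2 : 2 * cStar * lagDX u ξ = integ ((2 * cStar) • (lagField u).1) ξ := by
    rw [map_smul]; rfl
  rw [h2, h, map_add, map_sub, map_smul, map_smul, map_smul]
  simp only [BoundedContinuousFunction.coe_smul, BoundedContinuousFunction.coe_add,
    BoundedContinuousFunction.coe_sub, Pi.add_apply, Pi.sub_apply, smul_eq_mul,
    integ_mul_integ, lagZ, lagX, BoundedContinuousFunction.const_apply]
  ring

/-- The geometric factors (X - π)/2 cancel between the two summands and -q² + 2q² leaves q². The
result integrates directly to the equation of the perturbation along the flow. -/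
theorem lagField_two_smul_mul (u : LagState) :
    (2 * cStar) • ((lagField u).2.1 * u.1 + u.2.1 * (lagField u).1)
      = ((1 / 2 : ℝ) • lagZ u + u.2.1 * u.2.1) * u.1 - lagM u • u.1 := by
  ext ξ
  have h1 := lagField_fst u ξ
  have h2 := lagField_snd u ξ
  simp only [BoundedContinuousFunction.coe_smul, BoundedContinuousFunction.coe_mul,
    BoundedContinuousFunction.coe_add, BoundedContinuousFunction.coe_sub, Pi.mul_apply,
    Pi.add_apply, Pi.sub_apply, smul_eq_mul]
  linear_combination u.1 ξ * h2 + u.2.1 ξ * h1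

theorem lagDZ_two_smul (u : LagState) (ξ : ℝ) :
    2 * cStar * lagDZ u ξ = (2 * π)⁻¹ *
        integ ((lagX u - BoundedContinuousFunction.const ℝ π) * (u.2.1 * u.2.1) * u.1) (2 * π)
      + integ (((1 / 2 : ℝ) • lagZ u + u.2.1 * u.2.1) * u.1 - lagM u • u.1) ξ := by
  have h := cStar_pos.ne'
  rw [← lagField_two_smul_mul, map_smul]
  simp only [lagDZ, BoundedContinuousFunction.coe_smul, 
    BoundedContinuousFunction.coe_add, Pi.add_apply, smul_eq_mul, constCLM_apply,
    BoundedContinuousFunction.const_apply, mul_add]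
  congr 1
  simp only [lagField]
  field_simp

theorem hasDerivAt_eval {f : ℝ → ℝ →ᵇ ℝ} {f' : ℝ →ᵇ ℝ} {t : ℝ} (hf : HasDerivAt f f' t) (ξ : ℝ) :
    HasDerivAt (fun s => f s ξ) (f' ξ) t :=
  (BoundedContinuousFunction.evalCLM ℝ ξ : (ℝ →ᵇ ℝ) →L[ℝ] ℝ).hasFDerivAt.comp_hasDerivAt t hf

/-! ### Propagation of periodicity and bounds on the Jacobian -/

/-- Solutions of the Lagrangian equations on `(-τ, τ)` which start from the identity and
whose slope is bounded by two. -/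
structure IsLagSol (τ : ℝ) (u : ℝ → LagState) : Prop where
  pos : 0 < τ
  deriv : ∀ t ∈ Ioo (-τ) τ, HasDerivAt u (lagField (u t)) t
  init_J : (u 0).1 = 1
  init_q : integ (u 0).2.1 (2 * π) = 0
  bdd : ∃ R, ∀ t ∈ Ioo (-τ) τ, ‖u t‖ ≤ R
  norm_q_le : ∀ t ∈ Ioo (-τ) τ, ‖(u t).2.1‖ ≤ 2

namespace IsLagSol

variable {τ : ℝ} {u : ℝ → LagState} (h : IsLagSol τ u)
include h

theorem zero_mem : (0 : ℝ) ∈ Ioo (-τ) τ := ⟨by linarith [h.pos], h.pos⟩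

theorem hasDerivAt_J {t : ℝ} (ht : t ∈ Ioo (-τ) τ) :
    HasDerivAt (fun t => (u t).1) (lagField (u t)).1 t := (h.deriv t ht).fst

theorem hasDerivAt_q {t : ℝ} (ht : t ∈ Ioo (-τ) τ) :
    HasDerivAt (fun t => (u t).2.1) (lagField (u t)).2.1 t := (h.deriv t ht).snd.fst

theorem hasDerivAt_z0 {t : ℝ} (ht : t ∈ Ioo (-τ) τ) :
    HasDerivAt (fun t => (u t).2.2) (lagField (u t)).2.2 t := (h.deriv t ht).snd.snd

theorem hasDerivAt_X {t : ℝ} (ht : t ∈ Ioo (-τ) τ) :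
    HasDerivAt (fun t => lagX (u t)) (lagDX (u t)) t :=
  integ.hasFDerivAt.comp_hasDerivAt t (h.hasDerivAt_J ht)

theorem hasDerivAt_integ_mul {t : ℝ} (ht : t ∈ Ioo (-τ) τ) :
    HasDerivAt (fun t => integ ((u t).2.1 * (u t).1))
      (integ ((lagField (u t)).2.1 * (u t).1 + (u t).2.1 * (lagField (u t)).1)) t :=
  integ.hasFDerivAt.comp_hasDerivAt t ((h.hasDerivAt_q ht).mul (h.hasDerivAt_J ht))

theorem hasDerivAt_Z {t : ℝ} (ht : t ∈ Ioo (-τ) τ) :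
    HasDerivAt (fun t => lagZ (u t)) (lagDZ (u t)) t :=
  (constCLM.hasFDerivAt.comp_hasDerivAt t (h.hasDerivAt_z0 ht)).add (h.hasDerivAt_integ_mul ht)

/-- The two periodicity defects A = X(2π) - 2π and B = ∫ qJ satisfy a closed linear system with
bounded coefficients, 2c_* A' = X(2π) A/4 + 2B and 2c_* B' = -M A. They start from zero, so Grönwall
keeps them zero. -/
theorem periodic_aux {t : ℝ} (ht : t ∈ Ioo (-τ) τ) :
    lagX (u t) (2 * π) = 2 * π ∧ integ ((u t).2.1 * (u t).1) (2 * π) = 0 := by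
  obtain ⟨R, hR⟩ := h.bdd
  obtain ⟨L₁, hL₁, b₁, -⟩ := bddLip_lagX R
  obtain ⟨L₂, hL₂, b₂, -⟩ := bddLip_lagM R
  set p : ℝ → ℝ × ℝ := fun t => (lagX (u t) (2 * π) - 2 * π,
    integ ((u t).2.1 * (u t).1) (2 * π)) with hp
  have hd : ∀ s ∈ Ioo (-τ) τ, HasDerivAt p (lagDX (u s) (2 * π),
      integ ((lagField (u s)).2.1 * (u s).1 + (u s).2.1 * (lagField (u s)).1) (2 * π)) s :=
    fun s hs => ((hasDerivAt_eval (h.hasDerivAt_X hs) _).sub_const _).prodMk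
      (hasDerivAt_eval (h.hasDerivAt_integ_mul hs) _)
  have hk := two_le_two_mul_cStar
  have hb : ∀ s ∈ Ioo (-τ) τ, ‖(lagDX (u s) (2 * π),
      integ ((lagField (u s)).2.1 * (u s).1 + (u s).2.1 * (lagField (u s)).1) (2 * π))‖
        ≤ (L₁ + L₂ + 2) * ‖p s‖ + 0 := by
    intro s hs
    have h1 := lagX_two_smul (u s) (2 * π)
    have h2 : 2 * cStar * integ ((lagField (u s)).2.1 * (u s).1 + (u s).2.1 * (lagField (u s)).1)
        (2 * π) = - lagM (u s) * (lagX (u s) (2 * π) - 2 * π) := by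
      have e : 2 * cStar * integ ((lagField (u s)).2.1 * (u s).1 + (u s).2.1 * (lagField (u s)).1)
          (2 * π) = integ ((2 * cStar) • ((lagField (u s)).2.1 * (u s).1
            + (u s).2.1 * (lagField (u s)).1)) (2 * π) := by rw [map_smul]; rfl
      rw [e, lagField_two_smul_mul, map_sub, map_smul]
      simp only [BoundedContinuousFunction.coe_sub, Pi.sub_apply,
        BoundedContinuousFunction.coe_smul, smul_eq_mul]
      have e2 : integ (((1 / 2 : ℝ) • lagZ (u s) + (u s).2.1 * (u s).2.1) * (u s).1) (2 * π)
          = 2 * π * lagM (u s) := by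
        rw [lagM]; field_simp
      rw [e2, lagX]; ring
    have hA : |lagX (u s) (2 * π) - 2 * π| ≤ ‖p s‖ := norm_fst_le (p s)
    have hB : |integ ((u s).2.1 * (u s).1) (2 * π)| ≤ ‖p s‖ := norm_snd_le (p s)
    have hX : |lagX (u s) (2 * π)| ≤ L₁ :=
      ((lagX (u s)).norm_coe_le_norm _).trans (b₁ _ (hR s hs))
    have hM : |lagM (u s)| ≤ L₂ := b₂ _ (hR s hs)
    have hz : lagZ (u s) (2 * π) - (u s).2.2 = integ ((u s).2.1 * (u s).1) (2 * π) := by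
      simp [lagZ]
    rw [hz] at h1
    have key : ∀ a b : ℝ, 2 * cStar * a = b → |a| ≤ |b| := by
      intro a b hab
      rw [← hab, abs_mul, abs_of_nonneg (by linarith : (0 : ℝ) ≤ 2 * cStar)]
      nlinarith [abs_nonneg a]
    have n0 := norm_nonneg (p s)
    rw [add_zero]
    refine norm_prod_le_iff.2 ⟨(key _ _ h1).trans ?_, (key _ _ h2).trans ?_⟩
    · refine (abs_add_le _ _).trans ?_
      rw [abs_div, abs_mul, abs_mul, abs_two, abs_of_pos (four_pos : (0 : ℝ) < 4)]
      have := mul_le_mul hX hA (abs_nonneg _) hL₁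
      nlinarith [mul_nonneg hL₁ n0, mul_nonneg hL₂ n0]
    · rw [abs_mul, abs_neg]
      have := mul_le_mul hM hA (abs_nonneg _) hL₂
      nlinarith [mul_nonneg hL₁ n0, mul_nonneg hL₂ n0]
  have h0 : p 0 = 0 := by
    simp only [hp, lagX, h.init_J, mul_one, h.init_q]
    rw [integ_two_pi]
    simp
  have := norm_le_mul_exp_of_hasDerivAt (by positivity) le_rfl hd hb h.zero_mem ht
  rw [h0, norm_zero, zero_mul, zero_add, zero_mul, norm_le_zero_iff] at this
  exact ⟨by simpa [hp, sub_eq_zero] using congrArg Prod.fst this,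
    by simpa [hp] using congrArg Prod.snd this⟩

theorem lagX_two_pi {t : ℝ} (ht : t ∈ Ioo (-τ) τ) : lagX (u t) (2 * π) = 2 * π :=
  (h.periodic_aux ht).1

theorem integ_mul_two_pi {t : ℝ} (ht : t ∈ Ioo (-τ) τ) :
    integ ((u t).2.1 * (u t).1) (2 * π) = 0 := (h.periodic_aux ht).2

/-- At a fixed label the Jacobian solves a linear homogeneous equation with bounded coefficient, so
a zero at any time would force a zero at time 0, where J = 1. -/
theorem J_pos {t : ℝ} (ht : t ∈ Ioo (-τ) τ) (ξ : ℝ) : 0 < (u t).1 ξ := by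
  obtain ⟨R, hR⟩ := h.bdd
  obtain ⟨L₁, hL₁, b₁, -⟩ := bddLip_lagX R
  have hd : ∀ s ∈ Ioo (-τ) τ, HasDerivAt (fun s => (u s).1 ξ) ((lagField (u s)).1 ξ) s :=
    fun s hs => hasDerivAt_eval (h.hasDerivAt_J hs) ξ
  have hk := two_le_two_mul_cStar
  have hb : ∀ s ∈ Ioo (-τ) τ, ‖(lagField (u s)).1 ξ‖ ≤ (L₁ + π + 4) * ‖(u s).1 ξ‖ + 0 := by
    intro s hs
    have h1 := congrArg abs (lagField_fst (u s) ξ)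
    simp only [abs_mul, abs_two, abs_of_pos cStar_pos] at h1
    have hX : |lagX (u s) ξ| ≤ L₁ :=
      ((lagX (u s)).norm_coe_le_norm _).trans (b₁ _ (hR s hs))
    have hq : |(u s).2.1 ξ| ≤ 2 := ((u s).2.1.norm_coe_le_norm _).trans (h.norm_q_le s hs)
    rw [add_zero, Real.norm_eq_abs, Real.norm_eq_abs]
    have h2 : |(lagX (u s) ξ - π) / 2 + 2 * (u s).2.1 ξ| ≤ L₁ + π + 4 := by
      rw [abs_le] at *
      have := pi_pos
      constructor <;> linarith
    have h3 := mul_le_mul_of_nonneg_right h2 (abs_nonneg ((u s).1 ξ))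
    nlinarith [abs_nonneg ((lagField (u s)).1 ξ)]
  have hne : ∀ s ∈ Ioo (-τ) τ, (u s).1 ξ ≠ 0 := by
    intro s hs h0
    have := norm_le_mul_exp_of_hasDerivAt (by positivity) le_rfl hd hb hs h.zero_mem
    rw [h0, h.init_J] at this
    simp at this
    linarith
  by_contra hcon
  have hsub : uIcc 0 t ⊆ Ioo (-τ) τ := ordConnected_Ioo.uIcc_subset h.zero_mem ht
  have hc : ContinuousOn (fun s => (u s).1 ξ) (uIcc 0 t) := fun s hs =>
    (hd s (hsub hs)).continuousAt.continuousWithinAt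
  obtain ⟨s, hs, hs0⟩ := intermediate_value_uIcc hc (show (0 : ℝ) ∈ uIcc ((u 0).1 ξ) ((u t).1 ξ) by
    rw [h.init_J]
    exact mem_uIcc.2 (Or.inr ⟨not_lt.1 hcon, by simp⟩))
  exact hne s (hsub hs) hs0

theorem lagX_mem {t : ℝ} (ht : t ∈ Ioo (-τ) τ) (ξ : ℝ) : lagX (u t) ξ ∈ Icc 0 (2 * π) := by
  have h0 : ∀ x, (0 : ℝ →ᵇ ℝ) x ≤ (u t).1 x := fun x => (h.J_pos ht x).le
  constructor
  · have := integ_le_integ h0 ξ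
    rwa [map_zero] at this
  · have := abs_integ_le (fun x => (abs_of_nonneg (h0 x)).le) ξ
    have h2 := h.lagX_two_pi ht
    rw [lagX] at h2 ⊢
    rw [h2] at this
    exact (le_abs_self _).trans this

theorem abs_q_le {t : ℝ} (ht : t ∈ Ioo (-τ) τ) (ξ : ℝ) : |(u t).2.1 ξ| ≤ 2 :=
  ((u t).2.1.norm_coe_le_norm _).trans (h.norm_q_le t ht)

/-- Once positions are known to stay in the period, the rate no longer depends on the bound for `u`:
π/2 + 2·2 ≤ 6, divided by 2c_* ≥ 2. -/
theorem norm_lagField_fst_le {t : ℝ} (ht : t ∈ Ioo (-τ) τ) (ξ : ℝ) :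
    ‖(lagField (u t)).1 ξ‖ ≤ 3 * ‖(u t).1 ξ‖ + 0 := by
  have h1 := congrArg abs (lagField_fst (u t) ξ)
  have hk := two_le_two_mul_cStar
  simp only [abs_mul, abs_two, abs_of_pos cStar_pos] at h1
  have hX := h.lagX_mem ht ξ
  have hq := abs_le.1 (h.abs_q_le ht ξ)
  have hp := pi_lt_four
  have h2 : |(lagX (u t) ξ - π) / 2 + 2 * (u t).2.1 ξ| ≤ 6 := by
    rw [abs_le]
    constructor <;> linarith [hX.1, hX.2, hq.1, hq.2]
  have h3 := mul_le_mul_of_nonneg_right h2 (abs_nonneg ((u t).1 ξ))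
  rw [add_zero, Real.norm_eq_abs, Real.norm_eq_abs]
  nlinarith [abs_nonneg ((lagField (u t)).1 ξ)]

theorem J_le {t : ℝ} (ht : t ∈ Ioo (-τ) τ) (ξ : ℝ) : (u t).1 ξ ≤ exp (3 * |t|) := by
  have := norm_le_mul_exp_of_hasDerivAt (f := fun s => (u s).1 ξ) three_pos le_rfl
    (fun s hs => hasDerivAt_eval (h.hasDerivAt_J hs) ξ)
    (fun s hs => h.norm_lagField_fst_le hs ξ) h.zero_mem ht
  rw [h.init_J] at this
  simpa using (le_abs_self _).trans this

/-- Grönwall is started at time `t` and read at time 0, which turns the upper bound into a lower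
one. -/
theorem le_J {t : ℝ} (ht : t ∈ Ioo (-τ) τ) (ξ : ℝ) : exp (-(3 * |t|)) ≤ (u t).1 ξ := by
  have := norm_le_mul_exp_of_hasDerivAt (f := fun s => (u s).1 ξ) three_pos le_rfl
    (fun s hs => hasDerivAt_eval (h.hasDerivAt_J hs) ξ)
    (fun s hs => h.norm_lagField_fst_le hs ξ) ht h.zero_mem
  rw [h.init_J, Real.norm_eq_abs (_ : ℝ), Real.norm_eq_abs, abs_of_pos (h.J_pos ht ξ)] at this
  simp only [BoundedContinuousFunction.coe_one, Pi.one_apply, abs_one, zero_mul, add_zero,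
    zero_sub, abs_neg] at this
  rw [exp_neg, inv_eq_one_div, div_le_iff₀ (exp_pos _)]
  exact this

end IsLagSol

/-! ### Energy estimate and smallness of the forcing -/

/-- The squared `L²` norm of the slope, in Lagrangian coordinates. -/
noncomputable def lagEnergy (u : LagState) : ℝ := integ (u.2.1 * u.2.1 * u.1) (2 * π)

theorem abs_le_abs_of_two_mul_cStar_mul {a b : ℝ} (hab : 2 * cStar * a = b) : |a| ≤ |b| / 2 := by
  rw [← hab, abs_mul, abs_of_nonneg (by linarith [cStar_pos] : (0 : ℝ) ≤ 2 * cStar)]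
  nlinarith [abs_nonneg a, two_le_two_mul_cStar]

theorem cStar_le : cStar ≤ π / 2 := by
  refine abs_le_of_sq_le_sq' ?_ pi_div_two_pos.le |>.2
  rw [cStar_sq]
  nlinarith [sq_nonneg π]

namespace IsLagSol

variable {τ : ℝ} {u : ℝ → LagState} (h : IsLagSol τ u)
include h

theorem energy_nonneg {t : ℝ} (ht : t ∈ Ioo (-τ) τ) : 0 ≤ lagEnergy (u t) := by
  have h0 : ∀ x, (0 : ℝ →ᵇ ℝ) x ≤ ((u t).2.1 * (u t).2.1 * (u t).1) x := fun x =>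
    mul_nonneg (mul_self_nonneg _) (h.J_pos ht x).le
  have := integ_le_integ h0 (2 * π)
  rwa [map_zero] at this

theorem abs_integ_sub_mul_le {t : ℝ} (ht : t ∈ Ioo (-τ) τ) :
    |integ ((lagX (u t) - BoundedContinuousFunction.const ℝ π)
      * ((u t).2.1 * (u t).2.1) * (u t).1) (2 * π)| ≤ π * lagEnergy (u t) := by
  have : π * lagEnergy (u t) = integ (π • ((u t).2.1 * (u t).2.1 * (u t).1)) (2 * π) := by
    rw [map_smul]; rfl
  rw [this]
  refine abs_integ_le (fun x => ?_) _
  have hX := h.lagX_mem ht x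
  have h1 : |lagX (u t) x - π| ≤ π := abs_le.2 ⟨by linarith [hX.1], by linarith [hX.2]⟩
  have h2 : 0 ≤ (u t).2.1 x * (u t).2.1 x * (u t).1 x :=
    mul_nonneg (mul_self_nonneg _) (h.J_pos ht x).le
  simp only [BoundedContinuousFunction.coe_mul, BoundedContinuousFunction.coe_sub, Pi.mul_apply,
    Pi.sub_apply, BoundedContinuousFunction.const_apply, BoundedContinuousFunction.coe_smul,
    smul_eq_mul]
  rw [mul_assoc, abs_mul, abs_of_nonneg h2]
  exact mul_le_mul_of_nonneg_right h1 h2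

/-- The cubic terms -2q³J and +2q³J cancel. The terms proportional to qJ and to qJ ∫qJ integrate to
zero because ∫ qJ vanishes over the period. Only -(1/2) ∫ (X - π) q² J survives, so the growth rate
of the energy does not depend on the size of the slope. -/
theorem hasDerivAt_energy {t : ℝ} (ht : t ∈ Ioo (-τ) τ) :
    ∃ d, HasDerivAt (fun s => lagEnergy (u s)) d t ∧ ‖d‖ ≤ 1 * ‖lagEnergy (u t)‖ + 0 := by
  have hq := h.hasDerivAt_q ht
  have hJ := h.hasDerivAt_J ht
  set D : ℝ →ᵇ ℝ := ((lagField (u t)).2.1 * (u t).2.1 + (u t).2.1 * (lagField (u t)).2.1) * (u t).1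
    + (u t).2.1 * (u t).2.1 * (lagField (u t)).1 with hD
  have hd : HasDerivAt (fun s => (u s).2.1 * (u s).2.1 * (u s).1) D t := (hq.mul hq).mul hJ
  refine ⟨integ D (2 * π), hasDerivAt_eval (integ.hasFDerivAt.comp_hasDerivAt t hd) _, ?_⟩
  have e : (2 * cStar) • D = (-(1 / 2) : ℝ) • ((lagX (u t) - BoundedContinuousFunction.const ℝ π)
      * ((u t).2.1 * (u t).2.1) * (u t).1)
      + ((u t).2.2 - 2 * lagM (u t)) • ((u t).2.1 * (u t).1)
      + (u t).2.1 * (u t).1 * integ ((u t).2.1 * (u t).1) := by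
    ext ξ
    have h1 := lagField_fst (u t) ξ
    have h2 := lagField_snd (u t) ξ
    have h3 : lagZ (u t) ξ = (u t).2.2 + integ ((u t).2.1 * (u t).1) ξ := rfl
    rw [h3] at h2
    simp only [hD, BoundedContinuousFunction.coe_smul, BoundedContinuousFunction.coe_mul,
      BoundedContinuousFunction.coe_add, BoundedContinuousFunction.coe_sub, Pi.mul_apply,
      Pi.add_apply, Pi.sub_apply, smul_eq_mul, BoundedContinuousFunction.const_apply]
    linear_combination 2 * (u t).2.1 ξ * (u t).1 ξ * h2 + (u t).2.1 ξ ^ 2 * h1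
  have e2 : 2 * cStar * integ D (2 * π) = -(1 / 2) * integ ((lagX (u t)
      - BoundedContinuousFunction.const ℝ π) * ((u t).2.1 * (u t).2.1) * (u t).1) (2 * π) := by
    have : 2 * cStar * integ D (2 * π) = integ ((2 * cStar) • D) (2 * π) := by
      rw [map_smul]; rfl
    rw [this, e, map_add, map_add, map_smul, map_smul]
    simp only [BoundedContinuousFunction.coe_add, Pi.add_apply, BoundedContinuousFunction.coe_smul,
      smul_eq_mul, integ_mul_integ, h.integ_mul_two_pi ht]
    ring
  have h4 := abs_le_abs_of_two_mul_cStar_mul e2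
  rw [abs_mul, abs_neg, abs_of_pos (one_half_pos : (0 : ℝ) < 1 / 2)] at h4
  have h5 := h.abs_integ_sub_mul_le ht
  have h6 := h.energy_nonneg ht
  rw [Real.norm_eq_abs, Real.norm_eq_abs, abs_of_nonneg h6]
  nlinarith [pi_lt_four]

theorem energy_le {t : ℝ} (ht : t ∈ Ioo (-τ) τ) :
    lagEnergy (u t) ≤ lagEnergy (u 0) * exp |t| := by
  choose! d hd hd' using fun t (ht : t ∈ Ioo (-τ) τ) => h.hasDerivAt_energy ht
  have := norm_le_mul_exp_of_hasDerivAt one_pos le_rfl hd hd' h.zero_mem ht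
  rw [Real.norm_eq_abs, Real.norm_eq_abs, abs_of_nonneg (h.energy_nonneg h.zero_mem)] at this
  simpa using (le_abs_self _).trans this

theorem abs_z0_le {t : ℝ} (ht : t ∈ Ioo (-τ) τ) :
    |(u t).2.2| ≤ |(u 0).2.2| + lagEnergy (u 0) * exp τ * (τ * exp τ) := by
  have hE := h.energy_nonneg h.zero_mem
  have hε : 0 ≤ lagEnergy (u 0) * exp τ := by positivity
  -- The linear term is only slack, to match a Grönwall inequality that asks for K > 0; the actual
  -- bound is by the energy alone.
  have hb : ∀ s ∈ Ioo (-τ) τ, ‖(lagField (u s)).2.2‖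
      ≤ 1 * ‖(u s).2.2 - (u 0).2.2‖ + lagEnergy (u 0) * exp τ := by
    intro s hs
    have h1 : 2 * cStar * (lagField (u s)).2.2 = (2 * π)⁻¹ * integ ((lagX (u s)
        - BoundedContinuousFunction.const ℝ π) * ((u s).2.1 * (u s).2.1) * (u s).1) (2 * π) := by
      have := cStar_pos.ne'
      simp only [lagField]; field_simp
    have h2 := abs_le_abs_of_two_mul_cStar_mul h1
    rw [abs_mul, abs_of_pos (by positivity : 0 < (2 * π)⁻¹)] at h2
    have h3 := mul_le_mul_of_nonneg_left (h.abs_integ_sub_mul_le hs)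
      (by positivity : 0 ≤ (2 * π)⁻¹)
    have h4 : (2 * π)⁻¹ * (π * lagEnergy (u s)) = lagEnergy (u s) / 2 := by
      field_simp
    have h5 := h.energy_le hs
    have h6 : exp |s| ≤ exp τ := exp_le_exp.2 (abs_lt.2 hs).le
    have h7 := mul_le_mul_of_nonneg_left h6 hE
    have h8 := h.energy_nonneg hs
    rw [Real.norm_eq_abs]
    nlinarith [norm_nonneg ((u s).2.2 - (u 0).2.2)]
  have := norm_le_mul_exp_of_hasDerivAt one_pos hε
    (fun s hs => (h.hasDerivAt_z0 hs).sub_const (u 0).2.2) hb h.zero_mem ht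
  simp only [sub_self, norm_zero, zero_add, sub_zero, one_mul, Real.norm_eq_abs] at this
  have h9 : |t| ≤ τ := (abs_lt.2 ht).le
  have h10 : |t| * exp |t| ≤ τ * exp τ :=
    mul_le_mul h9 (exp_le_exp.2 h9) (exp_pos _).le h.pos.le
  have h11 := mul_le_mul_of_nonneg_left h10 hε
  have h12 := abs_sub_abs_le_abs_sub (u t).2.2 (u 0).2.2
  linarith

/-- A small energy makes the forcing term of the slope equation small. -/
theorem abs_forcing_le {t ε : ℝ} (ht : t ∈ Ioo (-τ) τ) (hε : 0 < ε) (hε1 : ε ≤ 1)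
    (hE : lagEnergy (u t) ≤ ε ^ 2) (ξ : ℝ) : |lagZ (u t) ξ / 2 - lagM (u t)| ≤ 4 * ε := by
  set J := (u t).1 with hJ
  set q := (u t).2.1 with hq
  set w := integ (q * J) with hw
  set P := lagEnergy (u t) with hP
  have hJ2 : integ J (2 * π) = 2 * π := h.lagX_two_pi ht
  -- Cauchy–Schwarz in the form |q| ≤ ε/2 + q²/(2ε), integrated against J, whose total mass is 2π.
  have hw1 : ∀ x, |w x| ≤ π * ε + P / (2 * ε) := by
    intro x
    have e : π * ε + P / (2 * ε) = integ ((ε / 2) • J + (1 / (2 * ε)) • (q * q * J)) (2 * π) := by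
      rw [map_add, map_smul, map_smul]
      simp only [BoundedContinuousFunction.coe_add, Pi.add_apply,
        BoundedContinuousFunction.coe_smul, smul_eq_mul, hJ2]
      rw [hP, lagEnergy]
      ring
    rw [e]
    refine abs_integ_le (fun y => ?_) x
    have hJy : 0 < J y := h.J_pos ht y
    simp only [BoundedContinuousFunction.coe_add, Pi.add_apply, BoundedContinuousFunction.coe_mul,
        BoundedContinuousFunction.coe_smul, smul_eq_mul, Pi.mul_apply]
    rw [abs_mul, abs_of_pos hJy, ← mul_assoc, ← add_mul]
    refine mul_le_mul_of_nonneg_right ?_ hJy.le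
    rw [← abs_mul_abs_self (q y), ← sub_nonneg]
    have : ε / 2 + 1 / (2 * ε) * (|q y| * |q y|) - |q y| = (ε - |q y|) ^ 2 / (2 * ε) := by
      field_simp; ring
    rw [this]; positivity
  have hP1 : P / (2 * ε) ≤ ε / 2 := by
    rw [div_le_iff₀ (by positivity)]; nlinarith
  have hI : |integ (J * w) (2 * π)| ≤ (π * ε + P / (2 * ε)) * (2 * π) := by
    have e : (π * ε + P / (2 * ε)) * (2 * π) = integ ((π * ε + P / (2 * ε)) • J) (2 * π) := by
      rw [map_smul]; simp only [BoundedContinuousFunction.coe_smul, smul_eq_mul, hJ2]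
    rw [e]
    refine abs_integ_le (fun y => ?_) _
    have hJy : 0 < J y := h.J_pos ht y
    simp only [BoundedContinuousFunction.coe_mul, Pi.mul_apply,
        BoundedContinuousFunction.coe_smul, smul_eq_mul]
    rw [abs_mul, abs_of_pos hJy, mul_comm]
    exact mul_le_mul_of_nonneg_right (hw1 y) hJy.le
  -- Because J has mass 2π, the peak value enters `lagM` with the same weight 1/2 as in `lagZ / 2`
  -- and cancels. The forcing depends only on the slope.
  have hM : lagM (u t) = (u t).2.2 / 2 + (2 * π)⁻¹ * (integ (J * w) (2 * π) / 2) + (2 * π)⁻¹ * P := by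
    have e : ((1 / 2 : ℝ) • lagZ (u t) + q * q) * J
        = ((u t).2.2 / 2) • J + (1 / 2 : ℝ) • (J * w) + q * q * J := by
      ext y
      have h3 : lagZ (u t) y = (u t).2.2 + w y := rfl
      simp only [BoundedContinuousFunction.coe_add, Pi.add_apply,
        BoundedContinuousFunction.coe_mul,
        BoundedContinuousFunction.coe_smul, smul_eq_mul, Pi.mul_apply, h3]
      ring
    rw [lagM, ← hq, ← hJ, e, map_add, map_add, map_smul, map_smul]
    simp only [BoundedContinuousFunction.coe_add, Pi.add_apply,
        BoundedContinuousFunction.coe_smul, smul_eq_mul, hJ2]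
    rw [hP, lagEnergy, ← hq, ← hJ]
    field_simp
  have hz : lagZ (u t) ξ = (u t).2.2 + w ξ := rfl
  have hp := pi_pos
  have hp3 := pi_gt_three
  have hp4 : π < 3.15 := pi_lt_d2
  have hP0 : 0 ≤ P := h.energy_nonneg ht
  have hI2 : |(2 * π)⁻¹ * (integ (J * w) (2 * π) / 2)| ≤ (π * ε + P / (2 * ε)) / 2 := by
    rw [abs_mul, abs_div, abs_two, abs_of_pos (by positivity : 0 < (2 * π)⁻¹), inv_mul_le_iff₀
      (by positivity)]
    linarith
  have hP2 : (2 * π)⁻¹ * P ≤ ε / 6 := by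
    rw [inv_mul_le_iff₀ (by positivity)]
    nlinarith
  have hP3 : 0 ≤ (2 * π)⁻¹ * P := by positivity
  have h1 := abs_le.1 (hw1 ξ)
  have h2 := abs_le.1 hI2
  have h3 : π * ε ≤ 3.15 * ε := by nlinarith
  rw [hz, hM, abs_le]
  constructor <;> linarith [h1.1, h1.2, h2.1, h2.2]

/-! ### Pointwise control of the slope under small forcing -/

section Slope

variable {ε : ℝ} (hr : ∀ t ∈ Ioo (-τ) τ, ∀ ξ, |lagZ (u t) ξ / 2 - lagM (u t)| ≤ ε)
include hr

/-- The a priori bound |q| ≤ 2 makes the quadratic term linear: the coefficient (π - X)/2 - q has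
size at most 4, and division by 2c_* ≥ 2 gives the rate 2. -/
theorem abs_q_le_exp {s t : ℝ} (hs : s ∈ Ioo (-τ) τ) (ht : t ∈ Ioo (-τ) τ) (hε : 0 ≤ ε) (ξ : ℝ) :
    |(u t).2.1 ξ| ≤ (|(u s).2.1 ξ| + ε * |t - s|) * exp (2 * |t - s|) := by
  refine norm_le_mul_exp_of_hasDerivAt (f := fun t => (u t).2.1 ξ) two_pos hε
    (fun r hr' => hasDerivAt_eval (h.hasDerivAt_q hr') ξ) (fun r hr' => ?_) hs ht
  have h1 := abs_le_abs_of_two_mul_cStar_mul (lagField_snd (u r) ξ)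
  have h2 := hr r hr' ξ
  have hX := h.lagX_mem hr' ξ
  have hq := h.abs_q_le hr' ξ
  set q := (u r).2.1 ξ
  rw [Real.norm_eq_abs, Real.norm_eq_abs]
  have h3 : |(π - lagX (u r) ξ) / 2 * q - q ^ 2| ≤ 4 * |q| := by
    have : (π - lagX (u r) ξ) / 2 * q - q ^ 2 = ((π - lagX (u r) ξ) / 2 - q) * q := by ring
    rw [this, abs_mul]
    refine mul_le_mul_of_nonneg_right ?_ (abs_nonneg _)
    have := abs_le.1 hq
    have := pi_lt_four
    rw [abs_le]; constructor <;> linarith [hX.1, hX.2]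
  have h4 := abs_add_le ((π - lagX (u r) ξ) / 2 * q - q ^ 2) (lagZ (u r) ξ / 2 - lagM (u r))
  linarith [abs_nonneg (lagZ (u r) ξ / 2 - lagM (u r))]

/-- A slope that is positive at time `t` either started in `[0, β]` or has crossed zero. The
two-sided estimate is restarted from that moment, so the bound is unaffected by how negative the
initial slope was. -/
theorem q_le_exp {t β : ℝ} (ht : t ∈ Ioo (-τ) τ) (hε : 0 ≤ ε) (hβ : 0 ≤ β) (ξ : ℝ)
    (h0 : (u 0).2.1 ξ ≤ β) : (u t).2.1 ξ ≤ (β + ε * |t|) * exp (2 * |t|) := by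
  have key : ∀ s ∈ uIcc 0 t, |(u s).2.1 ξ| ≤ β →
      (u t).2.1 ξ ≤ (β + ε * |t|) * exp (2 * |t|) := by
    intro s hs hsβ
    have hst : |t - s| ≤ |t| := by
      have := abs_sub_right_of_mem_uIcc hs
      rwa [sub_zero] at this
    have h1 := (le_abs_self _).trans (h.abs_q_le_exp hr
      (ordConnected_Ioo.uIcc_subset h.zero_mem ht hs) ht hε ξ)
    refine h1.trans (mul_le_mul (by gcongr) (exp_le_exp.2 (by linarith)) (exp_pos _).le ?_)
    positivity
  rcases le_total 0 ((u 0).2.1 ξ) with h1 | h1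
  · exact key 0 left_mem_uIcc (by rwa [abs_of_nonneg h1])
  rcases le_total ((u t).2.1 ξ) 0 with h2 | h2
  · exact h2.trans (by positivity)
  have hsub : uIcc 0 t ⊆ Ioo (-τ) τ := ordConnected_Ioo.uIcc_subset h.zero_mem ht
  obtain ⟨s, hs, hs0⟩ := intermediate_value_uIcc (f := fun s => (u s).2.1 ξ) (fun s hs =>
    (hasDerivAt_eval (h.hasDerivAt_q (hsub hs)) ξ).continuousAt.continuousWithinAt)
    (mem_uIcc.2 (Or.inl ⟨h1, h2⟩))
  refine key s hs ?_
  simp only at hs0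
  rwa [hs0, abs_zero]

/-- Backward in time, negative slopes stay controlled on the left half of the period. -/
theorem neg_q_le_of_nonpos {t b : ℝ} (ht : t ∈ Ioo (-τ) τ) (ht0 : t ≤ 0) (hε : 0 < ε) (hb : 0 ≤ b)
    (ξ : ℝ) (hX : ∀ s ∈ Icc t 0, lagX (u s) ξ ≤ π) (h0 : -b ≤ (u 0).2.1 ξ) :
    -(b + ε * |t|) ≤ (u t).2.1 ξ := by
  have hmem : ∀ s ∈ Icc 0 (-t), -s ∈ Ioo (-τ) τ := fun s hs =>
    ⟨by linarith [hs.2, ht.1], by linarith [hs.1, h.pos]⟩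
  have hd : ∀ s ∈ Icc 0 (-t), HasDerivAt (fun s => -(u (-s)).2.1 ξ)
      ((lagField (u (-s))).2.1 ξ) s := by
    intro s hs
    have := ((hasDerivAt_eval (h.hasDerivAt_q (hmem s hs)) ξ).comp s (hasDerivAt_neg s)).neg
    exact this.congr_deriv (by ring)
  -- In reversed time -q is compared with the barrier b + εs. At a contact q ≤ 0 and X ≤ π, so (π -
  -- X)/2 · q and -q² both push -q down, and the forcing contributes at most ε/2 < ε.
  have := image_le_of_deriv_right_lt_deriv_boundary (a := 0) (b := -t)
    (f := fun s => -(u (-s)).2.1 ξ) (f' := fun s => (lagField (u (-s))).2.1 ξ)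
    (B := fun s => b + ε * s) (B' := fun _ => ε)
    (fun s hs => (hd s hs).continuousAt.continuousWithinAt)
    (fun s hs => (hd s (Ico_subset_Icc_self hs)).hasDerivWithinAt)
    (by simp only [neg_zero, mul_zero, add_zero]; linarith)
    (fun s => by simpa using ((hasDerivAt_id s).const_mul ε).const_add b)
    (fun s hs hsB => ?_) (right_mem_Icc.2 (by linarith))
  · simp only [neg_neg] at this
    rw [abs_of_nonpos ht0]
    linarith
  · have hs' := hmem s (Ico_subset_Icc_self hs)
    have h1 := lagField_snd (u (-s)) ξ
    have h2 := abs_le.1 (hr _ hs' ξ)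
    have hXs := hX (-s) ⟨by linarith [hs.2], by linarith [hs.1]⟩
    have hB : 0 ≤ b + ε * s := add_nonneg hb (mul_nonneg hε.le hs.1)
    have hq : (u (-s)).2.1 ξ = -(b + ε * s) := by linarith
    rw [hq] at h1
    have h3 : 0 ≤ (π - lagX (u (-s)) ξ) / 2 * (b + ε * s) :=
      mul_nonneg (by linarith) hB
    have h4 : 2 * cStar * (lagField (u (-s))).2.1 ξ ≤ ε := by
      rw [h1]; nlinarith [sq_nonneg (b + ε * s)]
    have := two_le_two_mul_cStar
    by_contra hcon
    simp only [not_lt] at hcon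
    nlinarith

/-- Exponential growth of the slope at the peak. -/
theorem q_zero_le {t a : ℝ} (ht : t ∈ Ioo (-τ) τ) (ht0 : 0 ≤ t) (ha : 0 < a) (hε : ε ≤ a / 4)
    (h0 : (u 0).2.1 0 ≤ -(a / 2)) : (u t).2.1 0 ≤ -(a / 2 * exp (t / 4)) := by
  have hmem : ∀ s ∈ Icc 0 t, s ∈ Ioo (-τ) τ := fun s hs =>
    ⟨by linarith [hs.1, h.pos], lt_of_le_of_lt hs.2 ht.2⟩
  have hd : ∀ s ∈ Icc 0 t, HasDerivAt (fun s => (u s).2.1 0) ((lagField (u s)).2.1 0) s :=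
    fun s hs => hasDerivAt_eval (h.hasDerivAt_q (hmem s hs)) 0
  -- The barrier is -B with B = (a/2) e^{s/4}. At a contact 2c_* q' ≤ -(π/2)B + ε, where ε ≤ a/4 ≤
  -- B/2, while the barrier falls at the rate 2c_* B/4 ≤ πB/4 because c_* ≤ π/2. Since π > 3 the
  -- slope falls strictly faster.
  refine image_le_of_deriv_right_lt_deriv_boundary (a := 0) (b := t)
    (B := fun s => -(a / 2 * exp (s / 4))) (B' := fun s => -(a / 2 * (exp (s / 4) * (1 / 4))))
    (fun s hs => (hd s hs).continuousAt.continuousWithinAt)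
    (fun s hs => (hd s (Ico_subset_Icc_self hs)).hasDerivWithinAt)
    (by simpa using h0)
    (fun s => ((((hasDerivAt_id s).div_const 4).exp).const_mul (a / 2)).neg)
    (fun s hs hsB => ?_) (right_mem_Icc.2 ht0)
  have h1 := lagField_snd (u s) 0
  have h2 := abs_le.1 (hr _ (hmem s (Ico_subset_Icc_self hs)) 0)
  have hX : lagX (u s) 0 = 0 := integ_zero _
  rw [hX, hsB] at h1
  have he : 1 ≤ exp (s / 4) := one_le_exp (by linarith [hs.1])
  set B := a / 2 * exp (s / 4) with hB
  have hBa : a / 2 ≤ B := by rw [hB]; nlinarith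
  have h4 : 2 * cStar * (lagField (u s)).2.1 0 ≤ -(π / 2 * B) + ε := by
    rw [h1]; nlinarith [sq_nonneg B]
  have h5 : -(a / 2 * (exp (s / 4) * (1 / 4))) = -(B / 4) := by rw [hB]; ring
  rw [h5]
  have h6 := two_le_two_mul_cStar
  have h7 := cStar_le
  have h8 := pi_gt_three
  by_contra hcon
  simp only [not_lt] at hcon
  have h9 : -(π * (B / 4)) ≤ 2 * cStar * (lagField (u s)).2.1 0 := by
    have := mul_le_mul_of_nonneg_left hcon (by linarith : 0 ≤ 2 * cStar)
    nlinarith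
  nlinarith

end Slope

/-- The slope is Lipschitz continuous along the Lagrangian labels. -/
theorem abs_q_sub_le {L : ℝ} (hL : ∀ ξ η, |(u 0).2.1 ξ - (u 0).2.1 η| ≤ L * |clamp ξ - clamp η|)
    {t : ℝ} (ht : t ∈ Ioo (-τ) τ) (ξ η : ℝ) :
    |(u t).2.1 ξ - (u t).2.1 η| ≤ (L + 4 * exp (3 * τ) * τ) * exp (6 * τ) * |clamp ξ - clamp η| := by
  have hd : ∀ s ∈ Ioo (-τ) τ, HasDerivAt (fun s => (u s).2.1 ξ - (u s).2.1 η)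
      ((lagField (u s)).2.1 ξ - (lagField (u s)).2.1 η) s := fun s hs =>
    (hasDerivAt_eval (h.hasDerivAt_q hs) ξ).sub (hasDerivAt_eval (h.hasDerivAt_q hs) η)
  have hτ := h.pos
  have hb : ∀ s ∈ Ioo (-τ) τ, ‖(lagField (u s)).2.1 ξ - (lagField (u s)).2.1 η‖
      ≤ 6 * ‖(u s).2.1 ξ - (u s).2.1 η‖ + 4 * exp (3 * τ) * |clamp ξ - clamp η| := by
    intro s hs
    have hJ : ‖(u s).1‖ ≤ exp (3 * τ) := by
      refine (BoundedContinuousFunction.norm_le (exp_pos _).le).2 fun x => ?_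
      rw [Real.norm_eq_abs, abs_of_pos (h.J_pos hs x)]
      exact (h.J_le hs x).trans (exp_le_exp.2 (by linarith [abs_lt.2 hs]))
    have hX : |lagX (u s) ξ - lagX (u s) η| ≤ exp (3 * τ) * |clamp ξ - clamp η| :=
      (abs_integ_sub_le _ _ _).trans (mul_le_mul_of_nonneg_right hJ (abs_nonneg _))
    have hZ : |lagZ (u s) ξ - lagZ (u s) η| ≤ 2 * exp (3 * τ) * |clamp ξ - clamp η| := by
      have e : lagZ (u s) ξ - lagZ (u s) η
          = integ ((u s).2.1 * (u s).1) ξ - integ ((u s).2.1 * (u s).1) η := by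
        simp [lagZ]
      rw [e]
      refine (abs_integ_sub_le _ _ _).trans (mul_le_mul_of_nonneg_right ?_ (abs_nonneg _))
      exact (norm_mul_le _ _).trans (mul_le_mul (h.norm_q_le s hs) hJ (norm_nonneg _) two_pos.le)
    have e1 : 2 * cStar * ((lagField (u s)).2.1 ξ - (lagField (u s)).2.1 η)
        = ((π - lagX (u s) ξ) / 2 - (u s).2.1 ξ - (u s).2.1 η) * ((u s).2.1 ξ - (u s).2.1 η)
          - (lagX (u s) ξ - lagX (u s) η) / 2 * (u s).2.1 η
          + (lagZ (u s) ξ - lagZ (u s) η) / 2 := by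
      rw [mul_sub, lagField_snd, lagField_snd]; ring
    have h1 := abs_le_abs_of_two_mul_cStar_mul e1
    have hq1 := abs_le.1 (h.abs_q_le hs ξ)
    have hq2 := abs_le.1 (h.abs_q_le hs η)
    have hXm := h.lagX_mem hs ξ
    have hp := pi_lt_four
    have h2 : |((π - lagX (u s) ξ) / 2 - (u s).2.1 ξ - (u s).2.1 η)| ≤ 6 := by
      rw [abs_le]; constructor <;> linarith [hXm.1, hXm.2]
    have h3 := mul_le_mul_of_nonneg_right h2 (abs_nonneg ((u s).2.1 ξ - (u s).2.1 η))
    have h4 := mul_le_mul hX (h.abs_q_le hs η) (abs_nonneg _) (by positivity)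
    rw [← abs_mul] at h3 h4
    have h5 := (abs_add_le (((π - lagX (u s) ξ) / 2 - (u s).2.1 ξ - (u s).2.1 η)
      * ((u s).2.1 ξ - (u s).2.1 η) - (lagX (u s) ξ - lagX (u s) η) / 2 * (u s).2.1 η)
      ((lagZ (u s) ξ - lagZ (u s) η) / 2)).trans (add_le_add_left (abs_sub _ _) _)
    have h7 : 0 ≤ exp (3 * τ) * |clamp ξ - clamp η| := by positivity
    replace h1 := h1.trans (div_le_div_of_nonneg_right h5 two_pos.le)
    rw [div_mul_eq_mul_div, abs_div (_ * _), abs_div (lagZ (u s) ξ - _), abs_two] at h1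
    rw [Real.norm_eq_abs, Real.norm_eq_abs]
    have h6 := abs_nonneg ((u s).2.1 ξ - (u s).2.1 η)
    linarith
  have h1 := norm_le_mul_exp_of_hasDerivAt (by norm_num) (by positivity) hd hb h.zero_mem ht
  rw [Real.norm_eq_abs, Real.norm_eq_abs, sub_zero] at h1
  have h2 : |t| ≤ τ := (abs_lt.2 ht).le
  have hLn : 0 ≤ L * |clamp ξ - clamp η| := (abs_nonneg _).trans (hL ξ η)
  have h3 := mul_le_mul (add_le_add (hL ξ η) (mul_le_mul_of_nonneg_left h2
    (by positivity : 0 ≤ 4 * exp (3 * τ) * |clamp ξ - clamp η|)))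
    (exp_le_exp.2 (by linarith : 6 * |t| ≤ 6 * τ)) (exp_pos _).le (by positivity)
  refine h1.trans (h3.trans (le_of_eq ?_))
  ring

/-- Labels range over all of ℝ, but the Lipschitz bound sees only their clamped values. Outside the
period the slope is constant, so its supremum over ℝ is already attained on the period. -/
theorem q_clamp {L : ℝ} (hL : ∀ ξ η, |(u 0).2.1 ξ - (u 0).2.1 η| ≤ L * |clamp ξ - clamp η|)
    {t : ℝ} (ht : t ∈ Ioo (-τ) τ) (ξ : ℝ) : (u t).2.1 (clamp ξ) = (u t).2.1 ξ := by
  have := h.abs_q_sub_le hL ht (clamp ξ) ξ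
  rw [clamp_of_mem (clamp_mem ξ), sub_self, abs_zero, mul_zero] at this
  exact sub_eq_zero.1 (abs_nonpos_iff.1 this)

end IsLagSol

/-! ### Eulerian coordinates -/

theorem BddLip.continuous {E G : Type*} [NormedAddCommGroup E] [NormedAddCommGroup G] {F : E → G}
    (h : BddLip F) : Continuous F := by
  refine continuous_iff_continuousAt.2 fun u => ?_
  obtain ⟨L, hL, -, hl⟩ := h (‖u‖ + 1)
  rw [ContinuousAt, tendsto_iff_norm_sub_tendsto_zero]
  have hlim : Tendsto (fun v => L * ‖v - u‖) (𝓝 u) (𝓝 0) := by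
    have : Continuous fun v => L * ‖v - u‖ := by fun_prop
    simpa using this.tendsto u
  refine squeeze_zero' (Eventually.of_forall fun _ => norm_nonneg _) ?_ hlim
  filter_upwards [Metric.ball_mem_nhds u one_pos] with v hv
  rw [mem_ball_iff_norm] at hv
  refine hl v u ?_ (by linarith)
  have := norm_sub_norm_le v u
  linarith

/-- The flow map, without truncation to one period. -/
noncomputable def flow (u : LagState) (ξ : ℝ) : ℝ := ∫ y in (0)..ξ, u.1 y

/-- The label of the particle at a given position. -/
noncomputable def label (u : LagState) : ℝ → ℝ := Function.invFun (flow u)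

/-- The slope of the perturbation in Eulerian coordinates. -/
noncomputable def eulSlope (u : LagState) (x : ℝ) : ℝ := u.2.1 (label u x)

/-- The perturbation in Eulerian coordinates. -/
noncomputable def eulPert (u : LagState) : ℝ → ℝ :=
  perExt fun x => u.2.2 + ∫ y in (0)..x, eulSlope u y

theorem flow_zero (u : LagState) : flow u 0 = 0 := intervalIntegral.integral_same

theorem hasDerivAt_flow (u : LagState) (ξ : ℝ) : HasDerivAt (flow u) (u.1 ξ) ξ :=
  hasDerivAt_integral_zero u.1.continuous ξ

theorem continuous_flow (u : LagState) : Continuous (flow u) :=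
  continuous_iff_continuousAt.2 fun ξ => (hasDerivAt_flow u ξ).continuousAt

theorem flow_eq_lagX (u : LagState) {ξ : ℝ} (hξ : ξ ∈ Icc 0 (2 * π)) : flow u ξ = lagX u ξ :=
  (integ_apply_of_mem u.1 hξ).symm

theorem mul_sub_le_flow {u : LagState} {c : ℝ} (hJ : ∀ ξ, c ≤ u.1 ξ) {ξ η : ℝ} (h : ξ ≤ η) : c * (η - ξ) ≤ flow u η - flow u ξ := by
  rw [flow, flow, intervalIntegral.integral_interval_sub_left
    (u.1.continuous.intervalIntegrable _ _) (u.1.continuous.intervalIntegrable _ _)]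
  have := intervalIntegral.integral_mono_on (μ := volume) h
    (continuous_const (y := c) |>.intervalIntegrable _ _)
    (u.1.continuous.intervalIntegrable _ _) fun x _ => hJ x
  simpa [mul_comm] using this

theorem mul_abs_sub_le_flow {u : LagState} {c : ℝ} (hJ : ∀ ξ, c ≤ u.1 ξ) (ξ η : ℝ) :
    c * |ξ - η| ≤ |flow u ξ - flow u η| := by
  rcases le_total ξ η with h | h
  · have := mul_sub_le_flow hJ h
    rw [abs_sub_comm, abs_sub_comm (flow u ξ), abs_of_nonneg (sub_nonneg.2 h)]
    exact this.trans (le_abs_self _)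
  · have := mul_sub_le_flow hJ h
    rw [abs_of_nonneg (sub_nonneg.2 h)]
    exact this.trans (le_abs_self _)

section Flow

variable {u : LagState} {c : ℝ} (hc : 0 < c) (hJ : ∀ ξ, c ≤ u.1 ξ)
include hc hJ

theorem strictMono_flow : StrictMono (flow u) := fun ξ η h => by
  have := mul_sub_le_flow hJ h.le
  have := mul_pos hc (sub_pos.2 h)
  linarith

theorem surjective_flow : Function.Surjective (flow u) := by
  refine (continuous_flow u).surjective ?_ ?_
  · refine tendsto_atTop_mono' _ ?_ (tendsto_id.const_mul_atTop hc)
    filter_upwards [eventually_ge_atTop 0] with ξ hξ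
    have := mul_sub_le_flow hJ hξ
    rwa [sub_zero, flow_zero, sub_zero] at this
  · refine tendsto_atBot_mono' _ ?_ (tendsto_id.const_mul_atBot hc)
    filter_upwards [eventually_le_atBot 0] with ξ hξ
    have := mul_sub_le_flow hJ hξ
    rw [flow_zero] at this
    simp only [id]
    linarith

theorem flow_label (x : ℝ) : flow u (label u x) = x :=
  Function.invFun_eq (surjective_flow hc hJ x)

theorem label_flow (ξ : ℝ) : label u (flow u ξ) = ξ :=
  Function.leftInverse_invFun (strictMono_flow hc hJ).injective ξ

theorem label_zero : label u 0 = 0 := by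
  conv_lhs => rw [← flow_zero u]
  exact label_flow hc hJ 0

theorem mul_abs_label_sub_le (x y : ℝ) : c * |label u x - label u y| ≤ |x - y| := by
  have := mul_abs_sub_le_flow hJ (label u x) (label u y)
  rwa [flow_label hc hJ, flow_label hc hJ] at this

theorem continuous_label : Continuous (label u) := by
  have : LipschitzWith (Real.toNNReal c⁻¹) (label u) := by
    refine LipschitzWith.of_dist_le_mul fun x y => ?_
    rw [Real.coe_toNNReal _ (inv_pos.2 hc).le, Real.dist_eq, Real.dist_eq, ← div_eq_inv_mul,
      le_div_iff₀ hc, mul_comm]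
    exact mul_abs_label_sub_le hc hJ x y
  exact this.continuous

theorem label_two_pi (h2 : lagX u (2 * π) = 2 * π) : label u (2 * π) = 2 * π := by
  rw [← flow_eq_lagX u ⟨two_pi_pos.le, le_rfl⟩] at h2
  conv_lhs => rw [← h2]
  exact label_flow hc hJ _

theorem label_mem (h2 : lagX u (2 * π) = 2 * π) {x : ℝ} (hx : x ∈ Icc 0 (2 * π)) :
    label u x ∈ Icc 0 (2 * π) := by
  have hm : Monotone (label u) := fun x y hxy => by
    rw [← (strictMono_flow hc hJ).le_iff_le, flow_label hc hJ, flow_label hc hJ]; exact hxy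
  have h1 := hm hx.1
  have h3 := hm hx.2
  rw [label_zero hc hJ] at h1
  rw [label_two_pi hc hJ h2] at h3
  exact ⟨h1, h3⟩

theorem lagX_label (h2 : lagX u (2 * π) = 2 * π) {x : ℝ} (hx : x ∈ Icc 0 (2 * π)) :
    lagX u (label u x) = x := by
  rw [← flow_eq_lagX u (label_mem hc hJ h2 hx), flow_label hc hJ]

theorem integral_comp_label (h2 : lagX u (2 * π) = 2 * π) (F : ℝ →ᵇ ℝ) {x : ℝ}
    (hx : x ∈ Icc 0 (2 * π)) :
    ∫ y in (0)..x, F (label u y) = integ (F * u.1) (label u x) := by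
  have := intervalIntegral.integral_comp_mul_deriv (a := 0) (b := label u x)
    (fun ξ _ => hasDerivAt_flow u ξ) u.1.continuous.continuousOn
    (F.continuous.comp (continuous_label hc hJ))
  rw [flow_zero, flow_label hc hJ] at this
  rw [integ_apply_of_mem _ (label_mem hc hJ h2 hx)]
  refine Eq.trans this.symm (intervalIntegral.integral_congr fun ξ _ => ?_)
  simp only [Function.comp, label_flow hc hJ, BoundedContinuousFunction.coe_mul, Pi.mul_apply]

theorem continuous_eulSlope : Continuous (eulSlope u) :=
  u.2.1.continuous.comp (continuous_label hc hJ)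

theorem lagZ_label (h2 : lagX u (2 * π) = 2 * π) {x : ℝ} (hx : x ∈ Icc 0 (2 * π)) :
    u.2.2 + ∫ y in (0)..x, eulSlope u y = lagZ u (label u x) := by
  simp only [eulSlope]
  rw [integral_comp_label hc hJ h2 _ hx]
  rfl

theorem lagZ_apply (h2 : lagX u (2 * π) = 2 * π) {ξ : ℝ} (hξ : ξ ∈ Icc 0 (2 * π)) :
    u.2.2 + ∫ y in (0)..(lagX u ξ), eulSlope u y = lagZ u ξ := by
  have hm := (strictMono_flow hc hJ).monotone
  have hx : lagX u ξ ∈ Icc 0 (2 * π) := by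
    have h3 := hm hξ.1
    have h4 := hm hξ.2
    rw [flow_zero] at h3
    rw [flow_eq_lagX u (right_mem_Icc.2 two_pi_pos.le), h2] at h4
    rw [← flow_eq_lagX u hξ]
    exact ⟨h3, h4⟩
  rw [lagZ_label hc hJ h2 hx, ← flow_eq_lagX u hξ, label_flow hc hJ]

theorem integral_eulSlope (h2 : lagX u (2 * π) = 2 * π) (h3 : integ (u.2.1 * u.1) (2 * π) = 0) :
    ∫ y in (0)..(2 * π), eulSlope u y = 0 := by
  simp only [eulSlope]
  rw [integral_comp_label hc hJ h2 _ ⟨two_pi_pos.le, le_rfl⟩, label_two_pi hc hJ h2, h3]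

theorem eulPert_of_mem (h2 : lagX u (2 * π) = 2 * π) (h3 : integ (u.2.1 * u.1) (2 * π) = 0)
    {x : ℝ} (hx : x ∈ Icc 0 (2 * π)) :
    eulPert u x = u.2.2 + ∫ y in (0)..x, eulSlope u y := by
  rw [eulPert, perExt_of_mem_Icc _ hx]
  rw [integral_eulSlope hc hJ h2 h3, intervalIntegral.integral_same]

end Flow

namespace IsLagSol

variable {τ : ℝ} {u : ℝ → LagState} (h : IsLagSol τ u)
include h

theorem exp_le_J {t : ℝ} (ht : t ∈ Ioo (-τ) τ) (ξ : ℝ) : exp (-(3 * τ)) ≤ (u t).1 ξ :=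
  (exp_le_exp.2 (by linarith [abs_lt.2 ht])).trans (h.le_J ht ξ)

theorem continuousOn : ContinuousOn u (Ioo (-τ) τ) := fun t ht =>
  (h.deriv t ht).continuousAt.continuousWithinAt

/-- The lower bound of J turns a distance of labels into a distance of positions, and at a fixed
label the flows at two times differ by at most the sup distance of the Jacobians times the label. -/
theorem continuousOn_label :
    ContinuousOn (fun p : ℝ × ℝ => label (u p.1) p.2) (Ioo (-τ) τ ×ˢ univ) := by
  rintro ⟨t, x⟩ ⟨ht, -⟩
  have hc := exp_pos (-(3 * τ))
  rw [ContinuousWithinAt, tendsto_iff_dist_tendsto_zero]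
  set η := label (u t) x with hη
  have hlim : Tendsto (fun p : ℝ × ℝ => (exp (-(3 * τ)))⁻¹ * (|p.2 - x| +
      ‖(u t).1 - (u p.1).1‖ * |η|)) (𝓝[Ioo (-τ) τ ×ˢ univ] (t, x)) (𝓝 0) := by
    have hJ : ContinuousAt (fun p : ℝ × ℝ => (u p.1).1) (t, x) :=
      ContinuousAt.comp (f := Prod.fst) (g := fun s => (u s).1)
        (h.hasDerivAt_J ht).continuousAt continuousAt_fst
    have : ContinuousAt (fun p : ℝ × ℝ => (exp (-(3 * τ)))⁻¹ * (|p.2 - x| +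
      ‖(u t).1 - (u p.1).1‖ * |η|)) (t, x) := by fun_prop
    have h1 := this.tendsto
    simp only [sub_self, abs_zero, norm_zero, zero_mul, add_zero, mul_zero] at h1
    exact h1.mono_left nhdsWithin_le_nhds
  refine squeeze_zero' (Eventually.of_forall fun _ => dist_nonneg) ?_ hlim
  filter_upwards [self_mem_nhdsWithin] with p hp
  have h1 := mul_abs_sub_le_flow (h.exp_le_J hp.1) (label (u p.1) p.2) η
  rw [flow_label hc (h.exp_le_J hp.1)] at h1
  have h2 : p.2 - flow (u p.1) η = (p.2 - x) + (flow (u t) η - flow (u p.1) η) := by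
    rw [hη, flow_label hc (h.exp_le_J ht)]; ring
  have h3 : |flow (u t) η - flow (u p.1) η| ≤ ‖(u t).1 - (u p.1).1‖ * |η| := by
    have := abs_integral_le_norm ((u t).1 - (u p.1).1) 0 η
    rw [sub_zero] at this
    refine le_trans (le_of_eq ?_) this
    rw [flow, flow, ← intervalIntegral.integral_sub ((u t).1.continuous.intervalIntegrable _ _)
      ((u p.1).1.continuous.intervalIntegrable _ _)]
    rfl
  rw [Real.dist_eq, ← div_eq_inv_mul, le_div_iff₀ hc, mul_comm]
  rw [h2] at h1
  exact h1.trans ((abs_add_le _ _).trans (add_le_add_right h3 _))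

theorem continuousOn_comp_label {F : ℝ → ℝ →ᵇ ℝ} (hF : ContinuousOn F (Ioo (-τ) τ)) :
    ContinuousOn (fun p : ℝ × ℝ => F p.1 (label (u p.1) p.2)) (Ioo (-τ) τ ×ˢ univ) := by
  have h1 : ContinuousOn (fun p : ℝ × ℝ => F p.1) (Ioo (-τ) τ ×ˢ univ) :=
    hF.comp continuousOn_fst fun p hp => hp.1
  exact h1.eval h.continuousOn_label

theorem continuousOn_eulSlope :
    ContinuousOn (fun p : ℝ × ℝ => eulSlope (u p.1) p.2) (Ioo (-τ) τ ×ˢ univ) :=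
  h.continuousOn_comp_label (F := fun t => (u t).2.1) fun _ ht =>
    (h.hasDerivAt_q ht).continuousAt.continuousWithinAt

/-- The perturbation is differentiable in time, at every point of the period. -/
theorem hasDerivAt_pert {t x : ℝ} (ht : t ∈ Ioo (-τ) τ) (hx : x ∈ Icc 0 (2 * π)) :
    HasDerivAt (fun s => (u s).2.2 + ∫ y in (0)..x, eulSlope (u s) y)
      (lagDZ (u t) (label (u t) x) - lagDX (u t) (label (u t) x) * eulSlope (u t) x) t := by
  have hc := exp_pos (-(3 * τ))
  set ξ := label (u t) x with hξ
  have hξm : ξ ∈ Icc 0 (2 * π) := label_mem hc (h.exp_le_J ht) (h.lagX_two_pi ht) hx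
  have hXt : lagX (u t) ξ = x := lagX_label hc (h.exp_le_J ht) (h.lagX_two_pi ht) hx
  have hdX := hasDerivAt_eval (h.hasDerivAt_X ht) ξ
  have hdZ := hasDerivAt_eval (h.hasDerivAt_Z ht) ξ
  set G := eulSlope (u t) x with hG
  -- The Eulerian slope need not be differentiable in time. The value at the fixed point `x` is
  -- instead reached from the particle that passes through `x` at time `t`; `e` is the error of
  -- freezing the slope on the segment between them, of order o(s - t) by joint continuity.
  set e : ℝ → ℝ := fun s => ∫ y in x..(lagX (u s) ξ), (eulSlope (u s) y - G) with he
  have he' : HasDerivAt e 0 t := by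
    rw [hasDerivAt_iff_isLittleO]
    have h1 : (fun s => lagX (u s) ξ - lagX (u t) ξ) =O[𝓝 t] fun s => s - t := hdX.isBigO_sub
    refine Asymptotics.IsLittleO.trans_isBigO ?_ h1
    rw [Asymptotics.isLittleO_iff]
    intro c hc0
    have hcont : ContinuousAt (fun p : ℝ × ℝ => eulSlope (u p.1) p.2) (t, x) :=
      h.continuousOn_eulSlope.continuousAt ((isOpen_Ioo.prod isOpen_univ).mem_nhds ⟨ht, mem_univ _⟩)
    obtain ⟨δ, hδ, hb⟩ := Metric.continuousAt_iff.1 hcont c hc0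
    have hXc := hdX.continuousAt
    rw [Metric.continuousAt_iff] at hXc
    obtain ⟨δ', hδ', hb'⟩ := hXc δ hδ
    filter_upwards [Metric.ball_mem_nhds t (lt_min hδ hδ')] with s hs
    rw [Metric.mem_ball] at hs
    have h2 := hb' (hs.trans_le (min_le_right _ _))
    rw [hXt, Real.dist_eq] at h2
    have h3 : e t = 0 := by simp only [he, hXt, intervalIntegral.integral_same]
    rw [h3, smul_zero, sub_zero, sub_zero, hXt]
    refine intervalIntegral.norm_integral_le_of_norm_le_const fun y hy => ?_
    have hy2 : |y - x| ≤ |lagX (u s) ξ - x| := abs_sub_left_of_mem_uIcc (uIoc_subset_uIcc hy)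
    have := hb (x := (s, y)) (by
      rw [Prod.dist_eq]
      exact max_lt (hs.trans_le (min_le_left _ _)) (by rw [Real.dist_eq]; exact hy2.trans_lt h2))
    exact this.le
  have hmain : HasDerivAt (fun s => lagZ (u s) ξ - (lagX (u s) ξ - x) * G - e s)
      (lagDZ (u t) ξ - lagDX (u t) ξ * G - 0) t :=
    (hdZ.sub ((hdX.sub_const x).mul_const G)).sub he'
  rw [sub_zero] at hmain
  refine hmain.congr_of_eventuallyEq ?_
  filter_upwards [isOpen_Ioo.mem_nhds ht] with s hs
  have hcs := continuous_eulSlope hc (h.exp_le_J hs)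
  rw [← lagZ_apply hc (h.exp_le_J hs) (h.lagX_two_pi hs) hξm, he]
  simp only
  rw [intervalIntegral.integral_sub (hcs.intervalIntegrable _ _) intervalIntegrable_const,
    intervalIntegral.integral_const, smul_eq_mul,
    ← intervalIntegral.integral_interval_sub_left (hcs.intervalIntegrable 0 (lagX (u s) ξ))
      (hcs.intervalIntegrable 0 x)]
  ring

/-- A solution of the Lagrangian equations gives a local solution of the evolution equation. -/
theorem isLocalSolution : IsLocalSolution τ fun t => eulPert (u t) := by
  have hc := exp_pos (-(3 * τ))
  have hF : ContinuousOn (fun t => lagField (u t)) (Ioo (-τ) τ) :=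
    bddLip_lagField.continuous.comp_continuousOn h.continuousOn
  have hDX : ContinuousOn (fun t => lagDX (u t)) (Ioo (-τ) τ) :=
    integ.continuous.comp_continuousOn hF.fst
  have hDZ : ContinuousOn (fun t => lagDZ (u t)) (Ioo (-τ) τ) :=
    (constCLM.continuous.comp_continuousOn hF.snd.snd).add (integ.continuous.comp_continuousOn
      ((hF.snd.fst.mul h.continuousOn.fst).add (h.continuousOn.snd.fst.mul hF.fst)))
  refine isLocalSolution_perExt (c := fun t => (u t).2.2) (g := fun t => eulSlope (u t))
    (W := fun t x => lagDZ (u t) (label (u t) x) - lagDX (u t) (label (u t) x) * eulSlope (u t) x)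
    h.continuousOn.snd.snd h.continuousOn_eulSlope
    (fun t ht => continuous_eulSlope hc (h.exp_le_J ht))
    (fun t ht => integral_eulSlope hc (h.exp_le_J ht) (h.lagX_two_pi ht) (h.integ_mul_two_pi ht))
    ((h.continuousOn_comp_label hDZ).sub ((h.continuousOn_comp_label hDX).mul
      h.continuousOn_eulSlope))
    (fun t ht x hx => h.hasDerivAt_pert ht hx) fun t ht x hx => ?_
  have hJ := h.exp_le_J ht
  have h2 := h.lagX_two_pi ht
  have hx' := Ioo_subset_Icc_self hx
  have hI : ∀ F : ℝ →ᵇ ℝ, ∀ y ∈ Icc 0 (2 * π), ∫ y in (0)..y, F (label (u t) y)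
      = integ (F * (u t).1) (label (u t) y) := fun F y hy => integral_comp_label hc hJ h2 F hy
  have hlz : ∀ y ∈ Icc 0 (2 * π), (u t).2.2 + ∫ w in (0)..y, eulSlope (u t) w
      = lagZ (u t) (label (u t) y) := fun y hy => lagZ_label hc hJ h2 hy
  set ξ := label (u t) x with hξ
  have e1 : ∫ y in (0)..(2 * π), (y - π) * eulSlope (u t) y ^ 2
      = integ ((lagX (u t) - BoundedContinuousFunction.const ℝ π) * ((u t).2.1 * (u t).2.1)
        * (u t).1) (2 * π) := by
    rw [← label_two_pi hc hJ h2, ← hI _ _ (right_mem_Icc.2 two_pi_pos.le), label_two_pi hc hJ h2]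
    refine intervalIntegral.integral_congr fun y hy => ?_
    rw [uIcc_of_le two_pi_pos.le] at hy
    simp only [BoundedContinuousFunction.coe_mul, BoundedContinuousFunction.coe_sub, Pi.mul_apply,
      Pi.sub_apply, BoundedContinuousFunction.const_apply, lagX_label hc hJ h2 hy, eulSlope]
    ring
  have e2 : ∀ y ∈ Icc 0 (2 * π), ∫ w in (0)..y, (1 / 2 * ((u t).2.2
      + ∫ v in (0)..w, eulSlope (u t) v) + eulSlope (u t) w ^ 2)
      = integ (((1 / 2 : ℝ) • lagZ (u t) + (u t).2.1 * (u t).2.1) * (u t).1) (label (u t) y) := by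
    intro y hy
    rw [← hI _ _ hy]
    refine intervalIntegral.integral_congr fun w hw => ?_
    rw [uIcc_of_le hy.1] at hw
    have h3 : eulSlope (u t) w = (u t).2.1 (label (u t) w) := rfl
    simp only [BoundedContinuousFunction.coe_mul,
      BoundedContinuousFunction.coe_add, Pi.mul_apply, Pi.add_apply,
      BoundedContinuousFunction.coe_smul, smul_eq_mul]
    rw [hlz w ⟨hw.1, hw.2.trans hy.2⟩, h3]
    ring
  have e3 : (2 * π)⁻¹ * ∫ w in (0)..(2 * π), (1 / 2 * ((u t).2.2
      + ∫ v in (0)..w, eulSlope (u t) v) + eulSlope (u t) w ^ 2) = lagM (u t) := by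
    rw [e2 _ (right_mem_Icc.2 two_pi_pos.le), label_two_pi hc hJ h2]; rfl
  have hcs := continuous_eulSlope hc hJ
  have hcont : Continuous fun w => 1 / 2 * ((u t).2.2
      + ∫ v in (0)..w, eulSlope (u t) v) + eulSlope (u t) w ^ 2 :=
    ((continuous_primitive hcs _).const_mul _).add (hcs.pow 2)
  have hDx := lagX_two_smul (u t) ξ
  have hDz := lagDZ_two_smul (u t) ξ
  rw [lagX_label hc hJ h2 hx'] at hDx
  have hx3 := hlz x hx'
  simp only [e3]
  rw [intervalIntegral.integral_sub (hcont.intervalIntegrable _ _) intervalIntegrable_const,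
    intervalIntegral.integral_const, smul_eq_mul, e2 x hx', e1]
  rw [map_sub, map_smul] at hDz
  simp only [BoundedContinuousFunction.coe_sub, Pi.sub_apply, BoundedContinuousFunction.coe_smul,
    smul_eq_mul] at hDz
  have hX : integ (u t).1 ξ = x := lagX_label hc hJ h2 hx'
  rw [hX] at hDz
  rw [← hx3] at hDx
  -- The time derivative at a fixed point is the derivative along the flow minus velocity times
  -- slope.
  linear_combination hDz - eulSlope (u t) x * hDx

end IsLagSol

/-! ### Norms and uniqueness in Eulerian coordinates -/

theorem eLpNorm_two_sq {g : ℝ → ℝ} (hg : MemLp g 2 per) :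
    eLpNorm g 2 per ^ 2 = ENNReal.ofReal (∫ x, g x ^ 2 ∂per) := by
  rw [hg.eLpNorm_eq_integral_rpow_norm two_ne_zero ENNReal.ofNat_ne_top,
    ← ENNReal.ofReal_pow (by positivity)]
  congr 1
  have h1 : ∀ x, ‖g x‖ ^ (ENNReal.toReal 2) = g x ^ 2 := fun x => by
    rw [ENNReal.toReal_ofNat, Real.rpow_ofNat, Real.norm_eq_abs, sq_abs]
  simp only [h1]
  have h2 : 0 ≤ ∫ x, g x ^ 2 ∂per := integral_nonneg fun x => sq_nonneg _
  rw [ENNReal.toReal_ofNat, ← Real.rpow_natCast, ← Real.rpow_mul h2]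
  norm_num

theorem lagZ_clamp (u : LagState) (ξ : ℝ) : lagZ u (clamp ξ) = lagZ u ξ := by
  simp only [lagZ, BoundedContinuousFunction.coe_add, Pi.add_apply,
    BoundedContinuousFunction.const_apply, integ_apply, clamp_of_mem (clamp_mem ξ)]

section Flow

variable {u : LagState} {c : ℝ} (hc : 0 < c) (hJ : ∀ ξ, c ≤ u.1 ξ)
  (h2 : lagX u (2 * π) = 2 * π)
include hc hJ h2

theorem flow_mem {ξ : ℝ} (hξ : ξ ∈ Icc 0 (2 * π)) : flow u ξ ∈ Icc 0 (2 * π) := by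
  have hm := (strictMono_flow hc hJ).monotone
  have h3 := hm hξ.1
  have h4 := hm hξ.2
  rw [flow_zero] at h3
  rw [flow_eq_lagX u (right_mem_Icc.2 two_pi_pos.le), h2] at h4
  exact ⟨h3, h4⟩

/-- For a continuous function the essential supremum is a supremum, and the flow takes every clamped
label to a position in the period. No part of the sup norm of `F` is lost. -/
theorem eLpNorm_top_comp_label {F : ℝ →ᵇ ℝ} (hF : ∀ ξ, F (clamp ξ) = F ξ) {f : ℝ → ℝ}
    (hf : f =ᵐ[per] fun x => F (label u x)) : eLpNorm f ⊤ per = ENNReal.ofReal ‖F‖ := by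
  rw [eLpNorm_congr_ae hf]
  have hle : eLpNorm (fun x => F (label u x)) ⊤ per ≤ ENNReal.ofReal ‖F‖ :=
    eLpNorm_top_le_of_ae (ae_of_all _ fun x => F.norm_coe_le_norm _)
  refine le_antisymm hle ?_
  have hfin := ne_top_of_le_ne_top ENNReal.ofReal_ne_top hle
  rw [← ENNReal.ofReal_toReal hfin]
  refine ENNReal.ofReal_le_ofReal ((BoundedContinuousFunction.norm_le ENNReal.toReal_nonneg).2
    fun ξ => ?_)
  have h3 := ae_abs_le_of_eLpNorm_top_le ENNReal.toReal_nonneg (ENNReal.ofReal_toReal hfin).ge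
  have h4 := abs_le_on_Icc_of_ae (F.continuous.comp (continuous_label hc hJ)).continuousOn h3
    (flow u (clamp ξ)) (flow_mem hc hJ h2 (clamp_mem ξ))
  simp only [Function.comp, label_flow hc hJ, hF] at h4
  exact h4

variable (h3 : integ (u.2.1 * u.1) (2 * π) = 0)
include h3

theorem eulPert_eq_lagZ {x : ℝ} (hx : x ∈ Icc 0 (2 * π)) : eulPert u x = lagZ u (label u x) := by
  rw [eulPert_of_mem hc hJ h2 h3 hx, lagZ_label hc hJ h2 hx]

theorem eulPert_zero : eulPert u 0 = u.2.2 := by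
  rw [eulPert_of_mem hc hJ h2 h3 ⟨le_rfl, two_pi_pos.le⟩, intervalIntegral.integral_same, add_zero]

theorem eulPert_ae_eq : eulPert u =ᵐ[per] fun x => lagZ u (label u x) :=
  ae_per_of_forall fun _ hx => eulPert_eq_lagZ hc hJ h2 h3 (Ioo_subset_Icc_self hx)

theorem weakDeriv_eulPert : weakDeriv (eulPert u) =ᵐ[per] eulSlope u :=
  weakDeriv_perExt (continuous_eulSlope hc hJ) (integral_eulSlope hc hJ h2 h3) _

theorem memH1per_eulPert : MemH1per (eulPert u) :=
  memH1per_perExt (continuous_eulSlope hc hJ) (integral_eulSlope hc hJ h2 h3) _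

theorem memW1inf_eulPert : MemW1inf (eulPert u) :=
  memW1inf_perExt (continuous_eulSlope hc hJ) (integral_eulSlope hc hJ h2 h3) _

theorem normW1inf_eulPert (hq : ∀ ξ, u.2.1 (clamp ξ) = u.2.1 ξ) :
    normW1inf (eulPert u) = ENNReal.ofReal (‖lagZ u‖ + ‖u.2.1‖) := by
  rw [normW1inf, eLpNorm_top_comp_label hc hJ h2 (lagZ_clamp u) (eulPert_ae_eq hc hJ h2 h3),
    eLpNorm_top_comp_label hc hJ h2 hq (weakDeriv_eulPert hc hJ h2 h3),
    ENNReal.ofReal_add (norm_nonneg _) (norm_nonneg _)]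

theorem integral_weakDeriv_sq : ∫ x, weakDeriv (eulPert u) x ^ 2 ∂per = lagEnergy u := by
  have e : ∫ x, weakDeriv (eulPert u) x ^ 2 ∂per = ∫ x, eulSlope u x ^ 2 ∂per :=
    integral_congr_ae ((weakDeriv_eulPert hc hJ h2 h3).fun_comp (· ^ 2))
  rw [e, integral_per]
  have := integral_comp_label hc hJ h2 (u.2.1 * u.2.1) (right_mem_Icc.2 two_pi_pos.le)
  rw [label_two_pi hc hJ h2] at this
  rw [lagEnergy, ← this]
  refine intervalIntegral.integral_congr fun x _ => ?_
  simp only [eulSlope, BoundedContinuousFunction.coe_mul, Pi.mul_apply]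
  ring

theorem integral_constraint : ∫ x, (eulPert u x + 2 * weakDeriv (eulPert u) x ^ 2) ∂per
    = integ (lagZ u * u.1) (2 * π) + 2 * lagEnergy u := by
  have hm := memH1per_eulPert hc hJ h2 h3
  have hw : MemLp (weakDeriv (eulPert u)) 2 per :=
    (memLp_congr_ae (weakDeriv_eulPert hc hJ h2 h3)).2
      (memLp_per_of_continuous (continuous_eulSlope hc hJ) 2)
  have hi : Integrable (eulPert u) per := hm.2.2.1.integrable one_le_two
  rw [integral_add hi (hw.integrable_sq.const_mul 2), integral_const_mul,
    integral_weakDeriv_sq hc hJ h2 h3, integral_congr_ae (eulPert_ae_eq hc hJ h2 h3), integral_per]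
  rw [integral_comp_label hc hJ h2 _ (right_mem_Icc.2 two_pi_pos.le), label_two_pi hc hJ h2]

theorem normH1_eulPert_le {d : ℝ} (hd : 0 ≤ d) (h : 2 * π * ‖lagZ u‖ ^ 2 + lagEnergy u ≤ d ^ 2) :
    normH1 (eulPert u) ≤ ENNReal.ofReal d := by
  have hm := memH1per_eulPert hc hJ h2 h3
  have hw : MemLp (weakDeriv (eulPert u)) 2 per :=
    (memLp_congr_ae (weakDeriv_eulPert hc hJ h2 h3)).2
      (memLp_per_of_continuous (continuous_eulSlope hc hJ) 2)
  have h4 : ∫ x, eulPert u x ^ 2 ∂per ≤ 2 * π * ‖lagZ u‖ ^ 2 := by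
    refine (le_abs_self _).trans (?_ : _ ≤ 2 * π * ‖lagZ u‖ ^ 2)
    have h8 : ∀ᵐ x ∂per, |eulPert u x ^ 2| ≤ ‖lagZ u‖ ^ 2 := by
      filter_upwards [eulPert_ae_eq hc hJ h2 h3] with x hx
      rw [abs_of_nonneg (sq_nonneg _), hx, ← sq_abs]
      exact pow_le_pow_left₀ (abs_nonneg _) ((lagZ u).norm_coe_le_norm _) 2
    have h9 := abs_integral_le_of_ae_per h8 ⟨le_rfl, two_pi_pos.le⟩ ⟨two_pi_pos.le, le_rfl⟩
    rwa [sub_zero, abs_of_pos two_pi_pos, mul_comm (‖lagZ u‖ ^ 2), ← integral_per] at h9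
  have h5 : 0 ≤ ∫ x, eulPert u x ^ 2 ∂per := integral_nonneg fun x => sq_nonneg _
  have h6 : 0 ≤ ∫ x, weakDeriv (eulPert u) x ^ 2 ∂per := integral_nonneg fun x => sq_nonneg _
  have h7 := integral_weakDeriv_sq hc hJ h2 h3
  rw [normH1, eLpNorm_two_sq hm.2.2.1, eLpNorm_two_sq hw, ← ENNReal.ofReal_add h5 h6]
  refine (ENNReal.rpow_le_rpow (ENNReal.ofReal_le_ofReal (by linarith :
    _ ≤ d ^ 2)) (by norm_num)).trans ?_
  rw [ENNReal.ofReal_rpow_of_nonneg (sq_nonneg d) (by norm_num), ← Real.sqrt_eq_rpow,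
    Real.sqrt_sq hd]

theorem hasDerivAt_eulPert {x : ℝ} (hx : x ∈ Ioo 0 (2 * π)) :
    HasDerivAt (eulPert u) (eulSlope u x) x := by
  refine ((hasDerivAt_integral_zero (continuous_eulSlope hc hJ) x).const_add
    u.2.2).congr_of_eventuallyEq ?_
  filter_upwards [isOpen_Ioo.mem_nhds hx] with y hy
  exact eulPert_of_mem hc hJ h2 h3 (Ioo_subset_Icc_self hy)

/-- The transport speed is positive if the slope is small where this matters. -/
theorem le_speed_eulPert (hup : ∀ ξ, u.2.1 ξ ≤ π / 16)
    (hlow : ∀ ξ, π ≤ lagX u ξ → -(π / 16) ≤ u.2.1 ξ) {x : ℝ} (hx : x ∈ Icc 0 (2 * π)) :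
    π / 8 * min x (2 * π - x) ≤ speed (eulPert u) x := by
  have hs := continuous_eulSlope hc hJ
  have hp := pi_pos
  rw [speed_eq hx, eulPert_zero hc hJ h2 h3, eulPert_of_mem hc hJ h2 h3 hx, add_sub_cancel_left]
  -- The perturbation is integrated from the nearer copy of the peak. The unperturbed speed is at
  -- least π/4 times the distance, and slopes of size π/16, doubled, use up half of it. An upper
  -- bound on the slope is needed on the left, a lower bound on the right.
  rcases le_total x π with hxπ | hxπ
  · have h4 : ∫ y in (0)..x, eulSlope u y ≤ ∫ y in (0)..x, π / 16 :=
      intervalIntegral.integral_mono_on hx.1 (hs.intervalIntegrable _ _)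
        intervalIntegrable_const fun y _ => hup _
    rw [intervalIntegral.integral_const, smul_eq_mul, sub_zero] at h4
    have h5 := min_le_left x (2 * π - x)
    nlinarith [hx.1]
  · have h4 : ∫ y in x..(2 * π), -(π / 16) ≤ ∫ y in x..(2 * π), eulSlope u y :=
      intervalIntegral.integral_mono_on hx.2 intervalIntegrable_const (hs.intervalIntegrable _ _)
        fun y hy => hlow _ (by
          rw [lagX_label hc hJ h2 ⟨hx.1.trans hy.1, hy.2⟩]
          exact hxπ.trans hy.1)
    rw [intervalIntegral.integral_const, smul_eq_mul] at h4
    have h6 := intervalIntegral.integral_add_adjacent_intervals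
      (hs.intervalIntegrable (μ := volume) 0 x) (hs.intervalIntegrable x (2 * π))
    rw [integral_eulSlope hc hJ h2 h3] at h6
    have h5 := min_le_right x (2 * π - x)
    have h7 : 0 ≤ 2 * π - x := by linarith [hx.2]
    nlinarith

end Flow

namespace IsLagSol

variable {τ : ℝ} {u : ℝ → LagState} (h : IsLagSol τ u)
include h

theorem unique {L : ℝ} (hL : ∀ ξ η, |(u 0).2.1 ξ - (u 0).2.1 η| ≤ L * |clamp ξ - clamp η|)
    (hup : ∀ t ∈ Ioo (-τ) τ, ∀ ξ, (u t).2.1 ξ ≤ π / 16)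
    (hlow : ∀ t ∈ Ioo (-τ) τ, ∀ ξ, π ≤ lagX (u t) ξ → -(π / 16) ≤ (u t).2.1 ξ)
    {τ' : ℝ} (hτ' : 0 < τ') {ζ : ℝ → ℝ → ℝ} (hζ : IsLocalSolution τ' ζ) (h0 : ζ 0 = eulPert (u 0))
    {t : ℝ} (ht : |t| < τ) (ht' : |t| < τ') : ζ t = eulPert (u t) := by
  have hc := exp_pos (-(3 * τ))
  set K := (L + 4 * exp (3 * τ) * τ) * exp (6 * τ) with hK
  have hKn : 0 ≤ K := by
    have h1 := (abs_nonneg _).trans (hL 1 0)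
    have h2 : (0 : ℝ) < |clamp 1 - clamp 0| := by
      rw [clamp_of_mem ⟨zero_le_one, by linarith [pi_gt_three]⟩, clamp_of_mem ⟨le_rfl, two_pi_pos.le⟩]
      norm_num
    have h3 : 0 ≤ L := nonneg_of_mul_nonneg_left h1 h2
    have := h.pos
    positivity
  refine IsLocalSolution.unique (g := fun t => eulSlope (u t))
    (L := max 2 (K * (exp (-(3 * τ)))⁻¹)) h.isLocalSolution hζ h.pos hτ'
    (fun s hs => ⟨π / 8, by positivity, fun x hx => le_speed_eulPert hc (h.exp_le_J hs)
      (h.lagX_two_pi hs) (h.integ_mul_two_pi hs) (hup s hs) (hlow s hs) hx⟩)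
    (fun s hs x hx => hasDerivAt_eulPert hc (h.exp_le_J hs)
      (h.lagX_two_pi hs) (h.integ_mul_two_pi hs) hx)
    (fun s hs x _ => (h.abs_q_le hs _).trans (le_max_left _ _)) ?_ h0 ht ht'
  intro s hs x _ y _
  have h1 := h.abs_q_sub_le hL hs (label (u s) x) (label (u s) y)
  have h2 := mul_abs_label_sub_le hc (h.exp_le_J hs) x y
  have h3 := abs_clamp_sub_le (label (u s) x) (label (u s) y)
  rw [mul_comm, ← le_div_iff₀ hc, div_eq_inv_mul] at h2
  refine h1.trans ((mul_le_mul_of_nonneg_left (h3.trans h2) hKn).trans ?_)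
  rw [← mul_assoc]
  exact mul_le_mul_of_nonneg_right (le_max_right _ _) (abs_nonneg _)

end IsLagSol

/-! ### Initial data -/

/-- A profile which is concentrated at the origin: `ξ ↦ (1 - ξ / 2π) ^ n` on the period. -/
noncomputable def spike (n : ℕ) : ℝ →ᵇ ℝ :=
  BoundedContinuousFunction.ofNormedAddCommGroup (fun ξ => (1 - clamp ξ / (2 * π)) ^ n)
    (((continuous_const.sub (continuous_clamp.div_const _))).pow n) 1 fun ξ => by
      have h := clamp_mem ξ
      have h1 : clamp ξ / (2 * π) ≤ 1 := (div_le_one two_pi_pos).2 h.2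
      have h2 : 0 ≤ clamp ξ / (2 * π) := div_nonneg h.1 two_pi_pos.le
      rw [norm_pow]
      exact pow_le_one₀ (norm_nonneg _) (abs_le.2 ⟨by linarith, by linarith⟩)

theorem spike_apply (n : ℕ) (ξ : ℝ) : spike n ξ = (1 - clamp ξ / (2 * π)) ^ n := rfl

theorem one_sub_clamp_mem (ξ : ℝ) : 1 - clamp ξ / (2 * π) ∈ Icc (0 : ℝ) 1 := by
  have h := clamp_mem ξ
  have h1 : clamp ξ / (2 * π) ≤ 1 := (div_le_one two_pi_pos).2 h.2
  have h2 : 0 ≤ clamp ξ / (2 * π) := div_nonneg h.1 two_pi_pos.le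
  exact ⟨by linarith, by linarith⟩

theorem spike_mem (n : ℕ) (ξ : ℝ) : spike n ξ ∈ Icc (0 : ℝ) 1 :=
  ⟨pow_nonneg (one_sub_clamp_mem ξ).1 n,
    pow_le_one₀ (one_sub_clamp_mem ξ).1 (one_sub_clamp_mem ξ).2⟩

theorem abs_spike_sub_le (n : ℕ) (ξ η : ℝ) :
    |spike n ξ - spike n η| ≤ n * |clamp ξ - clamp η| := by
  have h1 := one_sub_clamp_mem ξ
  have h2 := one_sub_clamp_mem η
  have h3 := abs_pow_sub_pow_le (1 - clamp ξ / (2 * π)) (1 - clamp η / (2 * π)) n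
  rw [abs_of_nonneg h1.1, abs_of_nonneg h2.1] at h3
  have h4 : max (1 - clamp ξ / (2 * π)) (1 - clamp η / (2 * π)) ^ (n - 1) ≤ 1 :=
    pow_le_one₀ (h1.1.trans (le_max_left _ _)) (max_le h1.2 h2.2)
  have h5 : |1 - clamp ξ / (2 * π) - (1 - clamp η / (2 * π))| ≤ |clamp ξ - clamp η| := by
    have : 1 - clamp ξ / (2 * π) - (1 - clamp η / (2 * π)) = (clamp η - clamp ξ) / (2 * π) := by
      ring
    rw [this, abs_div, abs_of_pos two_pi_pos, abs_sub_comm]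
    exact div_le_self (abs_nonneg _) (by linarith [pi_gt_three])
  rw [spike_apply, spike_apply, mul_comm (n : ℝ)]
  refine h3.trans ((mul_le_of_le_one_right (by positivity) h4).trans ?_)
  exact mul_le_mul_of_nonneg_right h5 (Nat.cast_nonneg n)

theorem integ_spike (n : ℕ) : integ (spike n) (2 * π) = 2 * π / (n + 1) := by
  have hp := two_pi_pos.ne'
  have hn : (n : ℝ) + 1 ≠ 0 := by positivity
  have hd : ∀ y : ℝ, HasDerivAt (fun y : ℝ => -(2 * π / (n + 1)) * (1 - y / (2 * π)) ^ (n + 1))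
      ((1 - y / (2 * π)) ^ n) y := by
    intro y
    refine (((((hasDerivAt_id y).div_const (2 * π)).const_sub 1).fun_pow (n + 1)).const_mul
      (-(2 * π / (n + 1)))).congr_deriv ?_
    simp only [Nat.cast_add, Nat.cast_one, add_tsub_cancel_right, id]
    field_simp
  have h1 : ∫ y in (0)..(2 * π), spike n y = ∫ y in (0)..(2 * π), (1 - y / (2 * π)) ^ n := by
    refine intervalIntegral.integral_congr fun y hy => ?_
    rw [uIcc_of_le two_pi_pos.le] at hy
    simp only [spike_apply, clamp_of_mem hy]
  rw [integ_two_pi, h1, intervalIntegral.integral_eq_sub_of_hasDerivAt (fun y _ => hd y)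
    ((by fun_prop : Continuous fun y : ℝ => (1 - y / (2 * π)) ^ n).intervalIntegrable _ _)]
  rw [div_self hp]
  simp

theorem integ_const (c : ℝ) : integ (BoundedContinuousFunction.const ℝ c) (2 * π) = 2 * π * c := by
  rw [integ_two_pi]; simp

/-- Small initial slopes with a prescribed negative value at the peak. -/
theorem exists_slope_profile {a β η x₀ : ℝ} (ha : 0 < a) (ha1 : a ≤ 1) (hβ : 0 < β) (hη : 0 < η)
    (hx₀ : 0 < x₀) (hx₀' : x₀ ≤ 2 * π) :
    ∃ q : ℝ →ᵇ ℝ, (∃ L : ℝ, ∀ ξ η, |q ξ - q η| ≤ L * |clamp ξ - clamp η|) ∧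
      integ q (2 * π) = 0 ∧ q 0 ≤ -(a / 2) ∧ (∀ ξ, q ξ ≤ β) ∧ (∀ ξ, |q ξ| ≤ a) ∧
      (∀ ξ, x₀ ≤ clamp ξ → |q ξ| ≤ β) ∧ integ (q * q) (2 * π) ≤ η ∧ ∀ ξ, |integ q ξ| ≤ η := by
  have hr0 : 0 ≤ 1 - x₀ / (2 * π) := by
    have := (div_le_one two_pi_pos).2 hx₀'; linarith
  have hr1 : 1 - x₀ / (2 * π) < 1 := by
    have := div_pos hx₀ two_pi_pos; linarith
  have t1 := tendsto_one_div_add_atTop_nhds_zero_nat (𝕜 := ℝ)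
  have t2 := tendsto_pow_atTop_nhds_zero_of_lt_one hr0 hr1
  obtain ⟨n, h1, h2, h3, hn⟩ := ((t1.eventually_le_const hβ).and ((t2.eventually_le_const hβ).and
    ((t1.eventually_le_const (by positivity : 0 < η / (4 * π))).and
      (eventually_ge_atTop 1)))).exists
  -- `m` is the mean of the spike, so a(m - spike) has mean zero. Its value at the peak is a(m - 1)
  -- ≤ -a/2 because m ≤ 1/2, and its positive part is at most am ≤ β.
  set m : ℝ := 1 / ((n : ℝ) + 1) with hm
  have hm0 : 0 < m := by positivity
  have hm1 : m ≤ 1 / 2 := by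
    have : (1 : ℝ) ≤ n := by exact_mod_cast hn
    rw [hm]; exact one_div_le_one_div_of_le two_pos (by linarith)
  set q : ℝ →ᵇ ℝ := a • (BoundedContinuousFunction.const ℝ m - spike n) with hq
  have hqv : ∀ ξ, q ξ = a * (m - spike n ξ) := fun ξ => rfl
  have hqa : ∀ ξ, |q ξ| ≤ a * (m + spike n ξ) := by
    intro ξ
    rw [hqv, abs_mul, abs_of_pos ha]
    refine mul_le_mul_of_nonneg_left (abs_le.2 ⟨?_, ?_⟩) ha.le <;> linarith [(spike_mem n ξ).1]
  have hqa1 : ∀ ξ, |q ξ| ≤ a := by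
    intro ξ
    rw [hqv, abs_mul, abs_of_pos ha]
    refine mul_le_of_le_one_right ha.le (abs_le.2 ⟨?_, ?_⟩) <;>
      linarith [(spike_mem n ξ).1, (spike_mem n ξ).2]
  -- A majorant of |q| with integral 4πm. As |q| ≤ 1, it also dominates q², so one smallness
  -- condition on `m` controls the energy and the primitive together.
  set G : ℝ →ᵇ ℝ := BoundedContinuousFunction.const ℝ m + spike n with hG
  have hGv : ∀ ξ, G ξ = m + spike n ξ := fun ξ => rfl
  have hGi : integ G (2 * π) ≤ η := by
    rw [hG, map_add, BoundedContinuousFunction.coe_add, Pi.add_apply, integ_const, integ_spike]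
    have : 2 * π * m + 2 * π / (n + 1) = m * (4 * π) := by rw [hm]; ring
    rw [this]
    exact (le_div_iff₀ (by positivity)).1 h3
  have hqG : ∀ ξ, |q ξ| ≤ G ξ := fun ξ => by
    refine (hqa ξ).trans ?_
    rw [hGv]
    exact mul_le_of_le_one_left (by linarith [(spike_mem n ξ).1]) ha1
  refine ⟨q, ⟨a * n, fun ξ ζ => ?_⟩, ?_, ?_, fun ξ => ?_, hqa1, fun ξ hξ => ?_, ?_, fun ξ => ?_⟩
  · have : q ξ - q ζ = -(a * (spike n ξ - spike n ζ)) := by rw [hqv, hqv]; ring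
    rw [this, abs_neg, abs_mul, abs_of_pos ha, mul_assoc]
    exact mul_le_mul_of_nonneg_left (abs_spike_sub_le n ξ ζ) ha.le
  · rw [hq, map_smul, map_sub]
    simp only [BoundedContinuousFunction.coe_smul, BoundedContinuousFunction.coe_sub, Pi.sub_apply,
      integ_const, integ_spike, hm, smul_eq_mul]
    ring
  · rw [hqv, spike_apply, clamp_of_mem ⟨le_rfl, two_pi_pos.le⟩, zero_div, sub_zero, one_pow]
    nlinarith
  · rw [hqv]
    have := (spike_mem n ξ).1
    nlinarith
  · have hs : spike n ξ ≤ β := by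
      refine le_trans ?_ h2
      rw [spike_apply]
      refine pow_le_pow_left₀ (one_sub_clamp_mem ξ).1 ?_ n
      have := div_le_div_of_nonneg_right hξ two_pi_pos.le
      linarith
    have hs0 := (spike_mem n ξ).1
    rw [hqv, abs_mul, abs_of_pos ha]
    refine (mul_le_of_le_one_left (abs_nonneg _) ha1).trans (abs_le.2 ⟨?_, ?_⟩) <;> linarith
  · refine (integ_le_integ (fun ξ => ?_) _).trans hGi
    refine le_trans ?_ (hqG ξ)
    simp only [BoundedContinuousFunction.coe_mul, Pi.mul_apply]
    rw [← abs_mul_abs_self]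
    exact mul_le_of_le_one_left (abs_nonneg _) ((hqa1 ξ).trans ha1)
  · exact (abs_integ_le hqG ξ).trans hGi

/-! ### Exit times -/

theorem exists_exit_time {ψ : ℝ → ℝ} {T : ℝ} (hT : 0 < T) (hψ : ContinuousOn ψ (Icc 0 T))
    (h0 : ψ 0 < 0) : ∃ τ, 0 < τ ∧ τ ≤ T ∧ (∀ t ∈ Ico 0 τ, ψ t < 0) ∧ (τ = T ∨ 0 ≤ ψ τ) := by
  rcases (Icc 0 T ∩ ψ ⁻¹' Ici 0).eq_empty_or_nonempty with hS | hS
  · refine ⟨T, hT, le_rfl, fun t ht => ?_, Or.inl rfl⟩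
    by_contra hcon
    exact (hS ▸ ⟨Ico_subset_Icc_self ht, not_lt.1 hcon⟩ : t ∈ (∅ : Set ℝ))
  · have hc : IsCompact (Icc 0 T ∩ ψ ⁻¹' Ici 0) :=
      isCompact_Icc.of_isClosed_subset (hψ.preimage_isClosed_of_isClosed isClosed_Icc isClosed_Ici)
        inter_subset_left
    obtain ⟨τ, hτ, hmin⟩ := hc.exists_isLeast hS
    refine ⟨τ, lt_of_le_of_ne hτ.1.1 fun h => ?_, hτ.1.2, fun t ht => ?_, Or.inr hτ.2⟩
    · have := hτ.2
      rw [← h] at this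
      exact absurd h0 (not_lt.2 this)
    · by_contra hcon
      exact absurd ht.2 (not_lt.2 (hmin ⟨⟨ht.1, ht.2.le.trans hτ.1.2⟩, not_lt.1 hcon⟩))

theorem le_on_Icc_of_le_on_Ioo {f g : ℝ → ℝ} {a b : ℝ} (hab : a < b) (hf : ContinuousOn f (Icc a b))
    (hg : ContinuousOn g (Icc a b)) (h : ∀ t ∈ Ioo a b, f t ≤ g t) : ∀ t ∈ Icc a b, f t ≤ g t := by
  intro t ht
  rw [← closure_Ioo hab.ne] at hf hg ht
  exact le_on_closure h hf hg ht

/-- Initial data with small energy whose slope is small except near the peak. -/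
structure IsSmallDatum (T a ε : ℝ) (v : LagState) : Prop where
  pos_ε : 0 < ε
  pos_a : 0 < a
  a_le : a ≤ 1 / 4
  ε_le : 4 * ε ≤ a / 4
  small : (ε + 4 * ε * T) * exp (2 * T) ≤ 1 / 8
  energy : lagEnergy v * exp T ≤ ε ^ 2
  z0_le : |v.2.2| + lagEnergy v * exp T * (T * exp T) ≤ 1
  init_J : v.1 = 1
  init_q : integ v.2.1 (2 * π) = 0
  q_zero : v.2.1 0 ≤ -(a / 2)
  q_le : ∀ ξ, v.2.1 ξ ≤ ε
  q_abs_le : ∀ ξ, |v.2.1 ξ| ≤ a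
  q_far : ∀ ξ, π * exp (-(3 * T)) ≤ clamp ξ → |v.2.1 ξ| ≤ ε

theorem IsSmallDatum.growth_le {T a ε : ℝ} {v : LagState} (hd : IsSmallDatum T a ε v) {t : ℝ}
    (ht : |t| ≤ T) : (ε + 4 * ε * |t|) * exp (2 * |t|) ≤ 1 / 8 := by
  have hε := hd.pos_ε
  refine le_trans (mul_le_mul ?_ (exp_le_exp.2 (by linarith)) (exp_pos _).le ?_) hd.small
  · have := mul_le_mul_of_nonneg_left ht (by linarith : 0 ≤ 4 * ε)
    linarith
  · have := (abs_nonneg t).trans ht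
    positivity

/-! ### A priori bounds for solutions from small data -/

namespace IsLagSol

variable {τ : ℝ} {u : ℝ → LagState} (h : IsLagSol τ u)
include h

theorem norm_J_le {T : ℝ} (hT : τ ≤ T) {t : ℝ} (ht : t ∈ Ioo (-τ) τ) :
    ‖(u t).1‖ ≤ exp (3 * T) := by
  refine (BoundedContinuousFunction.norm_le (exp_pos _).le).2 fun x => ?_
  rw [Real.norm_eq_abs, abs_of_pos (h.J_pos ht x)]
  exact (h.J_le ht x).trans (exp_le_exp.2 (by linarith [abs_lt.2 ht]))

theorem lagX_le {T : ℝ} (hT : τ ≤ T) {t : ℝ} (ht : t ∈ Ioo (-τ) τ) (ξ : ℝ) :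
    lagX (u t) ξ ≤ exp (3 * T) * clamp ξ := by
  have h1 := abs_integ_sub_le (u t).1 ξ 0
  rw [integ_zero, sub_zero, clamp_of_mem ⟨le_rfl, two_pi_pos.le⟩, sub_zero,
    abs_of_nonneg (clamp_mem ξ).1] at h1
  exact (le_abs_self _).trans (h1.trans
    (mul_le_mul_of_nonneg_right (h.norm_J_le hT ht) (clamp_mem ξ).1))

variable {T a ε : ℝ} (hd : IsSmallDatum T a ε (u 0)) (hT : τ ≤ T)
include hd hT

theorem abs_forcing_le_of_small {t : ℝ} (ht : t ∈ Ioo (-τ) τ) (ξ : ℝ) :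
    |lagZ (u t) ξ / 2 - lagM (u t)| ≤ 4 * ε := by
  refine h.abs_forcing_le ht hd.pos_ε (by linarith [hd.ε_le, hd.a_le]) ?_ ξ
  refine (h.energy_le ht).trans (le_trans ?_ hd.energy)
  exact mul_le_mul_of_nonneg_left (exp_le_exp.2 ((abs_lt.2 ht).le.trans hT))
    (h.energy_nonneg h.zero_mem)

theorem q_le_of_small {t : ℝ} (ht : t ∈ Ioo (-τ) τ) (ξ : ℝ) : (u t).2.1 ξ ≤ 1 / 8 :=
  (h.q_le_exp (fun s hs x => h.abs_forcing_le_of_small hd hT hs x) ht (by linarith [hd.pos_ε])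
    hd.pos_ε.le ξ (hd.q_le ξ)).trans (hd.growth_le ((abs_lt.2 ht).le.trans hT))

theorem abs_q_le_of_far {t : ℝ} (ht : t ∈ Ioo (-τ) τ) {ξ : ℝ}
    (hξ : π * exp (-(3 * T)) ≤ clamp ξ) : |(u t).2.1 ξ| ≤ 1 / 8 := by
  have h1 := h.abs_q_le_exp (fun s hs x => h.abs_forcing_le_of_small hd hT hs x) h.zero_mem ht
    (by linarith [hd.pos_ε]) ξ
  rw [sub_zero] at h1
  refine h1.trans (le_trans ?_ (hd.growth_le ((abs_lt.2 ht).le.trans hT)))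
  exact mul_le_mul_of_nonneg_right (add_le_add_left (hd.q_far ξ hξ) _) (exp_pos _).le

/-- Positions are at most e^{3T} times the label, so a particle found in the right half of the
period carries a label beyond π e^{-3T}, where the initial slope is at most ε. -/
theorem le_q_of_pi_le {t : ℝ} (ht : t ∈ Ioo (-τ) τ) {ξ : ℝ} (hξ : π ≤ lagX (u t) ξ) :
    -(1 / 8) ≤ (u t).2.1 ξ := by
  refine (abs_le.1 (h.abs_q_le_of_far hd hT ht ?_)).1
  have h1 := hξ.trans (h.lagX_le hT ht ξ)
  rw [exp_neg, ← div_eq_mul_inv, div_le_iff₀ (exp_pos _), mul_comm]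
  exact h1

/-- Labels beyond the threshold π e^{-3T} start with tiny slopes. Labels below it never pass π, so
the backward barrier applies to them. -/
theorem abs_q_le_of_nonpos {t : ℝ} (ht : t ∈ Ioo (-τ) τ) (ht0 : t ≤ 0) (ξ : ℝ) :
    |(u t).2.1 ξ| ≤ 1 / 2 := by
  rcases le_total (π * exp (-(3 * T))) (clamp ξ) with hξ | hξ
  · exact (h.abs_q_le_of_far hd hT ht hξ).trans (by norm_num)
  have hX : ∀ s ∈ Icc t 0, lagX (u s) ξ ≤ π := by
    intro s hs
    refine (h.lagX_le hT ⟨ht.1.trans_le hs.1, hs.2.trans_lt h.pos⟩ ξ).trans ?_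
    have h1 := mul_le_mul_of_nonneg_left hξ (exp_pos (3 * T)).le
    rwa [mul_left_comm, ← exp_add, add_neg_cancel, exp_zero, mul_one] at h1
  have h2 := h.neg_q_le_of_nonpos (fun s hs x => h.abs_forcing_le_of_small hd hT hs x) ht ht0
    (by linarith [hd.pos_ε]) hd.pos_a.le ξ hX (abs_le.1 (hd.q_abs_le ξ)).1
  have h3 := h.q_le_of_small hd hT ht ξ
  have h4 := hd.growth_le ((abs_lt.2 ht).le.trans hT)
  have h5 : ε + 4 * ε * |t| ≤ 1 / 8 := by
    refine le_trans (le_mul_of_one_le_right ?_ (one_le_exp (by positivity))) h4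
    have := hd.pos_ε
    positivity
  have := hd.a_le
  have := hd.pos_ε
  exact abs_le.2 ⟨by linarith, by linarith⟩

theorem norm_le_of_small {t : ℝ} (ht : t ∈ Ioo (-τ) τ) : ‖u t‖ ≤ exp (3 * T) + 2 := by
  have hE := h.energy_nonneg h.zero_mem
  have h1 := (h.abs_z0_le ht)
  have h2 : lagEnergy (u 0) * exp τ * (τ * exp τ) ≤ lagEnergy (u 0) * exp T * (T * exp T) := by
    have := h.pos
    have h3 : exp τ ≤ exp T := exp_le_exp.2 hT
    have h4 : 0 ≤ T := by linarith
    gcongr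
  have h5 := hd.z0_le
  have h6 := exp_pos (3 * T)
  refine norm_prod_le_iff.2 ⟨(h.norm_J_le hT ht).trans (by linarith), norm_prod_le_iff.2
    ⟨(h.norm_q_le t ht).trans (by linarith), ?_⟩⟩
  rw [Real.norm_eq_abs]
  linarith

theorem le_norm_q {t : ℝ} (ht : t ∈ Ioo (-τ) τ) (ht0 : 0 ≤ t) :
    a / 2 * exp (t / 4) ≤ ‖(u t).2.1‖ := by
  have h1 := h.q_zero_le (fun s hs x => h.abs_forcing_le_of_small hd hT hs x) ht ht0 hd.pos_a
    hd.ε_le hd.q_zero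
  have h2 := (u t).2.1.norm_coe_le_norm 0
  rw [Real.norm_eq_abs] at h2
  linarith [neg_abs_le ((u t).2.1 0)]

end IsLagSol

/-- The solution of the Lagrangian equations that starts from a small datum exists until its slope
has size two. -/
theorem IsSmallDatum.exists_isLagSol {T a ε : ℝ} {v : LagState} (hd : IsSmallDatum T a ε v)
    (hT : 0 < T) (hTa : 2 < a / 2 * exp (T / 4)) :
    ∃ τ, τ ≤ T ∧ ∃ u : ℝ → LagState, u 0 = v ∧ IsLagSol τ u ∧ ContinuousOn u (Icc 0 τ) ∧
      2 ≤ ‖(u τ).2.1‖ := by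
  -- One more than the a priori bound of `norm_le_of_small`, so the truncation radius is never what
  -- stops the solution.
  set R := exp (3 * T) + 3 with hR
  obtain ⟨u, hu0, huc, hud⟩ := bddLip_lagField.exists_solution v R hT
  have hq0 : ‖v.2.1‖ ≤ 1 / 4 := (BoundedContinuousFunction.norm_le (by norm_num)).2 fun x =>
    (hd.q_abs_le x).trans hd.a_le
  have hv : ‖v‖ < R := by
    have h1 : 0 ≤ lagEnergy v := by
      have h0 : ∀ x, (0 : ℝ →ᵇ ℝ) x ≤ (v.2.1 * v.2.1 * v.1) x := fun x => by
        rw [hd.init_J, mul_one]; exact mul_self_nonneg _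
      have := integ_le_integ h0 (2 * π)
      rwa [map_zero] at this
    have h2 : |v.2.2| ≤ 1 := by
      have := hd.z0_le
      have : 0 ≤ lagEnergy v * exp T * (T * exp T) := by positivity
      linarith
    have h3 := exp_pos (3 * T)
    refine lt_of_le_of_lt (norm_prod_le_iff.2 ⟨?_, norm_prod_le_iff.2 ⟨hq0.trans ?_, ?_⟩⟩ :
      ‖v‖ ≤ 1) (by linarith)
    · rw [hd.init_J]; exact norm_one.le
    · norm_num
    · exact h2
  -- The exit function watches the times t and -t together, because the solution is needed on a
  -- symmetric interval.
  set ψ : ℝ → ℝ := fun t => max (max (‖(u t).2.1‖ - 2) (‖(u (-t)).2.1‖ - 2))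
    (max (‖u t‖ - R) (‖u (-t)‖ - R)) with hψ
  have hcp : ContinuousOn u (Icc 0 T) := huc.mono (Icc_subset_Icc_left (by linarith))
  have hcn : ContinuousOn (fun t => u (-t)) (Icc 0 T) :=
    huc.comp continuousOn_neg fun t ht => ⟨neg_le_neg ht.2, by linarith [ht.1]⟩
  have hψc : ContinuousOn ψ (Icc 0 T) :=
    ((hcp.snd.fst.norm.sub continuousOn_const).sup (hcn.snd.fst.norm.sub continuousOn_const)).sup
      ((hcp.norm.sub continuousOn_const).sup (hcn.norm.sub continuousOn_const))
  have hψ0 : ψ 0 < 0 := by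
    simp only [hψ, neg_zero, hu0, max_self]
    exact max_lt (by linarith) (by linarith)
  obtain ⟨τ, hτ, hτT, hlt, hex⟩ := exists_exit_time hT hψc hψ0
  have hall : ∀ t ∈ Ioo (-τ) τ, ‖(u t).2.1‖ < 2 ∧ ‖u t‖ < R := by
    intro t ht
    have h1 := hlt |t| ⟨abs_nonneg t, abs_lt.2 ht⟩
    simp only [hψ, max_lt_iff] at h1
    rcases abs_cases t with ⟨h2, -⟩ | ⟨h2, -⟩
    · rw [h2] at h1; exact ⟨by linarith [h1.1.1], by linarith [h1.2.1]⟩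
    · rw [h2, neg_neg] at h1; exact ⟨by linarith [h1.1.2], by linarith [h1.2.2]⟩
  have hsol : IsLagSol τ u :=
    { pos := hτ
      deriv := fun t ht => hud t ⟨by linarith [ht.1], by linarith [ht.2]⟩ (hall t ht).2.le
      init_J := by rw [hu0]; exact hd.init_J
      init_q := by rw [hu0]; exact hd.init_q
      bdd := ⟨R, fun t ht => (hall t ht).2.le⟩
      norm_q_le := fun t ht => (hall t ht).1.le }
  rw [← hu0] at hd
  have hcτ : ContinuousOn u (Icc (-τ) τ) := huc.mono (Icc_subset_Icc (by linarith) hτT)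
  have hττ : -τ < τ := by linarith
  have hnorm : ∀ t ∈ Icc (-τ) τ, ‖u t‖ ≤ exp (3 * T) + 2 :=
    le_on_Icc_of_le_on_Ioo hττ hcτ.norm continuousOn_const fun t ht =>
      hsol.norm_le_of_small hd hτT ht
  have hback : ∀ t ∈ Icc (-τ) 0, ‖(u t).2.1‖ ≤ 1 / 2 :=
    le_on_Icc_of_le_on_Ioo (by linarith) (hcτ.mono (Icc_subset_Icc_right hτ.le)).snd.fst.norm
      continuousOn_const fun t ht => (BoundedContinuousFunction.norm_le (by norm_num)).2 fun ξ =>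
        hsol.abs_q_le_of_nonpos hd hτT ⟨ht.1, ht.2.trans hτ⟩ ht.2.le ξ
  have hfor : ∀ t ∈ Icc 0 τ, a / 2 * exp (t / 4) ≤ ‖(u t).2.1‖ :=
    le_on_Icc_of_le_on_Ioo hτ (by fun_prop)
      (hcτ.mono (Icc_subset_Icc_left (by linarith))).snd.fst.norm fun t ht =>
        hsol.le_norm_q hd hτT ⟨by linarith [ht.1], ht.2⟩ ht.1.le
  refine ⟨τ, hτT, u, hu0, hsol, hcτ.mono (Icc_subset_Icc_left (by linarith)), ?_⟩
  -- If no exit happens before `T`, the growth at the peak already gives slope 2 at `T`. Otherwise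
  -- one of four bounds is reached: the two norm bounds are excluded with a margin of 1, the
  -- backward slope is at most 1/2, and only the forward slope remains.
  rcases hex with rfl | hex
  · exact hTa.le.trans (hfor τ (right_mem_Icc.2 hτ.le))
  · have h1 := hnorm τ (right_mem_Icc.2 hττ.le)
    have h2 := hnorm (-τ) (left_mem_Icc.2 hττ.le)
    have h3 := hback (-τ) ⟨le_rfl, by linarith⟩
    by_contra hcon
    simp only [not_le] at hcon
    refine absurd hex (not_le.2 ?_)
    simp only [hψ, max_lt_iff]
    exact ⟨⟨by linarith, by linarith⟩, by linarith, by linarith⟩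

/-! ### The main result -/

/-- A device for choosing one small parameter that meets finitely many linear smallness conditions.
-/
theorem exists_pos_forall_mul_le (l : List (ℝ × ℝ)) (hl : ∀ p ∈ l, 0 < p.2) :
    ∃ η : ℝ, 0 < η ∧ ∀ p ∈ l, η * p.1 ≤ p.2 := by
  induction l with
  | nil => exact ⟨1, one_pos, by simp⟩
  | cons p l ih =>
    obtain ⟨η, hη, h⟩ := ih fun q hq => hl q (List.mem_cons_of_mem _ hq)
    have hp := hl p List.mem_cons_self
    refine ⟨min η (p.2 / (|p.1| + 1)), lt_min hη (by positivity), fun q hq => ?_⟩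
    have h0 : 0 < min η (p.2 / (|p.1| + 1)) := lt_min hη (by positivity)
    rcases List.mem_cons.1 hq with rfl | hq
    · have h1 := mul_le_mul_of_nonneg_left (le_abs_self q.1) h0.le
      have h2 := mul_le_mul_of_nonneg_right (min_le_right η (q.2 / (|q.1| + 1))) (abs_nonneg q.1)
      refine h1.trans (h2.trans ?_)
      rw [div_mul_eq_mul_div, div_le_iff₀ (by positivity)]
      nlinarith [abs_nonneg q.1]
    · rcases le_total 0 q.1 with h1 | h1
      · exact (mul_le_mul_of_nonneg_right (min_le_left _ _) h1).trans (h q hq)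
      · exact (mul_nonpos_of_nonneg_of_nonpos h0.le h1).trans
          (hl q (List.mem_cons_of_mem _ hq)).le

/-- Small data which satisfy the constraint. -/
theorem exists_small_datum {δ a T : ℝ} (hδ : 0 < δ) (hT : 0 < T) (ha : 0 < a) (ha4 : a ≤ 1 / 4) :
    ∃ (v : LagState) (ε : ℝ), IsSmallDatum T a ε v ∧
      (∃ L : ℝ, ∀ ξ η, |v.2.1 ξ - v.2.1 η| ≤ L * |clamp ξ - clamp η|) ∧
      ‖lagZ v‖ + ‖v.2.1‖ ≤ 2 * a ∧ 2 * π * ‖lagZ v‖ ^ 2 + lagEnergy v ≤ (δ ^ 2) ^ 2 ∧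
      1 / 2 * (integ (lagZ v * v.1) (2 * π) + 2 * lagEnergy v) + π * v.2.2 = 0 := by
  obtain ⟨ε, hε, hε'⟩ := exists_pos_forall_mul_le
    [(16, a), ((1 + 4 * T) * exp (2 * T), 1 / 8)] (by simp; exact ha)
  have e1 := hε' (16, a) (by simp)
  have e2 := hε' ((1 + 4 * T) * exp (2 * T), 1 / 8) (by simp)
  -- The parameter η bounds both the initial energy and the primitive of the slope, and is chosen
  -- after ε. The first condition makes the forcing small, the second serves the `H¹` norm, the
  -- third the `W^{1,∞}` norm, and the last two the value at the peak.
  obtain ⟨η, hη, hη'⟩ := exists_pos_forall_mul_le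
    [(exp T, ε ^ 2), (100, (δ ^ 2) ^ 2), (3, a), (exp T * (T * exp T), 1 / 2), (4, 1)]
    (by simp; exact ⟨by positivity, by positivity, ha⟩)
  have n1 := hη' (exp T, ε ^ 2) (by simp)
  have n2 := hη' (100, (δ ^ 2) ^ 2) (by simp)
  have n3 := hη' (3, a) (by simp)
  have n4 := hη' (exp T * (T * exp T), 1 / 2) (by simp)
  have n5 := hη' (4, 1) (by simp)
  simp only at e1 e2 n1 n2 n3 n4 n5
  have hx₀ : π * exp (-(3 * T)) ≤ 2 * π := by
    have : exp (-(3 * T)) ≤ 1 := exp_le_one_iff.2 (by linarith)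
    nlinarith [pi_pos]
  obtain ⟨q, hL, hq0, hqp, hqε, hqa, hqf, hqE, hqi⟩ := exists_slope_profile ha (by linarith) hε hη
    (mul_pos pi_pos (exp_pos (-(3 * T)))) hx₀
  set P := integ (q * q) (2 * π) with hP
  have hP0 : 0 ≤ P := by
    have := integ_le_integ (f := 0) (g := q * q) (fun x => mul_self_nonneg (q x)) (2 * π)
    rwa [map_zero] at this
  -- For J = 1 the constraint reads 2πz + (1/2)∫∫q + ∫q² = 0, linear in the peak value `z`; this is
  -- its solution.
  set z : ℝ := -((2 * π)⁻¹ * (integ (integ q) (2 * π) / 2 + P)) with hz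
  have hw : ‖integ q‖ ≤ η := (BoundedContinuousFunction.norm_le hη.le).2 hqi
  have hzη : |z| ≤ 2 * η := by
    have h1 : |integ (integ q) (2 * π)| ≤ 2 * π * η := by
      rw [← integ_const]
      exact abs_integ_le hqi _
    rw [hz, abs_neg, abs_mul, abs_of_pos (by positivity : 0 < (2 * π)⁻¹),
      inv_mul_le_iff₀ two_pi_pos]
    refine (abs_add_le _ _).trans ?_
    rw [abs_div, abs_two, abs_of_nonneg hP0]
    nlinarith [pi_gt_three]
  set v : LagState := (1, q, z) with hv
  have hZ : lagZ v = BoundedContinuousFunction.const ℝ z + integ q := by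
    simp only [lagZ, hv, mul_one]
  have hE : lagEnergy v = P := by simp only [lagEnergy, hv, mul_one, hP]
  have hZn : ‖lagZ v‖ ≤ 3 * η := by
    rw [hZ]
    have := BoundedContinuousFunction.norm_const_le (α := ℝ) z
    rw [Real.norm_eq_abs] at this
    refine (norm_add_le _ _).trans ?_
    linarith
  have hqn : ‖q‖ ≤ a := (BoundedContinuousFunction.norm_le ha.le).2 hqa
  refine ⟨v, ε, ?_, hL, ?_, ?_, ?_⟩
  · refine
    { pos_ε := hε
      pos_a := ha
      a_le := ha4
      ε_le := by linarith
      small := by linarith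
      energy := ?_
      z0_le := ?_
      init_J := rfl
      init_q := hq0
      q_zero := hqp
      q_le := hqε
      q_abs_le := hqa
      q_far := hqf }
    · rw [hE]
      exact (mul_le_mul_of_nonneg_right hqE (exp_pos T).le).trans n1
    · rw [hE]
      have h1 : P * exp T * (T * exp T) ≤ η * exp T * (T * exp T) := by gcongr
      have h2 : |v.2.2| ≤ 2 * η := hzη
      linarith
  · have : ‖v.2.1‖ ≤ a := hqn
    linarith
  · rw [hE]
    have h1 : ‖lagZ v‖ ^ 2 ≤ (3 * η) ^ 2 := pow_le_pow_left₀ (norm_nonneg _) hZn 2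
    have h2 : 2 * π * ‖lagZ v‖ ^ 2 ≤ 8 * (3 * η) ^ 2 :=
      mul_le_mul (by linarith [pi_lt_four]) h1 (by positivity) (by norm_num)
    nlinarith
  · rw [hE, hZ]
    have h1 : v.1 = 1 := rfl
    have h2 : v.2.2 = z := rfl
    rw [h1, h2, mul_one, map_add]
    simp only [BoundedContinuousFunction.coe_add, Pi.add_apply, integ_const]
    rw [hz]
    field_simp
    ring

end PeakedWave

theorem mainTheorem1 (δ : ℝ) (hδ : 0 < δ) :
    ∃ ζ₀ : ℝ → ℝ,
      PeakedWave.MemH1per ζ₀ ∧ PeakedWave.MemW1inf ζ₀ ∧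
      PeakedWave.normH1 ζ₀ ≤ ENNReal.ofReal (δ ^ 2) ∧
      PeakedWave.normW1inf ζ₀ ≤ ENNReal.ofReal δ ∧
      1 / 2 * (∫ x, (ζ₀ x + 2 * PeakedWave.weakDeriv ζ₀ x ^ 2) ∂PeakedWave.per)
        + π * ζ₀ 0 = 0 ∧
      ∃ τ₀ : ℝ, 0 < τ₀ ∧ ∃ ζ : ℝ → ℝ → ℝ,
        PeakedWave.IsLocalSolution τ₀ ζ ∧ ζ 0 = ζ₀ ∧
        (∀ τ₁ : ℝ, 0 < τ₁ → ∀ ζ₁ : ℝ → ℝ → ℝ,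
          PeakedWave.IsLocalSolution τ₁ ζ₁ → ζ₁ 0 = ζ₀ →
            ∀ t : ℝ, |t| < τ₀ → |t| < τ₁ → ζ₁ t = ζ t) ∧
        ∃ t₀ : ℝ, 0 < t₀ ∧ t₀ < τ₀ ∧ PeakedWave.normW1inf (ζ t₀) = 1 := by
  -- The height a = min(δ, 1)/4 and the time `T` needed for its growth to slope 2 are fixed before
  -- the width of the spike, which may depend on both.
  obtain ⟨T, hT, hTa⟩ : ∃ T : ℝ, 0 < T ∧ 2 < min δ 1 / 4 / 2 * exp (T / 4) := by
    have ha : 0 < min δ 1 / 4 / 2 := by positivity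
    have h1 : Filter.Tendsto (fun T : ℝ => min δ 1 / 4 / 2 * exp (T / 4)) Filter.atTop
        Filter.atTop :=
      (Real.tendsto_exp_atTop.comp (Filter.tendsto_id.atTop_div_const four_pos)).const_mul_atTop ha
    exact ((Filter.eventually_gt_atTop 0).and (h1.eventually_gt_atTop 2)).exists
  have hm : 0 < min δ 1 := lt_min hδ one_pos
  obtain ⟨v, ε, hd, ⟨L, hL⟩, hW, hH, hcon⟩ := PeakedWave.exists_small_datum hδ hT
    (a := min δ 1 / 4) (by positivity) (by linarith [min_le_right δ 1])
  obtain ⟨τ, hτT, u, rfl, hsol, huc, hexit⟩ := hd.exists_isLagSol hT hTa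
  have hc := exp_pos (-(3 * τ))
  have hmem := hsol.zero_mem
  have hJ := hsol.exp_le_J hmem
  have h2 := hsol.lagX_two_pi hmem
  have h3 := hsol.integ_mul_two_pi hmem
  refine ⟨PeakedWave.eulPert (u 0), PeakedWave.memH1per_eulPert hc hJ h2 h3,
    PeakedWave.memW1inf_eulPert hc hJ h2 h3,
    PeakedWave.normH1_eulPert_le hc hJ h2 h3 (sq_nonneg δ) hH, ?_, ?_, τ, hsol.pos,
    fun t => PeakedWave.eulPert (u t), hsol.isLocalSolution, rfl, ?_, ?_⟩
  · rw [PeakedWave.normW1inf_eulPert hc hJ h2 h3 (hsol.q_clamp hL hmem)]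
    exact ENNReal.ofReal_le_ofReal (by linarith [min_le_left δ 1])
  · rw [PeakedWave.integral_constraint hc hJ h2 h3, PeakedWave.eulPert_zero hc hJ h2 h3]
    exact hcon
  · intro τ₁ hτ₁ ζ₁ hζ₁ h0 t ht ht₁
    have hp := pi_gt_three
    exact hsol.unique hL (fun s hs ξ => (hsol.q_le_of_small hd hτT hs ξ).trans (by linarith))
      (fun s hs ξ hξ => le_trans (by linarith) (hsol.le_q_of_pi_le hd hτT hs hξ)) hτ₁ hζ₁ h0 ht ht₁
  · have hN : ContinuousOn (fun t => ‖PeakedWave.lagZ (u t)‖ + ‖(u t).2.1‖) (Icc 0 τ) :=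
      (PeakedWave.bddLip_lagZ.continuous.comp_continuousOn huc).norm.add huc.snd.fst.norm
    obtain ⟨t, ht, hNt⟩ := intermediate_value_Ioo hsol.pos.le hN
      (show (1 : ℝ) ∈ Ioo _ _ from ⟨by linarith [min_le_right δ 1],
        by linarith [norm_nonneg (PeakedWave.lagZ (u τ))]⟩)
    have hmt : t ∈ Ioo (-τ) τ := ⟨by linarith [ht.1, hsol.pos], ht.2⟩
    refine ⟨t, ht.1, ht.2, ?_⟩
    rw [PeakedWave.normW1inf_eulPert hc (hsol.exp_le_J hmt) (hsol.lagX_two_pi hmt)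
      (hsol.integ_mul_two_pi hmt) (hsol.q_clamp hL hmt)]
    simp only at hNt
    rw [hNt, ENNReal.ofReal_one]
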